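/- **Setting.** Let $\omega\subset\mathbb R^2$ be a domain and let $\Gamma_D\subset\partial\omega$ have positive one-dimensional length. Let $\mathcal T_h$ be a conforming triangulation of $\overline\omega$ into nondegenerate closed triangles, with vertices $\mathcal N_h$, such that $\Gamma_D$ is a union of edges. Put $h_T=\operatorname{diam}T$, $h_{\min}=\min_T h_T$ and $|\omega|=\sum_T|T|$. $\mathcal T_h$ is $\sigma$-shape-regular if every $T\in\mathcal T_h$ contains a disc of radius $r>0$ with $h_T\le\sigma r$. Let $V_h=\mathcal S^{\rm dkt}(\mathcal T_h)^3$, where $\mathcal S^{\rm dkt}(\mathcal T_h)$ is the space of $w\in C(\overline\omega)$ such that $\nabla w$ is continuous at the vertices and, on each $T$, $w|_T$ is a polynomial of degree $\le3$ with $w(x_T)=\frac16\sum_{z\in\mathcal N_h\cap T}(2w(z)-\nabla w(z)\cdot(z-x_T))$, $x_T$ the centre of gravity of $T$. For $w\in\mathcal S^{\rm dkt}(\mathcal T_h)$ the discrete gradient $\nabla_hw$ is the continuous piecewise quadratic field that equals $\nabla w$ at the vertices and, at the midpoint $z_E$ of an edge $E$ with endpoints $z_E^1,z_E^2$, unit tangent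 $t_E$ and unit normal $n_E$, satisfies $\nabla_hw(z_E)\cdot t_E=\nabla w(z_E)\cdot t_E$ and $\nabla_hw(z_E)\cdot n_E=\frac12[\nabla w(z_E^1)+\nabla w(z_E^2)]\cdot n_E$. Let $\nabla_h$ act componentwise on $V_h$, $\Delta_h=\operatorname{div}\nabla_h$, let $\widehat{\mathcal I}_h^1$ be elementwise linear nodal interpolation, and set $(y,w)_*=\int_\omega\nabla\nabla_hy:\nabla\nabla_hw\,dx$, $\|w\|_*^2=(w,w)_*$. For $\alpha\in\mathbb R$ and $y\in V_h$ let $$\widetilde E_h[y]=\tfrac12\|y\|_*^2-\alpha\int_\omega\widehat{\mathcal I}^1_h\{\Delta_hy\cdot(\partial_1y\times\partial_2y)\}\,dx+\alpha^2|\omega| .$$ For given boundary data $y_D,\phi_D$, let $\mathcal A_h$ be the set of $y\in V_h$ with $y=y_D$, $\nabla y=\phi_D$ at all $z\in\mathcal N_h\cap\Gamma_D$ and $[\nabla y(z)]^\top\nabla y(z)=I_2$ for all $z\in\mathcal N_h$. For $y\in V_h$ let $\mathcal F_h[y]$ be the set of $w\in V_h$ with $w=0$, $\nabla w=0$ at all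 $z\in\mathcal N_h\cap\Gamma_D$ and $[\nabla w(z)]^\top\nabla y(z)+[\nabla y(z)]^\top\nabla w(z)=0$ for all $z\in\mathcal N_h$. **Linearized isometry flow.** Given $\tau>0$ and $y_h^0\in\mathcal A_h$, for $k=1,2,\dots$ find $d_ty_h^k\in\mathcal F_h[y_h^{k-1}]$ such that for all $w\in\mathcal F_h[y_h^{k-1}]$ $$\begin{aligned}(d_ty_h^k,w)_*=&-(y_h^{k-1},w)_*-\tau(d_ty_h^k,w)_*+\alpha\int_\omega\widehat{\mathcal I}_h^1\{\Delta_hw\cdot(\partial_1y_h^{k-1}\times\partial_2y_h^{k-1})\}\,dx\\&+\alpha\int_\omega\widehat{\mathcal I}_h^1\{\Delta_hy_h^{k-1}\cdot(\partial_1w\times\partial_2y_h^{k-1}+\partial_1y_h^{k-1}\times\partial_2w)\}\,dx,\end{aligned}$$ and set $y_h^k=y_h^{k-1}+\tau d_ty_h^k$. **Theorem.** Let $\omega,\Gamma_D$, $\alpha\in\mathbb R$, $\sigma\in\mathbb R$, $\delta>0$ and $M>0$ be given. There are constants $C,\widetilde C>0$, depending only on these (in particular not on $\mathcal T_h$, $\tau$,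 the boundary data, $y_h^0$ or $L$), such that the following holds for every $\sigma$-shape-regular $\mathcal T_h$ as above with $|\log h_{\min}|\ge\delta$, all boundary data, every $y_h^0\in\mathcal A_h$ with $\widetilde E_h[y_h^0]\le M$, and every $\tau>0$. 1. The iterates are well defined: every step has exactly one solution, so there is exactly one sequence $(y_h^L)_{L\ge0}$. 2. If $C\tau|\log h_{\min}|\le1$, then for all $L\ge0$ $$\widetilde E_h[y_h^L]+(1-C\tau|\log h_{\min}|)\,\tau\sum_{k=1}^L\|d_ty_h^k\|_*^2\le\widetilde E_h[y_h^0].$$ 3. If $\tau\le(2C|\log h_{\min}|)^{-1}$, then for all $L\ge0$ $$\max_{z\in\mathcal N_h}\bigl|[\nabla y_h^L(z)]^\top\nabla y_h^L(z)-I_2\bigr|\le\widetilde C\,\tau|\log h_{\min}|\,\bigl(\widetilde E_h[y_h^0]-\widetilde E_h[y_h^L]\bigr),$$ and, if moreover $\widetilde E_h[y_h^0]\ge M^{-1}$, $$\max_{z\in\mathcal N_h}\bigl|[\nabla y_h^L(z)]^\top\nabla y_h^L(z)-I_2\bigr|\le\widetilde C\,\tau|\log h_{\min}|\,\widetilde E_h[y_h^0].$$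 Here $|\cdot|$ is the Frobenius norm. -/

import Mathlib

open MeasureTheory

namespace BilayerPlate

/-- The Euclidean plane, in which the reference configuration lives. -/
abbrev Plane := EuclideanSpace ℝ (Fin 2)

/-- Polynomials in two real variables. -/
abbrev Poly := MvPolynomial (Fin 2) ℝ

/-- The value of a polynomial at a point of the plane. -/
noncomputable def Poly.val (p : Poly) (x : Plane) : ℝ := MvPolynomial.eval (fun i => x i) p

/-- The gradient of a polynomial at a point of the plane. -/
noncomputable def Poly.grad (p : Poly) (x : Plane) : Plane :=
  WithLp.toLp 2 fun j => Poly.val (MvPolynomial.pderiv j p) x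

/-- A conforming triangulation of (the closure of) a planar set `ω` into `n` closed, nondegenerate
triangles. The intersection of two of them is the convex hull of their common vertices, that is, it
is empty, a common vertex, a common side, or the two triangles coincide. -/
structure Triangulation (ω : Set Plane) where
  /-- the number of triangles -/
  n : ℕ
  /-- the three vertices of each triangle -/
  vert : Fin n → Fin 3 → Plane
  nondegenerate : ∀ t, AffineIndependent ℝ (vert t)
  distinct : Function.Injective fun t => Set.range (vert t)
  conforming : ∀ t t', convexHull ℝ (Set.range (vert t)) ∩ convexHull ℝ (Set.range (vert t')) =
    convexHull ℝ (Set.range (vert t) ∩ Set.range (vert t'))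
  covers : ⋃ t, convexHull ℝ (Set.range (vert t)) = closure ω

namespace Triangulation

variable {ω : Set Plane} (T : Triangulation ω)

/-- The closed triangle with index `t`. -/
def cell (t : Fin T.n) : Set Plane := convexHull ℝ (Set.range (T.vert t))

/-- The diameter of the triangle with index `t`. -/
noncomputable def diam (t : Fin T.n) : ℝ := Metric.diam (T.cell t)

/-- The minimal diameter of the triangles. -/
noncomputable def hmin : ℝ := ⨅ t, T.diam t

/-- Shape regularity with parameter `σ`: every triangle `K` contains a disc of radius `r`
with `diam K ≤ σ r`. -/
def ShapeRegular (σ : ℝ) : Prop :=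
  ∀ t, ∃ (x : Plane) (r : ℝ), 0 < r ∧ Metric.closedBall x r ⊆ T.cell t ∧ T.diam t ≤ σ * r

/-- The edge of the triangle `t` that is opposite to its vertex `i`. -/
def edge (t : Fin T.n) (i : Fin 3) : Set Plane := segment ℝ (T.vert t (i + 1)) (T.vert t (i + 2))

/-- The set `Γ` is a union of edges of the triangulation. -/
def Matches (Γ : Set Plane) : Prop :=
  ∃ S : Set (Fin T.n × Fin 3), Γ = ⋃ e ∈ S, T.edge e.1 e.2

/-- The total area of the triangles. -/
noncomputable def area : ℝ := ∑ t, volume.real (T.cell t)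

/-- The integral over `ω` of a function that is given on each triangle by a polynomial. -/
noncomputable def integral (p : Fin T.n → Poly) : ℝ := ∑ t, ∫ x in T.cell t, Poly.val (p t) x

/-- The barycentric coordinate of the triangle `t` that belongs to its vertex `i`, as a polynomial:
`det (x - b, c - b) / det (a - b, c - b)` for the vertices `a` (with index `i`), `b`, `c`. -/
noncomputable def bary (t : Fin T.n) (i : Fin 3) : Poly :=
  let a := T.vert t i
  let b := T.vert t (i + 1)
  let c := T.vert t (i + 2)
  MvPolynomial.C ((a 0 - b 0) * (c 1 - b 1) - (a 1 - b 1) * (c 0 - b 0))⁻¹ *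
    ((MvPolynomial.X 0 - MvPolynomial.C (b 0)) * MvPolynomial.C (c 1 - b 1) -
      (MvPolynomial.X 1 - MvPolynomial.C (b 1)) * MvPolynomial.C (c 0 - b 0))

/-- The elementwise linear interpolant of a function with (elementwise) vertex values `g`. -/
noncomputable def interp (g : Fin T.n → Fin 3 → ℝ) (t : Fin T.n) : Poly :=
  ∑ i, MvPolynomial.C (g t i) * T.bary t i

/-- The centre of gravity of the triangle `t`. -/
noncomputable def center (t : Fin T.n) : Plane := (1 / 3 : ℝ) • ∑ i, T.vert t i

/-- The reduced cubic polynomials on the triangle `t`. -/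
def IsReducedCubic (t : Fin T.n) (p : Poly) : Prop :=
  p.totalDegree ≤ 3 ∧ Poly.val p (T.center t) = (1 / 6 : ℝ) * ∑ i, (2 * Poly.val p (T.vert t i) -
    inner ℝ (Poly.grad p (T.vert t i)) (T.vert t i - T.center t))

/-- The scalar discrete Kirchhoff triangle space. A function in it is represented by its polynomial
pieces (one on each triangle); they are reduced cubics, fit together to a continuous function on the
closure of `ω`, and have gradients that agree at the common vertices of the triangles. -/
noncomputable def dkt : Submodule ℝ (Fin T.n → Poly) where
  carrier := {p | (∀ t, T.IsReducedCubic t (p t)) ∧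
    (∀ t t', ∀ x ∈ T.cell t ∩ T.cell t', Poly.val (p t) x = Poly.val (p t') x) ∧
    (∀ t t' i i', T.vert t i = T.vert t' i' →
      Poly.grad (p t) (T.vert t i) = Poly.grad (p t') (T.vert t' i'))}
  zero_mem' := by
    refine ⟨fun t => ⟨by simp, ?_⟩, fun t t' x _ => by simp, fun t t' i i' _ => ?_⟩
    · simp [Poly.val, Poly.grad, PiLp.inner_apply]
    · simp [Poly.val, Poly.grad]
  add_mem' := by
    rintro p q ⟨hp1, hp2, hp3⟩ ⟨hq1, hq2, hq3⟩
    have hg : ∀ (a b : Poly) (x : Plane), Poly.grad (a + b) x = Poly.grad a x + Poly.grad b x := by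
      intro a b x; ext j; simp [Poly.grad, Poly.val]
    have hv : ∀ (a b : Poly) (x : Plane), Poly.val (a + b) x = Poly.val a x + Poly.val b x := by
      intro a b x; simp [Poly.val]
    refine ⟨fun t => ⟨?_, ?_⟩, fun t t' x hx => ?_, fun t t' i i' h => ?_⟩
    · exact (MvPolynomial.totalDegree_add _ _).trans (max_le (hp1 t).1 (hq1 t).1)
    · rw [Pi.add_apply, hv, (hp1 t).2, (hq1 t).2, ← mul_add, ← Finset.sum_add_distrib]
      congr 1
      refine Finset.sum_congr rfl fun i _ => ?_
      rw [hv, hg, inner_add_left]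
      ring
    · rw [Pi.add_apply, Pi.add_apply, hv, hv, hp2 t t' x hx, hq2 t t' x hx]
    · rw [Pi.add_apply, Pi.add_apply, hg, hg, hp3 t t' i i' h, hq3 t t' i i' h]
  smul_mem' := by
    rintro c p ⟨hp1, hp2, hp3⟩
    have hg : ∀ (a : Poly) (x : Plane), Poly.grad (c • a) x = c • Poly.grad a x := by
      intro a x; ext j; simp [Poly.grad, Poly.val, MvPolynomial.smul_eval]
    have hv : ∀ (a : Poly) (x : Plane), Poly.val (c • a) x = c * Poly.val a x := by
      intro a x; simp [Poly.val, MvPolynomial.smul_eval]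
    refine ⟨fun t => ⟨?_, ?_⟩, fun t t' x hx => ?_, fun t t' i i' h => ?_⟩
    · exact (MvPolynomial.totalDegree_smul_le _ _).trans (hp1 t).1
    · rw [Pi.smul_apply, hv, (hp1 t).2, mul_left_comm, Finset.mul_sum]
      congr 1
      refine Finset.sum_congr rfl fun i _ => ?_
      rw [hv, hg, real_inner_smul_left]
      ring
    · rw [Pi.smul_apply, Pi.smul_apply, hv, hv, hp2 t t' x hx]
    · rw [Pi.smul_apply, Pi.smul_apply, hg, hg, hp3 t t' i i' h]

/-- The vector-valued discrete Kirchhoff triangle space, the space of discrete deformations. -/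
abbrev Deformation := Fin 3 → T.dkt

/-- The unit tangent of the edge opposite to the vertex `i` of the triangle `t`. -/
noncomputable def tangent (t : Fin T.n) (i : Fin 3) : Plane :=
  ‖T.vert t (i + 2) - T.vert t (i + 1)‖⁻¹ • (T.vert t (i + 2) - T.vert t (i + 1))

/-- A unit normal of the edge opposite to the vertex `i` of the triangle `t`. -/
noncomputable def normal (t : Fin T.n) (i : Fin 3) : Plane :=
  !₂[-(T.tangent t i 1), T.tangent t i 0]

/-- The midpoint of the edge opposite to the vertex `i` of the triangle `t`. -/
noncomputable def mid (t : Fin T.n) (i : Fin 3) : Plane :=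
  midpoint ℝ (T.vert t (i + 1)) (T.vert t (i + 2))

/-- The value of the discrete gradient at the midpoint of an edge: its tangential component is that
of the gradient at the midpoint, its normal component is the mean of the normal components of the
gradients at the two endpoints. -/
noncomputable def midGrad (t : Fin T.n) (p : Poly) (i : Fin 3) : Plane :=
  ((1 / 2 : ℝ) * inner ℝ (Poly.grad p (T.vert t (i + 1)) + Poly.grad p (T.vert t (i + 2)))
      (T.normal t i)) • T.normal t i +
    (inner ℝ (Poly.grad p (T.mid t i)) (T.tangent t i) : ℝ) • T.tangent t i

/-- The component `j` of the discrete gradient of `p` on the triangle `t`: the quadratic polynomial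
with the value of `∂ⱼ p` at the three vertices and the value prescribed by `midGrad` at the midpoints
of the three edges. -/
noncomputable def discreteGrad (t : Fin T.n) (p : Poly) (j : Fin 2) : Poly :=
  ∑ i, (MvPolynomial.C (Poly.grad p (T.vert t i) j) *
      (T.bary t i * (MvPolynomial.C 2 * T.bary t i - 1)) +
    MvPolynomial.C (T.midGrad t p i j) *
      (MvPolynomial.C 4 * T.bary t (i + 1) * T.bary t (i + 2)))

/-- The second discrete derivative `∂ₖ` of component `j` of the discrete gradient of the component
`a` of a deformation, on the triangle `t`. -/
noncomputable def discreteHess (y : T.Deformation) (t : Fin T.n) (a : Fin 3) (j k : Fin 2) : Poly :=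
  MvPolynomial.pderiv k (T.discreteGrad t ((y a).1 t) j)

/-- The discrete Laplacian (the divergence of the discrete gradient) at the vertex `i` of the
triangle `t`, evaluated from inside this triangle. -/
noncomputable def discreteLaplacian (y : T.Deformation) (t : Fin T.n) (i : Fin 3) : Fin 3 → ℝ :=
  fun a => ∑ j, Poly.val (T.discreteHess y t a j j) (T.vert t i)

/-- The gradient, a `3 × 2` matrix, at the vertex `i` of the triangle `t`. -/
noncomputable def nodalGrad (y : T.Deformation) (t : Fin T.n) (i : Fin 3) :
    Matrix (Fin 3) (Fin 2) ℝ :=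
  Matrix.of fun a j => Poly.grad ((y a).1 t) (T.vert t i) j

/-- The partial derivative `∂ⱼ y` at the vertex `i` of the triangle `t`. -/
noncomputable def nodalPartial (j : Fin 2) (y : T.Deformation) (t : Fin T.n) (i : Fin 3) :
    Fin 3 → ℝ :=
  fun a => T.nodalGrad y t i a j

/-- The scalar product `(y, w)_* = ∫ ∇∇ₕ y : ∇∇ₕ w`. -/
noncomputable def star (y w : T.Deformation) : ℝ :=
  T.integral fun t => ∑ a, ∑ j, ∑ k, T.discreteHess y t a j k * T.discreteHess w t a j k

/-- The integral of the elementwise linear interpolant of `Δₕ u · (∂₁ v × ∂₂ w)`. -/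
noncomputable def cubicForm (u v w : T.Deformation) : ℝ :=
  T.integral (T.interp fun t i => dotProduct (T.discreteLaplacian u t i)
    (crossProduct (T.nodalPartial 0 v t i) (T.nodalPartial 1 w t i)))

/-- The discrete energy
`½ ∫ |∇∇ₕ y|² - α ∫ Iₕ{Δₕ y · (∂₁ y × ∂₂ y)} + α² |ω|`. -/
noncomputable def energy (α : ℝ) (y : T.Deformation) : ℝ :=
  1 / 2 * T.star y y - α * T.cubicForm y y y + α ^ 2 * T.area

/-- The discrete admissible set for the Dirichlet boundary `Γ` and the boundary data `yD`, `φD`. -/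
def Admissible (Γ : Set Plane) (yD : Plane → Fin 3 → ℝ) (φD : Plane → Matrix (Fin 3) (Fin 2) ℝ) :
    Set T.Deformation :=
  {y | (∀ t i, T.vert t i ∈ Γ → (∀ a, Poly.val ((y a).1 t) (T.vert t i) = yD (T.vert t i) a) ∧
      T.nodalGrad y t i = φD (T.vert t i)) ∧
    ∀ t i, (T.nodalGrad y t i).transpose * T.nodalGrad y t i = 1}

/-- The discrete tangent space at `y`: the isometry constraint is linearized at the nodes. -/
def TangentSpace (Γ : Set Plane) (y : T.Deformation) : Set T.Deformation :=
  {w | (∀ t i, T.vert t i ∈ Γ → (∀ a, Poly.val ((w a).1 t) (T.vert t i) = 0) ∧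
      T.nodalGrad w t i = 0) ∧
    ∀ t i, (T.nodalGrad w t i).transpose * T.nodalGrad y t i +
      (T.nodalGrad y t i).transpose * T.nodalGrad w t i = 0}

/-- `d` solves the linear problem for the update at the deformation `y`. -/
structure IsUpdate (Γ : Set Plane) (α τ : ℝ) (y d : T.Deformation) : Prop where
  mem : d ∈ T.TangentSpace Γ y
  eq : ∀ w ∈ T.TangentSpace Γ y, T.star d w = -T.star y w - τ * T.star d w +
    α * T.cubicForm w y y + α * T.cubicForm y w y + α * T.cubicForm y y w

/-- The difference quotient `(y^(k+1) - y^k) / τ`, that is `dₜ y^(k+1)`. -/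
noncomputable def dt (τ : ℝ) (y : ℕ → T.Deformation) (k : ℕ) : T.Deformation :=
  τ⁻¹ • (y (k + 1) - y k)

/-- `y` is the sequence of iterates of the linearized isometry flow with step size `τ` and initial
value `y₀` (continued without regard to a stopping criterion). -/
structure IsIsoFlow (Γ : Set Plane) (α τ : ℝ) (y₀ : T.Deformation) (y : ℕ → T.Deformation) :
    Prop where
  init : y 0 = y₀
  step : ∀ k, T.IsUpdate Γ α τ (y k) (T.dt τ y k)

/-- The discrete maximum norm `‖(∇y)ᵀ ∇y - I‖` of the isometry violation, with the Frobenius norm of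
matrices. An elementwise linear interpolant attains its maximal modulus at vertices. -/
noncomputable def isometryViolation (y : T.Deformation) : ℝ :=
  ⨆ z : Fin T.n × Fin 3, Real.sqrt (∑ j, ∑ k,
    (((T.nodalGrad y z.1 z.2).transpose * T.nodalGrad y z.1 z.2 - 1 :
      Matrix (Fin 2) (Fin 2) ℝ) j k) ^ 2)

end Triangulation

end BilayerPlate

/-! The energy is a quadratic minus a cubic polynomial in `y`. When the step equation is tested with
the increment `d` itself, the first-order part of the energy expansion becomes
$-\tau(1+\tau)\|d\|_*^2$. What is left, besides $\frac{\tau^2}{2}\|d\|_*^2$, are cubic terms that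
contain `d` at least twice (`energy_add_smul`). Such a term is bounded by the $\|\cdot\|_*$-norm of
the factor under the Laplacian times the nodal maxima of the gradients of the two other factors
(`abs_cubicForm_le`). Two maximum bounds are therefore needed: one for the nodal gradients of `d`,
one for those of the iterates.

The first is a discrete Sobolev inequality. The discrete gradient of `d` is continuous and vanishes
on `Γ`; in two dimensions its maximum misses being controlled by its Dirichlet integral only by a
logarithm, so that the nodal gradients are at most $C|\log h_{\min}|^{1/2}\|d\|_*$
(`exists_discrete_sobolev`). The constant must not depend on the triangulation, and the only
regularity of the domain at hand is that its closure is a finite union of triangles. One reference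
triangulation is fixed once and for all, and it provides the geometry: every point `x` of the
closure lies in a convex reference triangle containing a ball of fixed size away from `x`.
Integrating along the segments from this ball towards `x`, stopped at the scale of a disc in the
given small triangle, costs $\int ds/s$, the logarithm. The reference balls are compared with one
another along chains in `ω`, and one of them with an edge in `Γ`. An inverse estimate leads from the
centre of the disc to the vertex. All this uses only upper gradients along segments
(`IsUpperGradient`).

The second bound comes from the linearized constraint: it removes the first-order change of the Gram
matrix of the nodal gradient, which in each step grows exactly by $\tau^2\nabla d^\top\nabla d$
(`gram_step`). With the Sobolev inequality, the accumulated violation is at most $C\tau|\log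
h_{\min}|$ times the dissipated energy. Energy decay and the bound of the iterates depend on each
other and are proved in one induction (`flow_decay`).

Solvability of a step is linear algebra: the product $(\cdot,\cdot)_*$ is definite under the
boundary conditions. A deformation with zero norm has zero nodal gradients by the Sobolev
inequality; by unisolvence it is constant on each triangle, hence constant by connectedness, hence
zero by the boundary condition. -/

namespace BilayerPlate

/-! ### Evaluation of polynomials, and cubics restricted to lines -/

namespace Poly

theorem continuous_val (P : Poly) : Continuous (Poly.val P) := by
  have h : Continuous fun x : Plane => (fun i => x i : Fin 2 → ℝ) := by fun_prop
  exact (MvPolynomial.continuous_eval P).comp h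

@[simp] theorem val_zero (x : Plane) : Poly.val 0 x = 0 := by simp [Poly.val]
@[simp] theorem val_one (x : Plane) : Poly.val 1 x = 1 := by simp [Poly.val]
@[simp] theorem val_C (c : ℝ) (x : Plane) : Poly.val (MvPolynomial.C c) x = c := by
  simp [Poly.val]
@[simp] theorem val_X (i : Fin 2) (x : Plane) : Poly.val (MvPolynomial.X i) x = x i := by
  simp [Poly.val]
@[simp] theorem val_add (p q : Poly) (x : Plane) :
    Poly.val (p + q) x = Poly.val p x + Poly.val q x := by simp [Poly.val]
@[simp] theorem val_sub (p q : Poly) (x : Plane) :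
    Poly.val (p - q) x = Poly.val p x - Poly.val q x := by simp [Poly.val]
@[simp] theorem val_mul (p q : Poly) (x : Plane) :
    Poly.val (p * q) x = Poly.val p x * Poly.val q x := by simp [Poly.val]
@[simp] theorem val_smul (c : ℝ) (q : Poly) (x : Plane) :
    Poly.val (c • q) x = c * Poly.val q x := by simp [Poly.val, MvPolynomial.smul_eval]
@[simp] theorem val_sum {ι : Type*} (s : Finset ι) (f : ι → Poly) (x : Plane) :
    Poly.val (∑ i ∈ s, f i) x = ∑ i ∈ s, Poly.val (f i) x := by simp [Poly.val]

@[simp] theorem grad_C (c : ℝ) (x : Plane) : Poly.grad (MvPolynomial.C c) x = 0 := by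
  ext j; simp [Poly.grad]
@[simp] theorem grad_add (p q : Poly) (x : Plane) :
    Poly.grad (p + q) x = Poly.grad p x + Poly.grad q x := by
  ext j; simp [Poly.grad]
@[simp] theorem grad_sub (p q : Poly) (x : Plane) :
    Poly.grad (p - q) x = Poly.grad p x - Poly.grad q x := by
  ext j; simp [Poly.grad]
@[simp] theorem grad_smul (c : ℝ) (q : Poly) (x : Plane) :
    Poly.grad (c • q) x = c • Poly.grad q x := by
  ext j; simp [Poly.grad]

theorem inner_grad (P : Poly) (x q : Plane) :
    inner ℝ (Poly.grad P x) q = ∑ j, Poly.val (MvPolynomial.pderiv j P) x * q j := by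
  simp [Poly.grad, PiLp.inner_apply, mul_comm]

/-- The chain rule along a line. -/
theorem hasDerivAt_line (P : Poly) (x q : Plane) (s : ℝ) :
    HasDerivAt (fun s : ℝ => Poly.val P (x + s • q))
      (inner ℝ (Poly.grad P (x + s • q)) q) s := by
  rw [inner_grad]
  induction P using MvPolynomial.induction_on with
  | C c => simpa using hasDerivAt_const s c
  | add p r hp hr =>
    simp only [val_add]
    refine (hp.add hr).congr_deriv ?_
    simp [add_mul, Finset.sum_add_distrib]
  | mul_X p i hp =>
    have h1 : HasDerivAt (fun s : ℝ => x i + s * q i) (q i) s := by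
      simpa using ((hasDerivAt_id s).mul_const (q i)).const_add (x i)
    have e : (fun s : ℝ => Poly.val (p * MvPolynomial.X i) (x + s • q)) =
        fun s : ℝ => Poly.val p (x + s • q) * (x i + s * q i) := by ext; simp
    rw [e]
    refine (hp.mul h1).congr_deriv ?_
    simp only [MvPolynomial.pderiv_mul, MvPolynomial.pderiv_X, val_add, val_mul, val_X,
      add_mul, Finset.sum_add_distrib]
    congr 1
    · rw [Finset.sum_mul]
      refine Finset.sum_congr rfl fun j _ => ?_
      simp; ring
    · rw [Finset.sum_eq_single i]
      · simp
      · intro j _ hj; simp [hj.symm]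
      · simp

/-- The restriction of a cubic polynomial to a line. -/
theorem exists_cubic_line (P : Poly) (hP : P.totalDegree ≤ 3) (x q : Plane) :
    ∃ c₀ c₁ c₂ c₃ : ℝ,
      (∀ s : ℝ, Poly.val P (x + s • q) = c₀ + c₁ * s + c₂ * s ^ 2 + c₃ * s ^ 3) ∧
      ∀ s : ℝ, inner ℝ (Poly.grad P (x + s • q)) q = c₁ + 2 * c₂ * s + 3 * c₃ * s ^ 2 := by
  set f : Polynomial ℝ := MvPolynomial.aeval
    (fun i : Fin 2 => Polynomial.C (x i) + Polynomial.C (q i) * Polynomial.X) P with hf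
  have hdeg : f.natDegree ≤ 3 := by
    have := MvPolynomial.aeval_natDegree_le P hP
      (fun i : Fin 2 => Polynomial.C (x i) + Polynomial.C (q i) * Polynomial.X) (n := 1)
      (fun i => by compute_degree)
    exact this
  have hval : ∀ s : ℝ, Poly.val P (x + s • q) = f.eval s := by
    intro s
    have h1 : f.eval s = Polynomial.aeval s f := by rw [Polynomial.coe_aeval_eq_eval]
    rw [h1, hf, ← AlgHom.comp_apply, MvPolynomial.comp_aeval]
    have h2 : (fun i : Fin 2 => (Polynomial.aeval s) (Polynomial.C (x i) +
        Polynomial.C (q i) * Polynomial.X)) = fun i => (x + s • q) i := by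
      ext i
      simp only [map_add, map_mul, Polynomial.aeval_C, Polynomial.aeval_X, PiLp.add_apply,
        PiLp.smul_apply, smul_eq_mul, Algebra.algebraMap_self, RingHom.id_apply]
      ring
    rw [h2]; rfl
  have hval' : ∀ s : ℝ, Poly.val P (x + s • q) =
      f.coeff 0 + f.coeff 1 * s + f.coeff 2 * s ^ 2 + f.coeff 3 * s ^ 3 := by
    intro s
    rw [hval, Polynomial.eval_eq_sum_range' (Nat.lt_succ_of_le hdeg)]
    simp [Finset.sum_range_succ]
  refine ⟨f.coeff 0, f.coeff 1, f.coeff 2, f.coeff 3, hval', fun s => ?_⟩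
  have h1 := hasDerivAt_line P x q s
  have h2 : HasDerivAt (fun s : ℝ => f.coeff 0 + f.coeff 1 * s + f.coeff 2 * s ^ 2 +
      f.coeff 3 * s ^ 3) (f.coeff 1 * 1 + f.coeff 2 * (2 * s ^ 1) + f.coeff 3 * (3 * s ^ 2)) s := by
    refine ((((hasDerivAt_id s).const_mul _).const_add _).add ?_).add ?_
    · simpa using (hasDerivAt_pow 2 s).const_mul (f.coeff 2)
    · simpa using (hasDerivAt_pow 3 s).const_mul (f.coeff 3)
  simp_rw [hval'] at h1
  rw [h1.unique h2]; ring

/-- The tangential derivative of a cubic at the midpoint of a segment in terms of the data at the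
endpoints. -/
theorem inner_grad_midpoint (P : Poly) (hP : P.totalDegree ≤ 3) (a b : Plane) :
    inner ℝ (Poly.grad P (midpoint ℝ a b)) (b - a) =
      3 / 2 * (Poly.val P b - Poly.val P a) -
        1 / 4 * inner ℝ (Poly.grad P a + Poly.grad P b) (b - a) := by
  obtain ⟨c₀, c₁, c₂, c₃, h, h'⟩ := exists_cubic_line P hP a (b - a)
  have e0 : a + (0 : ℝ) • (b - a) = a := by simp
  have e1 : a + (1 : ℝ) • (b - a) = b := by simp
  have e2 : a + (1 / 2 : ℝ) • (b - a) = midpoint ℝ a b := by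
    rw [midpoint_eq_smul_add, invOf_eq_inv]; module
  have h0 := h 0; have h1 := h 1
  have h0' := h' 0; have h1' := h' 1; have h2' := h' (1 / 2)
  rw [e0] at h0 h0'; rw [e1] at h1 h1'; rw [e2] at h2'
  rw [inner_add_left, h0, h1, h0', h1', h2']; ring

/-- A cubic with a double zero and two further zeros on a line vanishes on this line. -/
theorem val_line_eq_zero (P : Poly) (hP : P.totalDegree ≤ 3) (x q : Plane)
    (h0 : Poly.val P x = 0) (h0' : Poly.grad P x = 0) {s r : ℝ} (hs : s ≠ 0) (hr : r ≠ 0)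
    (hsr : s ≠ r) (h1 : Poly.val P (x + s • q) = 0) (h2 : Poly.val P (x + r • q) = 0) (l : ℝ) :
    Poly.val P (x + l • q) = 0 := by
  obtain ⟨c₀, c₁, c₂, c₃, h, h'⟩ := exists_cubic_line P hP x q
  have e0 := h 0; have e0' := h' 0
  simp only [zero_smul, add_zero, h0, h0', inner_zero_left] at e0 e0'
  have c0 : c₀ = 0 := by linarith
  have c1 : c₁ = 0 := by linarith
  rw [h] at h1 h2
  subst c0 c1
  have k1 : c₂ + c₃ * s = 0 := by
    have : s ^ 2 * (c₂ + c₃ * s) = 0 := by linarith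
    exact (mul_eq_zero.1 this).resolve_left (pow_ne_zero 2 hs)
  have k2 : c₂ + c₃ * r = 0 := by
    have : r ^ 2 * (c₂ + c₃ * r) = 0 := by linarith
    exact (mul_eq_zero.1 this).resolve_left (pow_ne_zero 2 hr)
  have k3 : c₃ = 0 := by
    have : (s - r) * c₃ = 0 := by linarith
    exact (mul_eq_zero.1 this).resolve_left (sub_ne_zero.2 hsr)
  rw [h]
  have k4 : c₂ = 0 := by rw [k3] at k1; linarith
  rw [k3, k4]; ring

end Poly

/-! ### Barycentric coordinates and the geometry of the triangles -/

namespace Triangulation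

variable {ω : Set Plane} (T : Triangulation ω)

/-- Twice the signed area of the triangle with index `t`. -/
noncomputable def det (t : Fin T.n) : ℝ :=
  (T.vert t 0 0 - T.vert t 1 0) * (T.vert t 2 1 - T.vert t 1 1) -
    (T.vert t 0 1 - T.vert t 1 1) * (T.vert t 2 0 - T.vert t 1 0)

theorem det_cyclic (t : Fin T.n) (i : Fin 3) :
    (T.vert t i 0 - T.vert t (i + 1) 0) * (T.vert t (i + 2) 1 - T.vert t (i + 1) 1) -
      (T.vert t i 1 - T.vert t (i + 1) 1) * (T.vert t (i + 2) 0 - T.vert t (i + 1) 0) = T.det t := by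
  fin_cases i <;> simp [det] <;> ring

theorem det_ne_zero (t : Fin T.n) : T.det t ≠ 0 := by
  intro h
  have hA := affineIndependent_iff.1 (T.nondegenerate t)
  unfold det at h
  have key : ∀ α β : ℝ, α • (T.vert t 0 - T.vert t 1) + β • (T.vert t 2 - T.vert t 1) = 0 →
      α = 0 ∧ β = 0 := by
    intro α β hαβ
    have := hA Finset.univ ![α, -(α + β), β] (by simp [Fin.sum_univ_three]) (by
      simp only [Fin.sum_univ_three, Matrix.cons_val]
      rw [← hαβ]; module)
    exact ⟨by simpa using this 0 (by simp), by simpa using this 2 (by simp)⟩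
  obtain ⟨h1, h2⟩ := key (T.vert t 2 0 - T.vert t 1 0) (-(T.vert t 0 0 - T.vert t 1 0)) (by
    ext j; fin_cases j <;> simp <;> linarith)
  obtain ⟨h3, h4⟩ := key (T.vert t 2 1 - T.vert t 1 1) (-(T.vert t 0 1 - T.vert t 1 1)) (by
    ext j; fin_cases j <;> simp <;> linarith)
  have := (key 0 1 (by ext j; fin_cases j <;> simp <;> linarith)).2
  norm_num at this

/-- The values of the barycentric coordinates. -/
theorem val_bary (t : Fin T.n) (i : Fin 3) (x : Plane) :
    Poly.val (T.bary t i) x = (T.det t)⁻¹ *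
      ((x 0 - T.vert t (i + 1) 0) * (T.vert t (i + 2) 1 - T.vert t (i + 1) 1) -
        (x 1 - T.vert t (i + 1) 1) * (T.vert t (i + 2) 0 - T.vert t (i + 1) 0)) := by
  simp only [bary, det_cyclic]; simp

theorem sum_bary (t : Fin T.n) (x : Plane) : ∑ i, Poly.val (T.bary t i) x = 1 := by
  have h := T.det_ne_zero t
  simp only [val_bary, ← Finset.mul_sum]
  rw [inv_mul_eq_one₀ h]
  simp [Fin.sum_univ_three, det]; ring

theorem sum_bary_smul (t : Fin T.n) (x : Plane) :
    ∑ i, Poly.val (T.bary t i) x • T.vert t i = x := by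
  have h := T.det_ne_zero t
  simp only [val_bary, mul_smul, ← Finset.smul_sum]
  apply (inv_smul_eq_iff₀ h).2
  ext j
  fin_cases j <;> simp [Fin.sum_univ_three, det] <;> ring

theorem bary_vert (t : Fin T.n) (i j : Fin 3) :
    Poly.val (T.bary t i) (T.vert t j) = if j = i then 1 else 0 := by
  rw [val_bary, ← div_eq_inv_mul]
  have h := T.det_ne_zero t
  rw [div_eq_iff h]
  fin_cases i <;> fin_cases j <;> simp [det] <;> ring

theorem bary_combo (t : Fin T.n) (i : Fin 3) (w : Fin 3 → ℝ) (hw : ∑ j, w j = 1) :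
    Poly.val (T.bary t i) (∑ j, w j • T.vert t j) = w i := by
  have key : Poly.val (T.bary t i) (∑ j, w j • T.vert t j) =
      ∑ j, w j * Poly.val (T.bary t i) (T.vert t j) := by
    simp only [val_bary]
    simp only [Fin.sum_univ_three] at hw ⊢
    have : w 2 = 1 - w 0 - w 1 := by linarith
    simp [this]; ring
  rw [key]; simp [bary_vert]

theorem mem_cell_iff (t : Fin T.n) (x : Plane) :
    x ∈ T.cell t ↔ ∀ i, 0 ≤ Poly.val (T.bary t i) x := by
  constructor
  · intro hx
    rw [cell, convexHull_range_eq_exists_affineCombination] at hx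
    obtain ⟨s, w, hw0, hw1, rfl⟩ := hx
    intro i
    rw [s.affineCombination_eq_linear_combination (T.vert t) w hw1]
    have e1 : ∑ j ∈ s, w j • T.vert t j = ∑ j, (if j ∈ s then w j else 0) • T.vert t j := by
      simp [ite_smul, Finset.sum_ite_mem]
    rw [e1, bary_combo]
    · split_ifs with h
      · exact hw0 i h
      · exact le_rfl
    · simpa [Finset.sum_ite_mem] using hw1
  · intro h
    rw [← T.sum_bary_smul t x]
    refine (convex_convexHull ℝ _).sum_mem (fun i _ => h i) (T.sum_bary t x) fun i _ => ?_
    exact subset_convexHull ℝ _ ⟨i, rfl⟩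

theorem bary_le_one {t : Fin T.n} {x : Plane} (hx : x ∈ T.cell t) (i : Fin 3) :
    Poly.val (T.bary t i) x ≤ 1 := by
  rw [← T.sum_bary t x]
  exact Finset.single_le_sum (fun j _ => (T.mem_cell_iff t x).1 hx j) (Finset.mem_univ i)

theorem vert_mem_cell (t : Fin T.n) (i : Fin 3) : T.vert t i ∈ T.cell t :=
  subset_convexHull ℝ _ ⟨i, rfl⟩

theorem convex_cell (t : Fin T.n) : Convex ℝ (T.cell t) := convex_convexHull ℝ _

theorem isCompact_cell (t : Fin T.n) : IsCompact (T.cell t) :=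
  (Set.finite_range (T.vert t)).isCompact_convexHull ℝ

theorem isClosed_cell (t : Fin T.n) : IsClosed (T.cell t) := (T.isCompact_cell t).isClosed

theorem measurableSet_cell (t : Fin T.n) : MeasurableSet (T.cell t) :=
  (T.isClosed_cell t).measurableSet

theorem cell_subset (t : Fin T.n) : T.cell t ⊆ closure ω := by
  rw [← T.covers]; exact Set.subset_iUnion (fun t => convexHull ℝ (Set.range (T.vert t))) t

theorem exists_mem_cell {x : Plane} (hx : x ∈ closure ω) : ∃ t, x ∈ T.cell t := by
  rw [← T.covers] at hx; simpa [cell] using hx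

theorem isCompact_closure (T : Triangulation ω) : IsCompact (closure ω) := by
  rw [← T.covers]; exact isCompact_iUnion T.isCompact_cell

theorem bary_line (t : Fin T.n) (i : Fin 3) (x q : Plane) (s : ℝ) :
    Poly.val (T.bary t i) (x + s • q) =
      Poly.val (T.bary t i) x + s * (Poly.val (T.bary t i) (x + q) - Poly.val (T.bary t i) x) := by
  simp only [val_bary]; simp; ring

/-! ### Affine functions and conformity of the discrete gradient -/

/-- A polynomial that is affine, expressed by means of the barycentric coordinates. -/
def IsAffine (t : Fin T.n) (f : Poly) : Prop :=
  ∀ x, Poly.val f x = ∑ i, Poly.val (T.bary t i) x * Poly.val f (T.vert t i)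

theorem isAffine_C (t : Fin T.n) (c : ℝ) : T.IsAffine t (MvPolynomial.C c) := fun x => by
  simp [← Finset.sum_mul, T.sum_bary]

theorem isAffine_bary (t : Fin T.n) (i : Fin 3) : T.IsAffine t (T.bary t i) := fun x => by
  simp [bary_vert]

variable {T} in
theorem IsAffine.add {t : Fin T.n} {f g : Poly} (hf : T.IsAffine t f) (hg : T.IsAffine t g) :
    T.IsAffine t (f + g) := fun x => by
  rw [Poly.val_add, hf x, hg x, ← Finset.sum_add_distrib]
  exact Finset.sum_congr rfl fun i _ => by rw [Poly.val_add]; ring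

variable {T} in
theorem IsAffine.C_mul {t : Fin T.n} {f : Poly} (hf : T.IsAffine t f) (c : ℝ) :
    T.IsAffine t (MvPolynomial.C c * f) := fun x => by
  rw [Poly.val_mul, hf x, Finset.mul_sum]
  exact Finset.sum_congr rfl fun i _ => by simp; ring

variable {T} in
theorem IsAffine.sum {t : Fin T.n} {ι : Type*} {s : Finset ι} {f : ι → Poly}
    (hf : ∀ i ∈ s, T.IsAffine t (f i)) : T.IsAffine t (∑ i ∈ s, f i) := fun x => by
  simp only [Poly.val_sum, Finset.mul_sum]
  rw [Finset.sum_comm]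
  exact Finset.sum_congr rfl fun i hi => hf i hi x

theorem exists_pderiv_bary (t : Fin T.n) (i : Fin 3) (k : Fin 2) :
    ∃ d : ℝ, MvPolynomial.pderiv k (T.bary t i) = MvPolynomial.C d := by
  have hX : ∀ j : Fin 2, ∃ e : ℝ,
      MvPolynomial.pderiv k (MvPolynomial.X j : Poly) = MvPolynomial.C e := by
    intro j
    by_cases h : j = k
    · exact ⟨1, by rw [h]; simp⟩
    · exact ⟨0, by simp [MvPolynomial.pderiv_X_of_ne h]⟩
  choose e he using hX
  refine ⟨(T.det t)⁻¹ * (e 0 * (T.vert t (i + 2) 1 - T.vert t (i + 1) 1) -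
      e 1 * (T.vert t (i + 2) 0 - T.vert t (i + 1) 0)), ?_⟩
  simp only [bary, det_cyclic, map_sub, MvPolynomial.pderiv_mul,
    MvPolynomial.pderiv_C, he, map_mul, mul_zero, add_zero, sub_zero,
    zero_mul, zero_add]

/-- The discrete gradient is quadratic on each triangle, so the entries of the discrete Hessian are
affine. All inverse estimates reduce to affine functions for this reason. -/
theorem isAffine_pderiv_discreteGrad (t : Fin T.n) (p : Poly) (j k : Fin 2) :
    T.IsAffine t (MvPolynomial.pderiv k (T.discreteGrad t p j)) := by
  choose d hd using fun i => T.exists_pderiv_bary t i k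
  rw [discreteGrad, map_sum]
  refine IsAffine.sum fun i _ => ?_
  have e : MvPolynomial.pderiv k (MvPolynomial.C (Poly.grad p (T.vert t i) j) *
      (T.bary t i * (MvPolynomial.C 2 * T.bary t i - 1)) +
      MvPolynomial.C (T.midGrad t p i j) *
      (MvPolynomial.C 4 * T.bary t (i + 1) * T.bary t (i + 2))) =
      (MvPolynomial.C (Poly.grad p (T.vert t i) j * d i * 4) * T.bary t i +
        MvPolynomial.C (-(Poly.grad p (T.vert t i) j * d i))) +
      (MvPolynomial.C (T.midGrad t p i j * 4 * d (i + 1)) * T.bary t (i + 2) +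
        MvPolynomial.C (T.midGrad t p i j * 4 * d (i + 2)) * T.bary t (i + 1)) := by
    simp only [map_add, MvPolynomial.pderiv_mul, MvPolynomial.pderiv_C, map_sub, hd,
      MvPolynomial.pderiv_one, map_mul, map_neg]
    have h4 : (MvPolynomial.C 4 : Poly) = MvPolynomial.C 2 * MvPolynomial.C 2 := by
      rw [← map_mul]; norm_num
    have h2 : (MvPolynomial.C 2 : Poly) = 1 + 1 := by
      rw [← map_one MvPolynomial.C, ← map_add]; norm_num
    rw [h4, h2]; ring
  rw [e]
  exact ((((T.isAffine_bary t i).C_mul _).add (T.isAffine_C t _))).add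
    (((T.isAffine_bary t _).C_mul _).add ((T.isAffine_bary t _).C_mul _))

theorem val_discreteGrad (t : Fin T.n) (p : Poly) (j : Fin 2) (x : Plane) :
    Poly.val (T.discreteGrad t p j) x =
      ∑ i, (Poly.grad p (T.vert t i) j *
        (Poly.val (T.bary t i) x * (2 * Poly.val (T.bary t i) x - 1)) +
      T.midGrad t p i j *
        (4 * Poly.val (T.bary t (i + 1)) x * Poly.val (T.bary t (i + 2)) x)) := by
  simp [discreteGrad]

theorem discreteGrad_vert (t : Fin T.n) (p : Poly) (j : Fin 2) (i : Fin 3) :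
    Poly.val (T.discreteGrad t p j) (T.vert t i) = Poly.grad p (T.vert t i) j := by
  rw [val_discreteGrad]
  simp only [bary_vert]
  fin_cases i <;> simp [Fin.sum_univ_three] <;> ring

/-- The value of the discrete gradient at the midpoint of an edge in terms of the data at its
endpoints `a` and `b`. -/
noncomputable def edgeMid (a b : Plane) (pa pb : ℝ) (ga gb : Plane) : Plane :=
  ((1 / 2 : ℝ) * (‖b - a‖⁻¹ * ‖b - a‖⁻¹ * (-(b 1 - a 1) * (ga 0 + gb 0) +
    (b 0 - a 0) * (ga 1 + gb 1)))) • !₂[-(b 1 - a 1), b 0 - a 0] +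
  (‖b - a‖⁻¹ * ‖b - a‖⁻¹ * (3 / 2 * (pb - pa) - 1 / 4 * inner ℝ (ga + gb) (b - a))) • (b - a)

/-- Two neighbouring triangles may run through a common edge in opposite directions. The sign of the
tangent and that of the normal each enter twice and cancel. -/
theorem edgeMid_comm (a b : Plane) (pa pb : ℝ) (ga gb : Plane) :
    edgeMid a b pa pb ga gb = edgeMid b a pb pa gb ga := by
  unfold edgeMid
  rw [norm_sub_rev a b]
  ext j
  fin_cases j <;> simp [PiLp.inner_apply, Fin.sum_univ_two] <;> ring

/-- The tangential derivative of a cubic at the midpoint is determined by Hermite data at the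
endpoints. The midpoint value thus depends only on quantities that both neighbours of an edge share.
-/
theorem midGrad_eq (t : Fin T.n) (p : Poly) (hp : p.totalDegree ≤ 3) (i : Fin 3) :
    T.midGrad t p i = edgeMid (T.vert t (i + 1)) (T.vert t (i + 2))
      (Poly.val p (T.vert t (i + 1))) (Poly.val p (T.vert t (i + 2)))
      (Poly.grad p (T.vert t (i + 1))) (Poly.grad p (T.vert t (i + 2))) := by
  unfold midGrad mid
  have h := Poly.inner_grad_midpoint p hp (T.vert t (i + 1)) (T.vert t (i + 2))
  unfold normal tangent edgeMid
  rw [real_inner_smul_right, h]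
  ext j
  fin_cases j <;> simp [PiLp.inner_apply, Fin.sum_univ_two] <;> ring

/-- The discrete gradient on an edge in terms of the data at its endpoints. -/
theorem discreteGrad_edge (t : Fin T.n) (p : Poly) (hp : p.totalDegree ≤ 3) (j : Fin 2) (i : Fin 3)
    (r s : ℝ) (hrs : r + s = 1) :
    Poly.val (T.discreteGrad t p j) (r • T.vert t (i + 1) + s • T.vert t (i + 2)) =
      Poly.grad p (T.vert t (i + 1)) j * (r * (2 * r - 1)) +
      Poly.grad p (T.vert t (i + 2)) j * (s * (2 * s - 1)) +
      edgeMid (T.vert t (i + 1)) (T.vert t (i + 2))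
      (Poly.val p (T.vert t (i + 1))) (Poly.val p (T.vert t (i + 2)))
      (Poly.grad p (T.vert t (i + 1))) (Poly.grad p (T.vert t (i + 2))) j * (4 * r * s) := by
  rw [val_discreteGrad, ← midGrad_eq T t p hp]
  have e : ∀ k, Poly.val (T.bary t k) (r • T.vert t (i + 1) + s • T.vert t (i + 2)) =
      if k = i then 0 else if k = i + 1 then r else s := by
    intro k
    have e1 : r • T.vert t (i + 1) + s • T.vert t (i + 2) =
        ∑ l, (if l = i then 0 else if l = i + 1 then r else s) • T.vert t l := by
      fin_cases i <;> simp [Fin.sum_univ_three, add_comm]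
    rw [e1, bary_combo]
    fin_cases i <;> simp [Fin.sum_univ_three] <;> linarith
  simp only [e]
  fin_cases i <;> simp [Fin.sum_univ_three] <;> ring

theorem vert_injective (t : Fin T.n) : Function.Injective (T.vert t) := (T.nondegenerate t).injective

/-- Two different triangles do not have all their vertices in common. -/
theorem exists_not_common {t t' : Fin T.n} (h : t ≠ t') :
    ∃ i, T.vert t i ∉ Set.range (T.vert t') := by
  by_contra! hc
  apply h
  apply T.distinct
  have hsub : Set.range (T.vert t) ⊆ Set.range (T.vert t') := by
    rintro _ ⟨i, rfl⟩; exact hc i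
  refine Set.eq_of_subset_of_ncard_le hsub ?_ (Set.finite_range _)
  have e : ∀ t, (Set.range (T.vert t)).ncard = 3 := fun t => by
    rw [Set.ncard_range_of_injective (T.vert_injective t)]; simp
  rw [e, e]

theorem common_subset_pair {t t' : Fin T.n} {i : Fin 3} (h : T.vert t i ∉ Set.range (T.vert t')) :
    Set.range (T.vert t) ∩ Set.range (T.vert t') ⊆ {T.vert t (i + 1), T.vert t (i + 2)} := by
  rintro _ ⟨⟨k, rfl⟩, hk⟩
  have hki : k ≠ i := fun e => h (e ▸ hk)
  have : k = i + 1 ∨ k = i + 2 := by revert hki; clear * -; revert i k; decide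
  rcases this with rfl | rfl <;> simp

/-- The pieces of the discrete gradient of a function of the discrete space fit together. -/
theorem discreteGrad_conforming (p : T.dkt) (j : Fin 2) {t t' : Fin T.n} {x : Plane}
    (hx : x ∈ T.cell t) (hx' : x ∈ T.cell t') :
    Poly.val (T.discreteGrad t (p.1 t) j) x = Poly.val (T.discreteGrad t' (p.1 t') j) x := by
  by_cases htt : t = t'
  · rw [htt]
  obtain ⟨hp1, hp2, hp3⟩ := p.2
  obtain ⟨i, hi⟩ := T.exists_not_common htt
  have hxR : x ∈ convexHull ℝ (Set.range (T.vert t) ∩ Set.range (T.vert t')) := by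
    rw [← T.conforming]; exact ⟨hx, hx'⟩
  have hvert : ∀ k, T.vert t k ∈ Set.range (T.vert t') → x = T.vert t k →
      Poly.val (T.discreteGrad t (p.1 t) j) x = Poly.val (T.discreteGrad t' (p.1 t') j) x := by
    rintro k ⟨k', hk'⟩ rfl
    rw [discreteGrad_vert, ← hk', discreteGrad_vert, hk']
    have := hp3 t t' k k' hk'.symm
    rw [hk'] at this
    rw [this]
  have hinter : ∀ k, T.vert t k ∈ Set.range (T.vert t) ∩ Set.range (T.vert t') →
      T.vert t k ∈ Set.range (T.vert t') := fun k hk => hk.2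
  -- The common vertices form a subset of two vertices of `t`: none, one of them, or a full common
  -- edge.
  rcases Set.subset_pair_iff_eq.1 (T.common_subset_pair hi) with h | h | h | h
  · rw [h] at hxR; simp at hxR
  · rw [h, convexHull_singleton] at hxR
    exact hvert _ (hinter _ (by rw [h]; simp)) hxR
  · rw [h, convexHull_singleton] at hxR
    exact hvert _ (hinter _ (by rw [h]; simp)) hxR
  · obtain ⟨k1, hk1⟩ := hinter (i + 1) (by rw [h]; simp)
    obtain ⟨k2, hk2⟩ := hinter (i + 2) (by rw [h]; simp)
    rw [h, convexHull_pair] at hxR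
    obtain ⟨r, s, hr, hs, hrs, rfl⟩ := hxR
    have hne : k1 ≠ k2 := by
      rintro rfl
      have := T.vert_injective t (hk1.symm.trans hk2)
      revert this; clear * -; revert i; decide
    -- On a common edge only the values and gradients at its endpoints matter, and these agree.
    have v1 := hp2 t t' (T.vert t (i + 1)) ⟨T.vert_mem_cell _ _, hk1 ▸ T.vert_mem_cell _ _⟩
    have v2 := hp2 t t' (T.vert t (i + 2)) ⟨T.vert_mem_cell _ _, hk2 ▸ T.vert_mem_cell _ _⟩
    have g1 := hp3 t t' (i + 1) k1 hk1.symm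
    have g2 := hp3 t t' (i + 2) k2 hk2.symm
    rw [discreteGrad_edge T t _ (hp1 t).1 j i r s hrs, v1, v2, g1, g2, ← hk1, ← hk2]
    have : ∃ k0 : Fin 3, (k1 = k0 + 1 ∧ k2 = k0 + 2) ∨ (k1 = k0 + 2 ∧ k2 = k0 + 1) := by
      revert hne; clear * -; revert k1 k2; decide
    obtain ⟨k0, ⟨rfl, rfl⟩ | ⟨rfl, rfl⟩⟩ := this
    · rw [discreteGrad_edge T t' _ (hp1 t').1 j k0 r s hrs]
    · rw [add_comm (r • _), discreteGrad_edge T t' _ (hp1 t').1 j k0 s r (by linarith),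
        edgeMid_comm]
      ring

/-- The discrete gradient vanishes on an edge at whose endpoints the data vanish. -/
theorem discreteGrad_edge_eq_zero (t : Fin T.n) (p : Poly) (hp : p.totalDegree ≤ 3) (j : Fin 2)
    (i : Fin 3) (h1 : Poly.val p (T.vert t (i + 1)) = 0) (h2 : Poly.val p (T.vert t (i + 2)) = 0)
    (g1 : Poly.grad p (T.vert t (i + 1)) = 0) (g2 : Poly.grad p (T.vert t (i + 2)) = 0)
    {x : Plane} (hx : x ∈ T.edge t i) : Poly.val (T.discreteGrad t p j) x = 0 := by
  obtain ⟨r, s, hr, hs, hrs, rfl⟩ := hx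
  rw [discreteGrad_edge T t p hp j i r s hrs, h1, h2, g1, g2]
  simp [edgeMid]

/-! ### Inverse estimates, areas and diameters -/

theorem volume_cell_ne_top (t : Fin T.n) : volume (T.cell t) ≠ ⊤ :=
  (T.isCompact_cell t).measure_lt_top.ne

/-- Inverse estimate: an affine function is controlled at the vertices by its `L²` norm. -/
theorem IsAffine.sq_vert_le {t : Fin T.n} {f : Poly} (hf : T.IsAffine t f) (i : Fin 3) :
    volume.real (T.cell t) * Poly.val f (T.vert t i) ^ 2 ≤
      64 * ∫ x in T.cell t, Poly.val f x ^ 2 := by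
  wlog hmax : ∀ j, |Poly.val f (T.vert t j)| ≤ |Poly.val f (T.vert t i)| generalizing i
  · obtain ⟨k, hk⟩ := Finite.exists_max fun j => |Poly.val f (T.vert t j)|
    refine le_trans ?_ (this k hk)
    exact mul_le_mul_of_nonneg_left (sq_le_sq.2 (hk i)) measureReal_nonneg
  set m := |Poly.val f (T.vert t i)| with hm
  -- On the triangle shrunk by 1/4 towards the maximal vertex, the coordinate of this vertex is at
  -- least 3/4. Hence the modulus of `f` is at least 3m/4 - m/4 = m/2. The shrunk area is 1/16 of
  -- the original, and 4 * 16 = 64.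
  set K' := AffineMap.homothety (T.vert t i) (1 / 4 : ℝ) '' T.cell t with hK'
  have hbary : ∀ x ∈ K', x ∈ T.cell t ∧ 3 / 4 ≤ Poly.val (T.bary t i) x := by
    rintro _ ⟨x, hx, rfl⟩
    have e : AffineMap.homothety (T.vert t i) (1 / 4 : ℝ) x =
        T.vert t i + (1 / 4 : ℝ) • (x - T.vert t i) := by
      rw [AffineMap.homothety_apply]; simp [add_comm]
    have e2 : T.vert t i + (x - T.vert t i) = x := by abel
    rw [e]
    constructor
    · have := (T.convex_cell t).add_smul_sub_mem (T.vert_mem_cell t i) hx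
        (t := 1 / 4) ⟨by norm_num, by norm_num⟩
      exact this
    · rw [bary_line, e2, bary_vert]
      have := (T.mem_cell_iff t x).1 hx i
      simp; linarith
  have hsub : K' ⊆ T.cell t := fun x hx => (hbary x hx).1
  have hlow : ∀ x ∈ K', m ^ 2 / 4 ≤ Poly.val f x ^ 2 := by
    intro x hx
    obtain ⟨hxc, hxi⟩ := hbary x hx
    have h0 := fun j => (T.mem_cell_iff t x).1 hxc j
    have hs := T.sum_bary t x
    have h1 : |Poly.val f x - Poly.val (T.bary t i) x * Poly.val f (T.vert t i)| ≤
        (1 - Poly.val (T.bary t i) x) * m := by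
      have e1 : Poly.val f x - Poly.val (T.bary t i) x * Poly.val f (T.vert t i) =
          ∑ j ∈ Finset.univ.erase i, Poly.val (T.bary t j) x * Poly.val f (T.vert t j) := by
        rw [hf x, ← Finset.add_sum_erase _ _ (Finset.mem_univ i)]; ring
      have e2 : 1 - Poly.val (T.bary t i) x =
          ∑ j ∈ Finset.univ.erase i, Poly.val (T.bary t j) x := by
        rw [← hs, ← Finset.add_sum_erase _ _ (Finset.mem_univ i)]; ring
      rw [e1, e2, Finset.sum_mul]
      refine (Finset.abs_sum_le_sum_abs _ _).trans (Finset.sum_le_sum fun j _ => ?_)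
      rw [abs_mul, abs_of_nonneg (h0 j)]
      exact mul_le_mul_of_nonneg_left (hmax j) (h0 j)
    have hm0 : 0 ≤ m := abs_nonneg _
    have h2 : m / 2 ≤ |Poly.val f x| := by
      have h3 : |Poly.val (T.bary t i) x * Poly.val f (T.vert t i)| =
          Poly.val (T.bary t i) x * m := by rw [abs_mul, abs_of_nonneg (h0 i)]
      have h4 := abs_sub_abs_le_abs_sub (Poly.val (T.bary t i) x * Poly.val f (T.vert t i))
        (Poly.val f x)
      rw [abs_sub_comm] at h4
      nlinarith
    rw [← sq_abs (Poly.val f x)]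
    nlinarith
  have hvol : volume.real K' = volume.real (T.cell t) / 16 := by
    rw [hK', Measure.real, Measure.addHaar_image_homothety, ENNReal.toReal_mul,
      ENNReal.toReal_ofReal (abs_nonneg _), ← Measure.real]
    simp; ring
  have hmeas : MeasurableSet K' := by
    refine (IsCompact.image (T.isCompact_cell t) ?_).isClosed.measurableSet
    exact AffineMap.homothety_continuous _ _
  have hint : IntegrableOn (fun x => Poly.val f x ^ 2) (T.cell t) :=
    ((Poly.continuous_val f).pow 2).continuousOn.integrableOn_compact (T.isCompact_cell t)
  have h5 : ∫ x in K', Poly.val f x ^ 2 ≤ ∫ x in T.cell t, Poly.val f x ^ 2 :=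
    setIntegral_mono_set hint (Filter.Eventually.of_forall fun x => sq_nonneg _)
      (LE.le.eventuallyLE hsub)
  have h6 : m ^ 2 / 4 * volume.real K' ≤ ∫ x in K', Poly.val f x ^ 2 := by
    have hfin : volume K' ≠ ⊤ := ne_top_of_le_ne_top (T.volume_cell_ne_top t) (measure_mono hsub)
    exact setIntegral_ge_of_const_le_real hmeas hfin hlow (hint.mono_set hsub)
  rw [← sq_abs, ← hm]
  rw [hvol] at h6
  linarith

/-- Inverse estimate on the whole triangle. -/
theorem IsAffine.sq_le {t : Fin T.n} {f : Poly} (hf : T.IsAffine t f) {x : Plane}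
    (hx : x ∈ T.cell t) :
    volume.real (T.cell t) * Poly.val f x ^ 2 ≤ 64 * ∫ x in T.cell t, Poly.val f x ^ 2 := by
  obtain ⟨k, hk⟩ := Finite.exists_max fun j => |Poly.val f (T.vert t j)|
  refine le_trans ?_ (hf.sq_vert_le T k)
  refine mul_le_mul_of_nonneg_left (sq_le_sq.2 ?_) measureReal_nonneg
  rw [hf x]
  refine (Finset.abs_sum_le_sum_abs _ _).trans ?_
  rw [← one_mul |Poly.val f (T.vert t k)|, ← T.sum_bary t x, Finset.sum_mul]
  refine Finset.sum_le_sum fun j _ => ?_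
  have h0 := (T.mem_cell_iff t x).1 hx j
  rw [abs_mul, abs_of_nonneg h0]
  exact mul_le_mul_of_nonneg_left (hk j) h0

/-- Some vertex of `t` is not shared, so by conformity the intersection lies on the line through the
two other vertices. -/
theorem volume_cell_inter {t t' : Fin T.n} (h : t ≠ t') : volume (T.cell t ∩ T.cell t') = 0 := by
  obtain ⟨i, hi⟩ := T.exists_not_common h
  have h1 : T.cell t ∩ T.cell t' ⊆
      (affineSpan ℝ {T.vert t (i + 1), T.vert t (i + 2)} : Set Plane) := by
    unfold cell
    rw [T.conforming]
    exact (convexHull_mono (T.common_subset_pair hi)).trans (convexHull_subset_affineSpan _)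
  refine measure_mono_null h1 (Measure.addHaar_affineSubspace _ _ fun htop => ?_)
  have h2 : T.vert t i ∈ affineSpan ℝ (T.vert t '' {i + 1, i + 2}) := by
    rw [Set.image_pair, htop]; trivial
  rw [(T.nondegenerate t).mem_affineSpan_iff] at h2
  revert h2; clear * -; revert i; decide

/-- This makes the constant in the bound of the cubic form independent of the triangulation. -/
theorem area_le : T.area ≤ volume.real (closure ω) := by
  have h1 : volume.real (⋃ t, T.cell t) = ∑ t, volume.real (T.cell t) := by
    rw [Measure.real, measure_iUnion₀ _ fun t => (T.measurableSet_cell t).nullMeasurableSet,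
      tsum_fintype, ENNReal.toReal_sum fun t _ => T.volume_cell_ne_top t]
    · rfl
    · intro t t' h; exact T.volume_cell_inter h
  rw [area, ← h1, ← T.covers]
  exact le_rfl

theorem diam_pos (t : Fin T.n) : 0 < T.diam t := by
  refine Metric.diam_pos ⟨T.vert t 0, T.vert_mem_cell _ _, T.vert t 1, T.vert_mem_cell _ _, ?_⟩
    (T.isCompact_cell t).isBounded
  intro h; exact absurd (T.vert_injective t h) (by decide)

theorem volume_cell_ge {t : Fin T.n} {x : Plane} {r : ℝ} (hr : 0 < r)
    (h : Metric.closedBall x r ⊆ T.cell t) : r ^ 2 ≤ volume.real (T.cell t) := by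
  have h1 : volume.real (Metric.ball x r) ≤ volume.real (T.cell t) :=
    measureReal_mono (Metric.ball_subset_closedBall.trans h) (T.volume_cell_ne_top t)
  refine le_trans ?_ h1
  rw [Measure.real, EuclideanSpace.volume_ball_fin_two, ENNReal.toReal_mul, ENNReal.toReal_pow,
    ENNReal.toReal_ofReal hr.le]
  rw [ENNReal.toReal_ofReal Real.pi_pos.le]
  nlinarith [Real.pi_gt_three, sq_nonneg r]

theorem interior_cell_nonempty (t : Fin T.n) : (interior (T.cell t)).Nonempty := by
  rw [cell, interior_convexHull_nonempty_iff_affineSpan_eq_top]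
  refine (T.nondegenerate t).affineSpan_eq_top_iff_card_eq_finrank_add_one.2 ?_
  simp

theorem volume_cell_pos (t : Fin T.n) : 0 < volume.real (T.cell t) :=
  ENNReal.toReal_pos (Measure.measure_pos_of_nonempty_interior _ (T.interior_cell_nonempty t)).ne'
    (T.volume_cell_ne_top t)

theorem n_pos (hne : ω.Nonempty) : 0 < T.n := by
  obtain ⟨x, hx⟩ := hne
  obtain ⟨t, -⟩ := T.exists_mem_cell (subset_closure hx)
  exact t.pos

theorem hmin_le (t : Fin T.n) : T.hmin ≤ T.diam t := ciInf_le (Set.finite_range _).bddBelow t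

theorem hmin_pos (hne : ω.Nonempty) : 0 < T.hmin := by
  have : Nonempty (Fin T.n) := ⟨⟨0, T.n_pos hne⟩⟩
  obtain ⟨t, ht⟩ := exists_eq_ciInf_of_finite (f := T.diam)
  rw [hmin, ← ht]; exact T.diam_pos t

end Triangulation

/-! ### Upper gradients along segments -/

open scoped ENNReal

/-- `G` is an upper gradient of `u` along the segments in `S`. -/
structure IsUpperGradient (S : Set Plane) (u : Plane → ℝ) (G : Plane → ℝ≥0∞) : Prop where
  measurable_fun : Measurable u
  measurable_grad : Measurable G
  le : ∀ (x q : Plane) (a b : ℝ), a ≤ b → (∀ s ∈ Set.Icc a b, x + s • q ∈ S) →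
    ENNReal.ofReal |u (x + b • q) - u (x + a • q)| ≤
      ENNReal.ofReal ‖q‖ * ∫⁻ s in Set.Icc a b, G (x + s • q)

theorem sq_lintegral_mul_le {α : Type*} [MeasurableSpace α] {μ : Measure α} {f g : α → ℝ≥0∞}
    (hf : AEMeasurable f μ) (hg : AEMeasurable g μ) :
    (∫⁻ x, f x * g x ∂μ) ^ 2 ≤ (∫⁻ x, f x ^ 2 ∂μ) * ∫⁻ x, g x ^ 2 ∂μ := by
  have h := ENNReal.lintegral_mul_le_Lp_mul_Lq μ Real.HolderConjugate.two_two hf hg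
  simp only [Pi.mul_apply, ENNReal.rpow_two] at h
  refine (pow_le_pow_left' h 2).trans ?_
  rw [mul_pow, ← ENNReal.rpow_mul_natCast, ← ENNReal.rpow_mul_natCast]
  simp

theorem ofReal_sq_abs (a : ℝ) : ENNReal.ofReal (a ^ 2) = ENNReal.ofReal |a| ^ 2 := by
  rw [← ENNReal.ofReal_pow (abs_nonneg _), sq_abs]

theorem measurable_line (x q : Plane) : Measurable fun s : ℝ => x + s • q := by
  have : Continuous fun s : ℝ => x + s • q := by fun_prop
  exact this.measurable

namespace IsUpperGradient

variable {S : Set Plane} {u : Plane → ℝ} {G : Plane → ℝ≥0∞}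

/-- Cauchy–Schwarz on the segment. The integral is enlarged to the unit interval so that the
right-hand side does not depend on the endpoint `b`, which will vary with `x`. -/
theorem sq_le (h : IsUpperGradient S u G) (x q : Plane) {b : ℝ} (hb0 : 0 ≤ b) (hb1 : b ≤ 1)
    (hS : ∀ s ∈ Set.Icc 0 b, x + s • q ∈ S) :
    ENNReal.ofReal ((u (x + b • q) - u x) ^ 2) ≤
      ENNReal.ofReal (‖q‖ ^ 2) * ∫⁻ s in Set.Icc (0 : ℝ) 1, G (x + s • q) ^ 2 := by
  have h1 := h.le x q 0 b hb0 hS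
  rw [zero_smul, add_zero] at h1
  have hm : Measurable fun s : ℝ => G (x + s • q) := h.measurable_grad.comp (measurable_line x q)
  have h2 : ∫⁻ s in Set.Icc 0 b, G (x + s • q) ≤ ∫⁻ s in Set.Icc (0 : ℝ) 1, G (x + s • q) :=
    lintegral_mono_set (Set.Icc_subset_Icc_right hb1)
  have h3 := sq_lintegral_mul_le (μ := volume.restrict (Set.Icc (0 : ℝ) 1))
    (f := fun _ => 1) aemeasurable_const hm.aemeasurable
  simp only [one_mul, one_pow, lintegral_const, MeasurableSet.univ, Measure.restrict_apply,
    Set.univ_inter, Real.volume_Icc, sub_zero, ENNReal.ofReal_one] at h3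
  rw [ofReal_sq_abs, ENNReal.ofReal_pow (norm_nonneg _)]
  calc _ ≤ (ENNReal.ofReal ‖q‖ * ∫⁻ s in Set.Icc (0 : ℝ) 1, G (x + s • q)) ^ 2 :=
        pow_le_pow_left' (h1.trans (mul_le_mul_right h2 _)) 2
    _ ≤ _ := by rw [mul_pow]; exact mul_le_mul_right h3 _

/-- Cauchy–Schwarz for the product of $s^{-1/2}$ and $s^{1/2}G$: the first factor produces the
logarithm, and the weight `s` left on the second is what integration over a cone in the plane can
absorb. -/
theorem sq_le_log (h : IsUpperGradient S u G) (x q : Plane) {ε : ℝ} (hε0 : 0 < ε) (hε1 : ε ≤ 1)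
    (hS : ∀ s ∈ Set.Icc ε 1, x + s • q ∈ S) :
    ENNReal.ofReal ((u (x + q) - u (x + ε • q)) ^ 2) ≤
      ENNReal.ofReal (‖q‖ ^ 2 * Real.log (1 / ε)) *
        ∫⁻ s in Set.Icc ε 1, ENNReal.ofReal s * G (x + s • q) ^ 2 := by
  have h1 := h.le x q ε 1 hε1 hS
  rw [one_smul] at h1
  have hm : Measurable fun s : ℝ => G (x + s • q) := h.measurable_grad.comp (measurable_line x q)
  have hf : Measurable fun s : ℝ => ENNReal.ofReal (Real.sqrt s)⁻¹ := by fun_prop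
  have hg : Measurable fun s : ℝ => ENNReal.ofReal (Real.sqrt s) * G (x + s • q) :=
    Measurable.mul (by fun_prop) hm
  have h3 := sq_lintegral_mul_le (μ := volume.restrict (Set.Icc ε 1))
    hf.aemeasurable hg.aemeasurable
  have e1 : ∫⁻ s in Set.Icc ε 1, ENNReal.ofReal (Real.sqrt s)⁻¹ *
      (ENNReal.ofReal (Real.sqrt s) * G (x + s • q)) = ∫⁻ s in Set.Icc ε 1, G (x + s • q) := by
    refine setLIntegral_congr_fun measurableSet_Icc fun s hs => ?_
    have : 0 < Real.sqrt s := Real.sqrt_pos.2 (hε0.trans_le hs.1)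
    rw [← mul_assoc, ← ENNReal.ofReal_mul (by positivity), inv_mul_cancel₀ this.ne',
      ENNReal.ofReal_one, one_mul]
  have e2 : ∫⁻ s in Set.Icc ε 1, ENNReal.ofReal (Real.sqrt s)⁻¹ ^ 2 =
      ENNReal.ofReal (Real.log (1 / ε)) := by
    have : ∫⁻ s in Set.Icc ε 1, ENNReal.ofReal (Real.sqrt s)⁻¹ ^ 2 =
        ∫⁻ s in Set.Icc ε 1, ENNReal.ofReal s⁻¹ := by
      refine setLIntegral_congr_fun measurableSet_Icc fun s hs => ?_
      rw [← ENNReal.ofReal_pow (by positivity), inv_pow, Real.sq_sqrt (hε0.le.trans hs.1)]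
    rw [this, ← ofReal_integral_eq_lintegral_ofReal]
    · rw [integral_Icc_eq_integral_Ioc, ← intervalIntegral.integral_of_le hε1,
        integral_inv_of_pos hε0 one_pos]
    · refine ContinuousOn.integrableOn_Icc ?_
      exact continuousOn_inv₀.mono fun s hs => (hε0.trans_le hs.1).ne'
    · exact ae_restrict_of_forall_mem measurableSet_Icc fun s hs =>
        inv_nonneg.2 (hε0.le.trans hs.1)
  have e3 : ∫⁻ s in Set.Icc ε 1, (ENNReal.ofReal (Real.sqrt s) * G (x + s • q)) ^ 2 =
      ∫⁻ s in Set.Icc ε 1, ENNReal.ofReal s * G (x + s • q) ^ 2 := by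
    refine setLIntegral_congr_fun measurableSet_Icc fun s hs => ?_
    rw [mul_pow, ← ENNReal.ofReal_pow (by positivity), Real.sq_sqrt (hε0.le.trans hs.1)]
  rw [e1, e2, e3] at h3
  rw [ofReal_sq_abs, ENNReal.ofReal_mul (by positivity), ENNReal.ofReal_pow (norm_nonneg _)]
  calc _ ≤ (ENNReal.ofReal ‖q‖ * ∫⁻ s in Set.Icc ε 1, G (x + s • q)) ^ 2 := pow_le_pow_left' h1 2
    _ ≤ _ := by rw [mul_pow, mul_assoc]; exact mul_le_mul_right h3 _

end IsUpperGradient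

/-! ### Integration over cones and translated segments -/

theorem lintegral_comp_homothety {f : Plane → ℝ≥0∞} (hf : Measurable f) (x : Plane) {s : ℝ}
    (hs : 0 < s) :
    ∫⁻ p, f (x + s • (p - x)) = ENNReal.ofReal (s⁻¹ ^ 2) * ∫⁻ y, f y := by
  have h1 : ∫⁻ p : Plane, f (x + s • (p - x)) = ∫⁻ p : Plane, f (x + s • p) :=
    lintegral_sub_right_eq_self (fun p : Plane => f (x + s • p)) x
  have h2 : ∫⁻ p : Plane, f (x + s • p) = ∫⁻ y, f (x + y) ∂(Measure.map (s • ·) volume) := by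
    rw [lintegral_map (by fun_prop) (by fun_prop)]
  rw [h1, h2, Measure.map_addHaar_smul _ hs.ne', lintegral_smul_measure,
    lintegral_add_left_eq_self]
  congr 2
  simp

/-- The pairs of a scale `s` and a point in the image of the ball of radius `ρ` about `c` under the
homothety with centre `x` and ratio `s`. -/
def coneSet (x c : Plane) (ρ : ℝ) : Set (ℝ × Plane) := {z | ‖z.2 - x - z.1 • (c - x)‖ < z.1 * ρ}

theorem measurableSet_coneSet (x c : Plane) (ρ : ℝ) : MeasurableSet (coneSet x c ρ) := by
  refine (isOpen_lt ?_ ?_).measurableSet <;> fun_prop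

/-- Substitution of `y = x + s • (p - x)`, whose inverse has Jacobian $s^{-2}$; together with the
weight `s` there remains $s^{-1}$. -/
theorem lintegral_ball_homothety {g : Plane → ℝ≥0∞} (hg : Measurable g) (x c : Plane) (ρ : ℝ)
    {s : ℝ} (hs : 0 < s) :
    ∫⁻ p in Metric.ball c ρ, ENNReal.ofReal s * g (x + s • (p - x)) =
      ∫⁻ y, ENNReal.ofReal s⁻¹ * (coneSet x c ρ).indicator (fun z => g z.2) (s, y) := by
  have hFm : Measurable fun y => (coneSet x c ρ).indicator (fun z => g z.2) (s, y) :=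
    ((hg.comp measurable_snd).indicator (measurableSet_coneSet x c ρ)).comp measurable_prodMk_left
  rw [lintegral_const_mul' _ _ ENNReal.ofReal_ne_top, lintegral_const_mul' _ _
    ENNReal.ofReal_ne_top, ← lintegral_indicator measurableSet_ball]
  have h2 : ∀ p, (Metric.ball c ρ).indicator (fun p => g (x + s • (p - x))) p =
      (coneSet x c ρ).indicator (fun z => g z.2) (s, x + s • (p - x)) := by
    intro p
    have : p ∈ Metric.ball c ρ ↔ (s, x + s • (p - x)) ∈ coneSet x c ρ := by
      rw [coneSet, Set.mem_ofPred_eq, mem_ball_iff_norm]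
      have e : x + s • (p - x) - x - s • (c - x) = s • (p - c) := by module
      rw [e, norm_smul, Real.norm_of_nonneg hs.le, mul_lt_mul_iff_right₀ hs]
    by_cases hp : p ∈ Metric.ball c ρ
    · rw [Set.indicator_of_mem hp, Set.indicator_of_mem (this.1 hp)]
    · rw [Set.indicator_of_notMem hp, Set.indicator_of_notMem (mt this.2 hp)]
  simp_rw [h2]
  rw [lintegral_comp_homothety hFm x hs, ← mul_assoc, ← ENNReal.ofReal_mul hs.le]
  congr 2
  field_simp

/-- If `y` lies in the ball scaled by `s`, then $s(|c-x|-\rho)\le|y-x|\le s(|c-x|+\rho)$. Since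
$2\rho\le|c-x|$, the quotient of the two factors is at most 3, so `s` is confined to an interval [α,
3α], on which $s^{-1}\le\alpha^{-1}$. The resulting bound is uniform in `y` and `ε`. -/
theorem lintegral_scale_le (a : ℝ≥0∞) (x c y : Plane) {ρ ε : ℝ}
    (hρ : 0 < ρ) (hd : 2 * ρ ≤ ‖c - x‖) (hε : 0 < ε) :
    ∫⁻ s in Set.Icc ε 1, ENNReal.ofReal s⁻¹ * (coneSet x c ρ).indicator (fun _ => a) (s, y) ≤
      2 * a := by
  set α := ‖y - x‖ / (‖c - x‖ + ρ) with hα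
  have hFle : ∀ s ∈ Set.Icc ε 1,
      ENNReal.ofReal s⁻¹ * (coneSet x c ρ).indicator (fun _ => a) (s, y) ≤
      (Set.Icc α (3 * α)).indicator (fun _ => ENNReal.ofReal α⁻¹ * a) s := by
    intro s hs
    have hs0 : 0 < s := hε.trans_le hs.1
    by_cases hy : (s, y) ∈ coneSet x c ρ
    · have hy' : ‖y - x - s • (c - x)‖ < s * ρ := hy
      have e1 : ‖s • (c - x)‖ = s * ‖c - x‖ := by rw [norm_smul, Real.norm_of_nonneg hs0.le]
      have h2 := norm_sub_norm_le (y - x) (s • (c - x))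
      have h3 := norm_sub_norm_le (s • (c - x)) (y - x)
      rw [norm_sub_rev (s • (c - x))] at h3
      rw [e1] at h2 h3
      have hα1 : α ≤ s := by rw [hα, div_le_iff₀ (by linarith)]; linarith
      have hα2 : s ≤ 3 * α := by
        rw [hα, ← mul_div_assoc, le_div_iff₀ (by linarith)]
        have h4 : s * ‖c - x‖ - s * ρ ≤ ‖y - x‖ := by linarith
        have h5 : 0 ≤ s * (‖c - x‖ - 2 * ρ) := mul_nonneg hs0.le (by linarith)
        linarith
      have hα0 : 0 < α := by linarith
      rw [Set.indicator_of_mem (show s ∈ Set.Icc α (3 * α) from ⟨hα1, hα2⟩),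
        Set.indicator_of_mem hy]
      gcongr
    · rw [Set.indicator_of_notMem hy, mul_zero]; exact zero_le
  refine (setLIntegral_mono' measurableSet_Icc hFle).trans ?_
  refine (setLIntegral_le_lintegral _ _).trans ?_
  rw [lintegral_indicator measurableSet_Icc, setLIntegral_const, Real.volume_Icc]
  have hα0 : 0 ≤ α := by positivity
  rw [mul_comm, ← mul_assoc, ← ENNReal.ofReal_mul (by linarith)]
  gcongr
  rw [show (2 : ℝ≥0∞) = ENNReal.ofReal 2 by norm_num]
  apply ENNReal.ofReal_le_ofReal
  rcases hα0.eq_or_lt with h | h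
  · rw [← h]; norm_num
  · rw [show 3 * α - α = 2 * α by ring, mul_assoc, mul_inv_cancel₀ h.ne']; norm_num

/-- Integration over the cone with a given vertex `x` over a ball. -/
theorem lintegral_cone_le {g : Plane → ℝ≥0∞} (hg : Measurable g) (x c : Plane) {ρ ε : ℝ}
    (hρ : 0 < ρ) (hd : 2 * ρ ≤ ‖c - x‖) (hε : 0 < ε) :
    ∫⁻ p in Metric.ball c ρ, ∫⁻ s in Set.Icc ε 1,
      ENNReal.ofReal s * g (x + s • (p - x)) ≤ 2 * ∫⁻ y, g y := by
  have hm1 : Measurable fun z : Plane × ℝ => ENNReal.ofReal z.2 * g (x + z.2 • (z.1 - x)) := by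
    have : Continuous fun z : Plane × ℝ => x + z.2 • (z.1 - x) := by fun_prop
    exact Measurable.mul (by fun_prop) (hg.comp this.measurable)
  have hm2 : Measurable fun z : ℝ × Plane =>
      ENNReal.ofReal z.1⁻¹ * (coneSet x c ρ).indicator (fun z => g z.2) z :=
    Measurable.mul (by fun_prop)
      ((hg.comp measurable_snd).indicator (measurableSet_coneSet x c ρ))
  rw [lintegral_lintegral_swap hm1.aemeasurable]
  have h1 : ∀ s ∈ Set.Icc ε 1, ∫⁻ p in Metric.ball c ρ,
      ENNReal.ofReal s * g (x + s • (p - x)) = ∫⁻ y, ENNReal.ofReal s⁻¹ *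
        (coneSet x c ρ).indicator (fun z => g z.2) (s, y) :=
    fun s hs => lintegral_ball_homothety hg x c ρ (hε.trans_le hs.1)
  rw [setLIntegral_congr_fun measurableSet_Icc h1, lintegral_lintegral_swap hm2.aemeasurable,
    ← lintegral_const_mul _ hg]
  exact lintegral_mono fun y => lintegral_scale_le (g y) x c y hρ hd hε

/-- For each fixed `s` the inner integral is that of a translate of `g`, whatever the direction `w`.
-/
theorem lintegral_translate_le {g : Plane → ℝ≥0∞} (hg : Measurable g) (c w : Plane)
    (B : Set Plane) :
    ∫⁻ v in B, ∫⁻ s in Set.Icc (0 : ℝ) 1, g (c + v + s • w) ≤ ∫⁻ y, g y := by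
  rw [lintegral_lintegral_swap]
  · have h1 : ∀ s : ℝ, ∫⁻ v in B, g (c + v + s • w) ≤ ∫⁻ y, g y := by
      intro s
      refine (setLIntegral_le_lintegral _ _).trans ?_
      have e : ∀ v, c + v + s • w = (c + s • w) + v := fun v => by abel
      simp_rw [e]
      rw [lintegral_add_left_eq_self g]
    refine (lintegral_mono h1).trans ?_
    simp
  · refine Measurable.aemeasurable ?_
    refine hg.comp ?_
    have : Continuous fun z : Plane × ℝ => c + z.1 + z.2 • w := by fun_prop
    exact this.measurable

/-! ### Comparison of values near different points of the domain -/

theorem ofReal_sq_add_le (a b : ℝ) :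
    ENNReal.ofReal ((a + b) ^ 2) ≤ 2 * ENNReal.ofReal (a ^ 2) + 2 * ENNReal.ofReal (b ^ 2) := by
  have h2 : (2 : ℝ≥0∞) = ENNReal.ofReal 2 := by norm_num
  rw [h2, ← ENNReal.ofReal_mul (by norm_num), ← ENNReal.ofReal_mul (by norm_num),
    ← ENNReal.ofReal_add (by positivity) (by positivity)]
  exact ENNReal.ofReal_le_ofReal (by nlinarith [sq_nonneg (a - b)])

theorem lintegral_sq_add_le {B : Set Plane} {f g : Plane → ℝ} (hf : Measurable f) :
    ∫⁻ v in B, ENNReal.ofReal ((f v + g v) ^ 2) ≤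
      2 * (∫⁻ v in B, ENNReal.ofReal (f v ^ 2)) + 2 * ∫⁻ v in B, ENNReal.ofReal (g v ^ 2) := by
  refine (lintegral_mono fun v => ofReal_sq_add_le (f v) (g v)).trans ?_
  rw [lintegral_add_left (by fun_prop), lintegral_const_mul' _ _ (by simp),
    lintegral_const_mul' _ _ (by simp)]

/-- The values of a function near `x` and near `y` are linked by its upper gradient. -/
def Linked (S : Set Plane) (x y : Plane) : Prop :=
  ∃ ρ₀ : ℝ, 0 < ρ₀ ∧ ∀ ρ, 0 < ρ → ρ ≤ ρ₀ → ∃ C : NNReal, ∀ u G, IsUpperGradient S u G →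
    ∫⁻ v in Metric.ball (0 : Plane) ρ, ENNReal.ofReal ((u (x + v) - u (y + v)) ^ 2) ≤
      C * ∫⁻ p, G p ^ 2

theorem Linked.symm {S : Set Plane} {x y : Plane} (h : Linked S x y) : Linked S y x := by
  obtain ⟨ρ₀, hρ₀, h⟩ := h
  refine ⟨ρ₀, hρ₀, fun ρ h0 h1 => ?_⟩
  obtain ⟨C, hC⟩ := h ρ h0 h1
  refine ⟨C, fun u G hu => ?_⟩
  simpa only [← neg_sub (u (x + _)), neg_sq] using hC u G hu

theorem Linked.trans {S : Set Plane} {x y z : Plane} (h : Linked S x y) (h' : Linked S y z) :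
    Linked S x z := by
  obtain ⟨ρ₀, hρ₀, h⟩ := h
  obtain ⟨ρ₁, hρ₁, h'⟩ := h'
  refine ⟨min ρ₀ ρ₁, lt_min hρ₀ hρ₁, fun ρ h0 h1 => ?_⟩
  obtain ⟨C, hC⟩ := h ρ h0 (h1.trans (min_le_left _ _))
  obtain ⟨C', hC'⟩ := h' ρ h0 (h1.trans (min_le_right _ _))
  refine ⟨2 * C + 2 * C', fun u G hu => ?_⟩
  have hm := hu.measurable_fun
  have h2 := lintegral_sq_add_le (B := Metric.ball (0 : Plane) ρ)
    (f := fun v => u (x + v) - u (y + v)) (g := fun v => u (y + v) - u (z + v)) (by fun_prop)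
  simp only [sub_add_sub_cancel] at h2
  refine h2.trans ?_
  push_cast
  rw [add_mul, mul_assoc, mul_assoc]
  gcongr
  · exact hC u G hu
  · exact hC' u G hu

/-- All segments from `x + v` to `y + v` are translates of one another and stay in the ball about
`x` of radius `r`, because both `v` and `y - x` are shorter than `r / 2`. -/
theorem linked_of_mem_ball {S : Set Plane} {x y : Plane} {r : ℝ} (hr : 0 < r)
    (hS : Metric.ball x r ⊆ S) (hy : y ∈ Metric.ball x (r / 2)) : Linked S x y := by
  refine ⟨r / 2, by positivity, fun ρ h0 h1 => ⟨(‖y - x‖ ^ 2).toNNReal, fun u G hu => ?_⟩⟩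
  have hp : ∀ v ∈ Metric.ball (0 : Plane) ρ, ENNReal.ofReal ((u (x + v) - u (y + v)) ^ 2) ≤
      ENNReal.ofReal (‖y - x‖ ^ 2) *
        ∫⁻ s in Set.Icc (0 : ℝ) 1, G (x + v + s • (y - x)) ^ 2 := by
    intro v hv
    have h2 := hu.sq_le (x + v) (y - x) zero_le_one le_rfl (fun s hs => hS ?_)
    · have e : x + v + (1 : ℝ) • (y - x) = y + v := by module
      rw [e] at h2
      rwa [← neg_sub, neg_sq] at h2
    · rw [mem_ball_iff_norm] at hy ⊢
      rw [mem_ball_zero_iff] at hv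
      have e : x + v + s • (y - x) - x = v + s • (y - x) := by abel
      rw [e]
      have h3 : ‖s • (y - x)‖ ≤ ‖y - x‖ := by
        rw [norm_smul, Real.norm_of_nonneg hs.1]
        exact mul_le_of_le_one_left (norm_nonneg _) hs.2
      have := norm_add_le v (s • (y - x))
      linarith
  refine (setLIntegral_mono' measurableSet_ball hp).trans ?_
  rw [lintegral_const_mul' _ _ ENNReal.ofReal_ne_top]
  have h4 := lintegral_translate_le (hu.measurable_grad.pow_const 2) x (y - x)
    (Metric.ball (0 : Plane) ρ)
  exact mul_le_mul_right h4 _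

/-- Being linked is symmetric and transitive, and every point of `ω` is linked to a neighbourhood of
itself. The points linked to `x` and the others therefore form two disjoint open sets covering the
connected set. -/
theorem linked_of_isPreconnected {S ω : Set Plane} (hω : IsOpen ω) (hc : IsPreconnected ω)
    (hS : ω ⊆ S) {x y : Plane} (hx : x ∈ ω) (hy : y ∈ ω) : Linked S x y := by
  have hloc : ∀ z ∈ ω, ∃ r > 0, ∀ p ∈ Metric.ball z r, p ∈ ω ∧ Linked S z p := by
    intro z hz
    obtain ⟨r, hr, hb⟩ := Metric.isOpen_iff.1 hω z hz
    exact ⟨r / 2, by positivity, fun p hp =>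
      ⟨hb (Metric.ball_subset_ball (by linarith) hp),
        linked_of_mem_ball hr (hb.trans hS) hp⟩⟩
  set U : Set Plane := {p | p ∈ ω ∧ Linked S x p}
  set V : Set Plane := {p | p ∈ ω ∧ ¬ Linked S x p}
  have hU : IsOpen U := by
    rw [Metric.isOpen_iff]
    rintro z ⟨hz, hxz⟩
    obtain ⟨r, hr, h⟩ := hloc z hz
    exact ⟨r, hr, fun p hp => ⟨(h p hp).1, hxz.trans (h p hp).2⟩⟩
  have hV : IsOpen V := by
    rw [Metric.isOpen_iff]
    rintro z ⟨hz, hxz⟩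
    obtain ⟨r, hr, h⟩ := hloc z hz
    exact ⟨r, hr, fun p hp => ⟨(h p hp).1, fun hxp => hxz (hxp.trans (h p hp).2.symm)⟩⟩
  by_contra hxy
  obtain ⟨r, hr, h⟩ := hloc x hx
  have hxx : Linked S x x := (h x (Metric.mem_ball_self hr)).2
  obtain ⟨z, -, hz1, hz2⟩ := hc U V hU hV (fun z hz => by
    by_cases h : Linked S x z
    · exact Or.inl ⟨hz, h⟩
    · exact Or.inr ⟨hz, h⟩) ⟨x, hx, hx, hxx⟩ ⟨y, hy, hy, hxy⟩
  exact hz2.2 hz1.2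

/-- The oscillation of a function between a small neighbourhood of a point `x` and a ball in a
convex set that contains `x` grows at most logarithmically. -/
theorem lintegral_sub_sq_le_log {S K : Set Plane} (hK : Convex ℝ K) (hKS : K ⊆ S) {R : ℝ}
    (hR : ∀ x ∈ S, ∀ y ∈ S, ‖x - y‖ ≤ R) {x c : Plane} {ρ : ℝ} (hρ : 0 < ρ) (hx : x ∈ K)
    (hc : Metric.ball c ρ ⊆ K) (hd : 2 * ρ ≤ ‖c - x‖) {u : Plane → ℝ} {G : Plane → ℝ≥0∞}
    (hu : IsUpperGradient S u G) {ε : ℝ} (hε0 : 0 < ε) (hε1 : ε ≤ 1) {m κ : ℝ}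
    (hm : ∀ y ∈ S, ‖y - x‖ ≤ ε * R → (m - u y) ^ 2 ≤ κ) :
    ∫⁻ v in Metric.ball (0 : Plane) ρ, ENNReal.ofReal ((m - u (c + v)) ^ 2) ≤
      2 * (ENNReal.ofReal κ * volume (Metric.ball (0 : Plane) ρ)) +
        2 * (ENNReal.ofReal (R ^ 2 * Real.log (1 / ε)) * (2 * ∫⁻ p, G p ^ 2)) := by
  have hlog : 0 ≤ Real.log (1 / ε) := Real.log_nonneg (by rw [le_div_iff₀ hε0]; linarith)
  have hGm := hu.measurable_grad.pow_const 2
  have htrans : ∫⁻ v in Metric.ball (0 : Plane) ρ, ENNReal.ofReal ((m - u (c + v)) ^ 2) =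
      ∫⁻ p in Metric.ball c ρ, ENNReal.ofReal ((m - u p) ^ 2) := by
    rw [← lintegral_indicator measurableSet_ball, ← lintegral_indicator measurableSet_ball,
      ← lintegral_add_left_eq_self ((Metric.ball c ρ).indicator _) c]
    refine lintegral_congr fun v => ?_
    have : v ∈ Metric.ball (0 : Plane) ρ ↔ c + v ∈ Metric.ball c ρ := by
      simp
    by_cases hv : v ∈ Metric.ball (0 : Plane) ρ
    · rw [Set.indicator_of_mem hv, Set.indicator_of_mem (this.1 hv)]
    · rw [Set.indicator_of_notMem hv, Set.indicator_of_notMem (mt this.2 hv)]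
  have hvol : volume (Metric.ball (0 : Plane) ρ) = volume (Metric.ball c ρ) := by
    rw [Measure.addHaar_ball_center volume c]
  rw [htrans, hvol]
  have hseg : ∀ p ∈ K, ∀ s ∈ Set.Icc (0 : ℝ) 1, x + s • (p - x) ∈ K := fun p hp s hs =>
    hK.add_smul_sub_mem hx hp hs
  -- On the segment from `x` to `p`, the part up to the parameter `ε` is covered by the assumption
  -- `hm`, the remaining part by the logarithmic estimate.
  have hp : ∀ p ∈ Metric.ball c ρ, ENNReal.ofReal ((m - u p) ^ 2) ≤ 2 * ENNReal.ofReal κ +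
      2 * (ENNReal.ofReal (R ^ 2 * Real.log (1 / ε)) *
        ∫⁻ s in Set.Icc ε 1, ENNReal.ofReal s * G (x + s • (p - x)) ^ 2) := by
    intro p hpb
    have hpK := hc hpb
    have h1 := hu.sq_le_log x (p - x) hε0 hε1 fun s hs =>
      hKS (hseg p hpK s ⟨hε0.le.trans hs.1, hs.2⟩)
    rw [add_sub_cancel] at h1
    have hn : ‖p - x‖ ≤ R := hR p (hKS hpK) x (hKS hx)
    have h2 : (m - u (x + ε • (p - x))) ^ 2 ≤ κ := by
      refine hm _ (hKS (hseg p hpK ε ⟨hε0.le, hε1⟩)) ?_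
      rw [add_sub_cancel_left, norm_smul, Real.norm_of_nonneg hε0.le]
      gcongr
    have e : m - u p = (m - u (x + ε • (p - x))) + -(u p - u (x + ε • (p - x))) := by ring
    rw [e]
    refine (ofReal_sq_add_le _ _).trans ?_
    rw [neg_sq]
    refine add_le_add (mul_le_mul_right (ENNReal.ofReal_le_ofReal h2) _)
      (mul_le_mul_right (h1.trans (mul_le_mul_left (ENNReal.ofReal_le_ofReal ?_) _)) _)
    gcongr
  refine (setLIntegral_mono' measurableSet_ball hp).trans ?_
  rw [lintegral_add_left measurable_const, setLIntegral_const,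
    lintegral_const_mul' _ _ (by simp), lintegral_const_mul' _ _ ENNReal.ofReal_ne_top, mul_assoc]
  gcongr
  exact lintegral_cone_le hGm x c hρ hd hε0

theorem exists_pos_le_of_finite {ι : Type*} [Finite ι] (f : ι → ℝ) (hf : ∀ i, 0 < f i) :
    ∃ r : ℝ, 0 < r ∧ ∀ i, r ≤ f i := by
  cases isEmpty_or_nonempty ι
  · exact ⟨1, one_pos, fun i => isEmptyElim i⟩
  · obtain ⟨i, hi⟩ := Finite.exists_min f
    exact ⟨f i, hf i, hi⟩

/-! ### The logarithmic Sobolev inequality on a triangulated domain -/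

namespace Triangulation

variable {ω : Set Plane} (T : Triangulation ω)

/-- A function that vanishes on an edge of a triangle is controlled on the triangle. -/
theorem sq_le_of_edge_eq_zero {t : Fin T.n} {i : Fin 3} {u : Plane → ℝ} {G : Plane → ℝ≥0∞}
    (hu : IsUpperGradient (closure ω) u G) (h0 : ∀ x ∈ T.edge t i, u x = 0) {p : Plane}
    (hp : p ∈ T.cell t) :
    ENNReal.ofReal (u p ^ 2) ≤ ENNReal.ofReal (‖T.mid t i - T.vert t i‖ ^ 2) *
      ∫⁻ s in Set.Icc (0 : ℝ) 1, G (p + s • (T.mid t i - T.vert t i)) ^ 2 := by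
  have hb := (T.mem_cell_iff t p).1 hp
  have hs := T.sum_bary t p
  have hsv := T.sum_bary_smul t p
  set b := Poly.val (T.bary t i) p with hbdef
  set w := T.mid t i - T.vert t i with hw
  -- Moving along the median direction `w` lowers the coordinate of vertex `i` at unit rate, so the
  -- edge is reached after time `b`. The direction does not depend on `p`, which allows integration
  -- over translates.
  have hedge : p + b • w ∈ T.edge t i := by
    refine ⟨Poly.val (T.bary t (i + 1)) p + b / 2, Poly.val (T.bary t (i + 2)) p + b / 2,
      by linarith [hb i, hb (i + 1)], by linarith [hb i, hb (i + 2)], ?_, ?_⟩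
    · rw [← hs]; fin_cases i <;> simp [Fin.sum_univ_three, hbdef] <;> ring
    · have : p = b • T.vert t i + Poly.val (T.bary t (i + 1)) p • T.vert t (i + 1) +
          Poly.val (T.bary t (i + 2)) p • T.vert t (i + 2) := by
        conv_lhs => rw [← hsv]
        fin_cases i <;> simp [Fin.sum_univ_three, hbdef] <;> abel
      conv_rhs => rw [this]
      rw [hw, mid, midpoint_eq_smul_add, invOf_eq_inv]
      module
  have hmem : p + b • w ∈ T.cell t :=
    (T.convex_cell t).segment_subset (T.vert_mem_cell t _) (T.vert_mem_cell t _) hedge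
  have h1 := hu.sq_le p w (hb i) (T.bary_le_one hp i) fun s hs => T.cell_subset t ?_
  · rwa [h0 _ hedge, zero_sub, neg_sq] at h1
  · rcases (hb i).eq_or_lt with h | h
    · have : s = 0 := le_antisymm (hs.2.trans h.symm.le) hs.1
      simpa [this] using hp
    · have h2 := (T.convex_cell t).add_smul_sub_mem hp hmem (t := s / b)
        ⟨div_nonneg hs.1 (hb i), (div_le_one h).2 hs.2⟩
      have hbne : b ≠ 0 := h.ne'
      rwa [add_sub_cancel_left, smul_smul, div_mul_cancel₀ _ hbne] at h2

/-- The cone estimate needs a ball whose centre has distance at least twice its radius from `x`. Of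
two balls that are far apart, one qualifies for every `x`. The centres lie in `ω` itself, so that
they can be linked. -/
theorem exists_pair_in_cell (hω : IsOpen ω) (t : Fin T.n) :
    ∃ (c c' : Plane) (r : ℝ), 0 < r ∧ c ∈ ω ∧ c' ∈ ω ∧ Metric.ball c r ⊆ T.cell t ∧
      Metric.ball c' r ⊆ T.cell t ∧ 4 * r ≤ ‖c - c'‖ := by
  obtain ⟨x, hx⟩ := T.interior_cell_nonempty t
  have hxc : x ∈ closure ω := T.cell_subset t (interior_subset hx)
  obtain ⟨c, hc1, hc2⟩ := mem_closure_iff.1 hxc _ isOpen_interior hx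
  obtain ⟨r, hr, hb⟩ := Metric.isOpen_iff.1 (isOpen_interior.inter hω) c ⟨hc1, hc2⟩
  refine ⟨c, c + (r / 2) • EuclideanSpace.single 0 1, r / 8, by positivity, hc2,
    (hb ?_).2, fun y hy => ?_, fun y hy => ?_, ?_⟩
  · rw [mem_ball_iff_norm, add_sub_cancel_left, norm_smul]
    simp [abs_of_pos hr]; linarith
  · exact interior_subset (hb (Metric.ball_subset_ball (by linarith) hy)).1
  · refine interior_subset (hb ?_).1
    rw [mem_ball_iff_norm] at hy ⊢
    have h1 : ‖(r / 2) • (EuclideanSpace.single 0 1 : Plane)‖ = r / 2 := by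
      rw [norm_smul]; simp [abs_of_pos hr]
    have h2 := norm_add_le (y - (c + (r / 2) • (EuclideanSpace.single 0 1 : Plane)))
      ((r / 2) • EuclideanSpace.single 0 1)
    have e : y - (c + (r / 2) • (EuclideanSpace.single 0 1 : Plane)) +
      (r / 2) • EuclideanSpace.single 0 1 = y - c := by abel
    rw [e] at h2
    linarith
  · rw [sub_add_cancel_left, norm_neg, norm_smul]
    simp [abs_of_pos hr]; linarith

/-- A logarithmic Sobolev type inequality in a planar domain that has a triangulation, for functions
that vanish on an edge of this triangulation. -/
theorem exists_log_sobolev (hω : IsOpen ω) (hωc : IsConnected ω) (t₁ : Fin T.n) (i₁ : Fin 3) :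
    ∃ C R : ℝ, 0 < C ∧ 0 < R ∧ (∀ x ∈ closure ω, ∀ y ∈ closure ω, ‖x - y‖ ≤ R) ∧
      ∀ (u : Plane → ℝ) (G : Plane → ℝ≥0∞) (I : ℝ), IsUpperGradient (closure ω) u G →
      0 ≤ I → ∫⁻ p, G p ^ 2 ≤ ENNReal.ofReal I → (∀ x ∈ T.edge t₁ i₁, u x = 0) →
      ∀ x ∈ closure ω, ∀ ε m κ : ℝ, 0 < ε → ε ≤ 1 → 0 ≤ κ →
      (∀ y ∈ closure ω, ‖y - x‖ ≤ ε * R → (m - u y) ^ 2 ≤ κ) →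
      m ^ 2 ≤ C * (κ + (1 + Real.log (1 / ε)) * I) := by
  choose c c' r hr hc hc' hb hb' hcc using T.exists_pair_in_cell hω
  set b := c t₁ with hbdef
  have hS : ω ⊆ closure ω := subset_closure
  -- Finitely many triangles give finitely many chains to the base point `b`; a common radius `ρ`
  -- and a common constant `A₀` serve them all.
  have L1 := fun t => linked_of_isPreconnected hω hωc.isPreconnected hS (hc t) (hc t₁)
  have L2 := fun t => linked_of_isPreconnected hω hωc.isPreconnected hS (hc' t) (hc t₁)
  choose r1 hr1 L1 using L1
  choose r2 hr2 L2 using L2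
  obtain ⟨ρ, hρ, hρle⟩ := exists_pos_le_of_finite (fun t => min (r t) (min (r1 t) (r2 t)))
    fun t => lt_min (hr t) (lt_min (hr1 t) (hr2 t))
  have hρr : ∀ t, ρ ≤ r t := fun t => (hρle t).trans (min_le_left _ _)
  have L1 := fun t => L1 t ρ hρ ((hρle t).trans ((min_le_right _ _).trans (min_le_left _ _)))
  have L2 := fun t => L2 t ρ hρ ((hρle t).trans ((min_le_right _ _).trans (min_le_right _ _)))
  choose A hA using L1
  choose A' hA' using L2
  obtain ⟨R₀, hR₀⟩ := (Metric.isBounded_iff.1 T.isCompact_closure.isBounded)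
  set R := max R₀ 1 with hRdef
  have hR : ∀ x ∈ closure ω, ∀ y ∈ closure ω, ‖x - y‖ ≤ R := fun x hx y hy => by
    rw [← dist_eq_norm]; exact (hR₀ hx hy).trans (le_max_left _ _)
  have hR0 : 0 < R := lt_max_of_lt_right one_pos
  set B := Metric.ball (0 : Plane) ρ with hBdef
  set V := volume.real B with hVdef
  have hVtop : volume B ≠ ⊤ := measure_ball_lt_top.ne
  have hV : 0 < V := ENNReal.toReal_pos (Metric.measure_ball_pos _ _ hρ).ne' hVtop
  have hVe : volume B = ENNReal.ofReal V := (ENNReal.ofReal_toReal hVtop).symm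
  set A₀ : NNReal := ∑ t, (A t + A' t) with hA₀
  have hAle : ∀ t, A t ≤ A₀ := fun t =>
    (le_add_of_nonneg_right (by simp)).trans
      (Finset.single_le_sum (f := fun t => A t + A' t) (by simp) (Finset.mem_univ t))
  have hAle' : ∀ t, A' t ≤ A₀ := fun t =>
    (le_add_of_nonneg_left (by simp)).trans
      (Finset.single_le_sum (f := fun t => A t + A' t) (by simp) (Finset.mem_univ t))
  set W := ‖T.mid t₁ i₁ - T.vert t₁ i₁‖ ^ 2 with hW
  -- Three uses of $(a+b)^2\le2a^2+2b^2$ lead from `m` through the ball about `d` and the ball about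
  -- `b` to the edge. They produce the factors 8, 16, 4 and 2; the factor 16 also contains the 2 of
  -- the cone estimate.
  refine ⟨8 + (16 * R ^ 2 + 4 * A₀ + 2 * W) / V, R, by positivity, hR0, hR, ?_⟩
  intro u G I hu hI hGI hedge x hx ε m κ hε0 hε1 hκ hm
  have hlog : 0 ≤ Real.log (1 / ε) := Real.log_nonneg (by rw [le_div_iff₀ hε0]; linarith)
  have hum := hu.measurable_fun
  obtain ⟨t, ht⟩ := T.exists_mem_cell hx
  -- the ball in the triangle of `x` that is not close to `x`
  obtain ⟨d, hdK, hdd, hdl⟩ : ∃ d : Plane, Metric.ball d ρ ⊆ T.cell t ∧ 2 * ρ ≤ ‖d - x‖ ∧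
      ∫⁻ v in B, ENNReal.ofReal ((u (d + v) - u (b + v)) ^ 2) ≤ A₀ * ∫⁻ p, G p ^ 2 := by
    by_cases h : 2 * ρ ≤ ‖c t - x‖
    · refine ⟨c t, (Metric.ball_subset_ball (hρr t)).trans (hb t), h, (hA t u G hu).trans ?_⟩
      gcongr
      exact hAle t
    · refine ⟨c' t, (Metric.ball_subset_ball (hρr t)).trans (hb' t), ?_, (hA' t u G hu).trans ?_⟩
      · have h1 := norm_sub_le_norm_sub_add_norm_sub (c t) x (c' t)
        rw [norm_sub_rev x] at h1
        linarith [hcc t, hρr t]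
      · gcongr
        exact hAle' t
  have h1 := lintegral_sub_sq_le_log (T.convex_cell t) (T.cell_subset t) hR hρ ht hdK hdd hu
    hε0 hε1 hm
  have h2 : ∫⁻ v in B, ENNReal.ofReal ((m - u (b + v)) ^ 2) ≤
      2 * (∫⁻ v in B, ENNReal.ofReal ((m - u (d + v)) ^ 2)) +
        2 * ∫⁻ v in B, ENNReal.ofReal ((u (d + v) - u (b + v)) ^ 2) := by
    have := lintegral_sq_add_le (B := B) (f := fun v => m - u (d + v))
      (g := fun v => u (d + v) - u (b + v)) (by fun_prop)
    simpa only [sub_add_sub_cancel] using this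
  have h3 : ∫⁻ v in B, ENNReal.ofReal (m ^ 2) ≤
      2 * (∫⁻ v in B, ENNReal.ofReal ((m - u (b + v)) ^ 2)) +
        2 * ∫⁻ v in B, ENNReal.ofReal (u (b + v) ^ 2) := by
    have := lintegral_sq_add_le (B := B) (f := fun v => m - u (b + v))
      (g := fun v => u (b + v)) (by fun_prop)
    simpa only [sub_add_cancel] using this
  have h4 : ∫⁻ v in B, ENNReal.ofReal (u (b + v) ^ 2) ≤
      ENNReal.ofReal W * ∫⁻ p, G p ^ 2 := by
    have hp : ∀ v ∈ B, ENNReal.ofReal (u (b + v) ^ 2) ≤ ENNReal.ofReal W *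
        ∫⁻ s in Set.Icc (0 : ℝ) 1, G (b + v + s • (T.mid t₁ i₁ - T.vert t₁ i₁)) ^ 2 := by
      intro v hv
      refine T.sq_le_of_edge_eq_zero hu hedge (hb t₁ ?_)
      rw [hBdef, mem_ball_zero_iff] at hv
      rw [mem_ball_iff_norm, add_sub_cancel_left]
      exact hv.trans_le (hρr t₁)
    refine (setLIntegral_mono' measurableSet_ball hp).trans ?_
    rw [lintegral_const_mul' _ _ ENNReal.ofReal_ne_top]
    exact mul_le_mul_right
      (lintegral_translate_le (hu.measurable_grad.pow_const 2) _ _ _) _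
  rw [setLIntegral_const] at h3
  have h5 : ENNReal.ofReal (m ^ 2) * ENNReal.ofReal V ≤
      2 * (2 * (2 * (ENNReal.ofReal κ * ENNReal.ofReal V) +
        2 * (ENNReal.ofReal (R ^ 2 * Real.log (1 / ε)) * (2 * ENNReal.ofReal I))) +
        2 * (ENNReal.ofReal A₀ * ENNReal.ofReal I)) +
      2 * (ENNReal.ofReal W * ENNReal.ofReal I) := by
    rw [← hVe, ENNReal.ofReal_coe_nnreal]
    refine h3.trans ?_
    gcongr
    · refine h2.trans ?_
      gcongr
      · refine h1.trans ?_
        gcongr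
      · refine hdl.trans ?_
        gcongr
    · refine h4.trans ?_
      gcongr
  have h6 : m ^ 2 * V ≤ 2 * (2 * (2 * (κ * V) + 2 * (R ^ 2 * Real.log (1 / ε) * (2 * I))) +
      2 * (A₀ * I)) + 2 * (W * I) := by
    have e2 : (2 : ℝ≥0∞) = ENNReal.ofReal 2 := by norm_num
    have hRl : 0 ≤ R ^ 2 * Real.log (1 / ε) := by positivity
    rw [e2] at h5
    rw [← ENNReal.ofReal_le_ofReal_iff (by positivity)]
    refine le_trans (le_of_eq ?_) (h5.trans (le_of_eq ?_))
    · rw [ENNReal.ofReal_mul (by positivity)]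
    · repeat rw [← ENNReal.ofReal_mul (by positivity)]
      repeat rw [← ENNReal.ofReal_add (by positivity) (by positivity)]
      repeat rw [← ENNReal.ofReal_mul (by positivity)]
      repeat rw [← ENNReal.ofReal_add (by positivity) (by positivity)]
      repeat rw [← ENNReal.ofReal_mul (by positivity)]
      repeat rw [← ENNReal.ofReal_add (by positivity) (by positivity)]
  set l := Real.log (1 / ε)
  have h7 : m ^ 2 ≤ (8 * (κ * V) + (16 * R ^ 2 * l + 4 * A₀ + 2 * W) * I) / V := by
    rw [le_div_iff₀ hV]; linarith
  refine h7.trans ?_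
  have hA0 : (0 : ℝ) ≤ A₀ := A₀.2
  have hW0 : 0 ≤ W := by positivity
  have h8 : (16 * R ^ 2 * l + 4 * A₀ + 2 * W) * I ≤
      (16 * R ^ 2 + 4 * A₀ + 2 * W) * ((1 + l) * I) := by
    have : 0 ≤ 16 * R ^ 2 * I + (4 * A₀ + 2 * W) * (l * I) := by positivity
    nlinarith
  rw [div_le_iff₀ hV]
  have h9 : (8 + (16 * R ^ 2 + 4 * A₀ + 2 * W) / V) * (κ + (1 + l) * I) * V =
      8 * (κ * V) + (16 * R ^ 2 + 4 * A₀ + 2 * W) * ((1 + l) * I) + (8 * ((1 + l) * I) * V +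
        (16 * R ^ 2 + 4 * A₀ + 2 * W) * κ) := by
    field_simp; ring
  rw [h9]
  have : 0 ≤ 8 * ((1 + l) * I) * V + (16 * R ^ 2 + 4 * A₀ + 2 * W) * κ := by positivity
  linarith

/-! ### Continuous piecewise polynomials and their upper gradients -/

/-- Polynomials on the triangles that fit together to a continuous function. -/
def IsConforming (f : Fin T.n → Poly) : Prop :=
  ∀ t t' x, x ∈ T.cell t → x ∈ T.cell t' → Poly.val (f t) x = Poly.val (f t') x

open Classical in
/-- The function given by polynomials on the triangles. -/
noncomputable def glue (f : Fin T.n → Poly) (x : Plane) : ℝ :=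
  if h : ∃ t, x ∈ T.cell t then Poly.val (f h.choose) x else 0

variable {T} in
theorem IsConforming.glue_eq {f : Fin T.n → Poly} (hf : T.IsConforming f) {t : Fin T.n} {x : Plane}
    (hx : x ∈ T.cell t) : T.glue f x = Poly.val (f t) x := by
  have h : ∃ t, x ∈ T.cell t := ⟨t, hx⟩
  rw [glue, dif_pos h]
  exact hf _ _ _ h.choose_spec hx

variable {T} in
theorem IsConforming.continuousOn_glue {f : Fin T.n → Poly} (hf : T.IsConforming f) :
    ContinuousOn (T.glue f) (closure ω) := by
  rw [← T.covers]
  refine (locallyFinite_of_finite _).continuousOn_iUnion (fun t => T.isClosed_cell t) fun t => ?_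
  exact (Poly.continuous_val (f t)).continuousOn.congr fun x hx => hf.glue_eq hx

variable {T} in
theorem IsConforming.measurable_glue {f : Fin T.n → Poly} (hf : T.IsConforming f) :
    Measurable (T.glue f) := by
  classical
  have h : T.glue f = (closure ω).piecewise (T.glue f) 0 := by
    ext x
    by_cases hx : x ∈ closure ω
    · rw [Set.piecewise_eq_of_mem _ _ _ hx]
    · rw [Set.piecewise_eq_of_notMem _ _ _ hx, glue, dif_neg]
      · rfl
      · rintro ⟨t, ht⟩; exact hx (T.cell_subset t ht)
  rw [h]
  exact hf.continuousOn_glue.measurable_piecewise continuousOn_const isClosed_closure.measurableSet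

/-- The squared modulus of the gradients of polynomials on the triangles. -/
noncomputable def gradSq (f : Fin T.n → Poly) (x : Plane) : ℝ :=
  ∑ t, (T.cell t).indicator (fun x => ‖Poly.grad (f t) x‖ ^ 2) x

theorem _root_.BilayerPlate.Poly.continuous_grad (P : Poly) : Continuous (Poly.grad P) := by
  have h := fun j => Poly.continuous_val (MvPolynomial.pderiv j P)
  unfold Poly.grad
  fun_prop

theorem measurable_gradSq (f : Fin T.n → Poly) : Measurable (T.gradSq f) := by
  unfold gradSq
  refine Finset.measurable_fun_sum _ fun t _ => ?_
  exact ((Poly.continuous_grad (f t)).norm.pow 2).measurable.indicator (T.measurableSet_cell t)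

theorem gradSq_nonneg (f : Fin T.n → Poly) (x : Plane) : 0 ≤ T.gradSq f x :=
  Finset.sum_nonneg fun _ _ => Set.indicator_nonneg (fun _ _ => sq_nonneg _) _

/-- On common edges `gradSq` adds the contributions of several triangles. It thus dominates the
gradient of every piece, also along segments that run inside an edge. -/
theorem norm_grad_le_sqrt (f : Fin T.n → Poly) {t : Fin T.n} {x : Plane} (hx : x ∈ T.cell t) :
    ‖Poly.grad (f t) x‖ ≤ Real.sqrt (T.gradSq f x) := by
  refine Real.le_sqrt_of_sq_le ?_
  have h := Finset.single_le_sum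
    (f := fun t => (T.cell t).indicator (fun x => ‖Poly.grad (f t) x‖ ^ 2) x)
    (fun _ _ => Set.indicator_nonneg (fun _ _ => sq_nonneg _) _) (Finset.mem_univ t)
  simp only [Set.indicator_of_mem hx] at h
  exact h

theorem lintegral_gradSq (f : Fin T.n → Poly) :
    ∫⁻ x, ENNReal.ofReal (Real.sqrt (T.gradSq f x)) ^ 2 =
      ENNReal.ofReal (∑ t, ∫ x in T.cell t, ‖Poly.grad (f t) x‖ ^ 2) := by
  have hc : ∀ t, Continuous fun x => ‖Poly.grad (f t) x‖ ^ 2 :=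
    fun t => (Poly.continuous_grad (f t)).norm.pow 2
  have h1 : ∀ x, ENNReal.ofReal (Real.sqrt (T.gradSq f x)) ^ 2 =
      ∑ t, (T.cell t).indicator (fun x => ENNReal.ofReal (‖Poly.grad (f t) x‖ ^ 2)) x := by
    intro x
    rw [← ENNReal.ofReal_pow (Real.sqrt_nonneg _), Real.sq_sqrt (T.gradSq_nonneg f x), gradSq,
      ENNReal.ofReal_sum_of_nonneg fun t _ => Set.indicator_nonneg (fun _ _ => sq_nonneg _) _]
    refine Finset.sum_congr rfl fun t _ => ?_
    by_cases hx : x ∈ T.cell t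
    · rw [Set.indicator_of_mem hx, Set.indicator_of_mem hx]
    · rw [Set.indicator_of_notMem hx, Set.indicator_of_notMem hx, ENNReal.ofReal_zero]
  simp_rw [h1]
  rw [lintegral_finsetSum _ fun t _ =>
    ((hc t).measurable.ennreal_ofReal).indicator (T.measurableSet_cell t),
    ENNReal.ofReal_sum_of_nonneg fun t _ => integral_nonneg fun x => sq_nonneg _]
  refine Finset.sum_congr rfl fun t _ => ?_
  rw [lintegral_indicator (T.measurableSet_cell t), ofReal_integral_eq_lintegral_ofReal]
  · exact (hc t).continuousOn.integrableOn_compact (T.isCompact_cell t)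
  · exact Filter.Eventually.of_forall fun x => sq_nonneg _

/-- Except for finitely many parameters, a line stays in a triangle for a while. -/
theorem exists_countable_mem_nhds (x q : Plane) (a b : ℝ) (t : Fin T.n) :
    ∃ E : Set ℝ, E.Countable ∧ ∀ s ∈ Set.Icc a b, s ∉ E → x + s • q ∈ T.cell t →
      ∀ᶠ r in nhds s, x + r • q ∈ T.cell t := by
  set I : Set ℝ := {s | s ∈ Set.Icc a b ∧ x + s • q ∈ T.cell t} with hI
  have hcont : Continuous fun s : ℝ => x + s • q := by fun_prop
  have hIc : IsCompact I := isCompact_Icc.inter_right ((T.isClosed_cell t).preimage hcont)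
  have hconv : Convex ℝ I := by
    refine (convex_Icc a b).inter ?_
    intro s hs r hr α β hα hβ hαβ
    have : x + (α • s + β • r) • q = α • (x + s • q) + β • (x + r • q) := by
      have hx : x = (α + β) • x := by rw [hαβ, one_smul]
      conv_lhs => rw [hx]
      simp only [smul_eq_mul]; module
    change x + (α • s + β • r) • q ∈ T.cell t
    rw [this]
    exact T.convex_cell t hs hr hα hβ hαβ
  -- By convexity the line is in the triangle for a whole interval of parameters, and only the ends
  -- of this interval are exceptional.
  refine ⟨{sInf I, sSup I}, (Set.toFinite _).countable, fun s hs hE hx => ?_⟩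
  have hsI : s ∈ I := ⟨hs, hx⟩
  have hIcc := eq_Icc_of_connected_compact ⟨⟨s, hsI⟩, hconv.isPreconnected⟩ hIc
  rw [Set.mem_insert_iff, Set.mem_singleton_iff, not_or] at hE
  have hs' : s ∈ Set.Icc (sInf I) (sSup I) := hIcc ▸ hsI
  have hnhds : I ∈ nhds s := by
    rw [hIcc]
    exact Icc_mem_nhds (lt_of_le_of_ne hs'.1 (Ne.symm hE.1)) (lt_of_le_of_ne hs'.2 hE.2)
  filter_upwards [hnhds] with r hr using hr.2

variable {T} in
theorem IsConforming.isUpperGradient {f : Fin T.n → Poly} (hf : T.IsConforming f) :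
    IsUpperGradient (closure ω) (T.glue f)
      fun x => ENNReal.ofReal (Real.sqrt (T.gradSq f x)) where
  measurable_fun := hf.measurable_glue
  measurable_grad := (T.measurable_gradSq f).sqrt.ennreal_ofReal
  le x q a b hab hS := by
    choose E hEc hE using T.exists_countable_mem_nhds x q a b
    have hEc' : (⋃ t, E t).Countable := Set.countable_iUnion hEc
    set g : ℝ → ℝ := fun s => T.glue f (x + s • q) with hg
    have hcont : ContinuousOn g (Set.Icc a b) :=
      hf.continuousOn_glue.comp (by fun_prop) fun s hs => hS s hs
    have hderiv : ∀ s ∈ Set.Icc a b, s ∉ ⋃ t, E t → ∃ t, x + s • q ∈ T.cell t ∧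
        HasDerivAt g (inner ℝ (Poly.grad (f t) (x + s • q)) q) s := by
      intro s hs hsE
      obtain ⟨t, ht⟩ := T.exists_mem_cell (hS s hs)
      refine ⟨t, ht, ?_⟩
      have h1 := hE t s hs (fun h => hsE (Set.mem_iUnion.2 ⟨t, h⟩)) ht
      refine (Poly.hasDerivAt_line (f t) x q s).congr_of_eventuallyEq ?_
      filter_upwards [h1] with r hr using hf.glue_eq hr
    have hbound : ∀ s ∈ Set.Icc a b, s ∉ ⋃ t, E t →
        |deriv g s| ≤ ‖q‖ * Real.sqrt (T.gradSq f (x + s • q)) := by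
      intro s hs hsE
      obtain ⟨t, ht, hd⟩ := hderiv s hs hsE
      rw [hd.deriv, mul_comm]
      refine (abs_real_inner_le_norm _ _).trans ?_
      exact mul_le_mul_of_nonneg_right (T.norm_grad_le_sqrt f ht) (norm_nonneg _)
    have hae : ∀ᵐ s ∂volume.restrict (Set.Ioc a b), s ∈ Set.Icc a b ∧ s ∉ ⋃ t, E t := by
      refine (ae_restrict_of_forall_mem measurableSet_Ioc fun s hs =>
        Set.Ioc_subset_Icc_self hs).and (ae_restrict_of_ae ?_)
      exact hEc'.ae_notMem _
    have hM : ∃ M : ℝ, ∀ t, ∀ p ∈ T.cell t, ‖Poly.grad (f t) p‖ ≤ M := by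
      choose M hM using fun t => (T.isCompact_cell t).exists_bound_of_continuousOn
        (Poly.continuous_grad (f t)).continuousOn
      refine ⟨∑ t, |M t|, fun t p hp => (hM t p hp).trans ((le_abs_self _).trans ?_)⟩
      exact Finset.single_le_sum (f := fun t => |M t|) (fun _ _ => abs_nonneg _)
        (Finset.mem_univ t)
    obtain ⟨M, hM⟩ := hM
    have hint : IntervalIntegrable (deriv g) volume a b := by
      rw [intervalIntegrable_iff_integrableOn_Ioc_of_le hab]
      refine Measure.integrableOn_of_bounded (M := M * ‖q‖) measure_Ioc_lt_top.ne
        (measurable_deriv g).aestronglyMeasurable ?_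
      filter_upwards [hae] with s hs
      obtain ⟨t, ht, hd⟩ := hderiv s hs.1 hs.2
      rw [hd.deriv]
      refine (norm_inner_le_norm _ _).trans ?_
      exact mul_le_mul_of_nonneg_right (hM t _ ht) (norm_nonneg _)
    -- The glued function is continuous along the segment and differentiable off a countable set
    -- with bounded derivative, which is enough for the fundamental theorem of calculus.
    have hftc := MeasureTheory.integral_eq_of_hasDerivAt_off_countable_of_le g (deriv g) hab
      hEc' hcont (fun s hs => by
        obtain ⟨t, ht, hd⟩ := hderiv s (Set.Ioo_subset_Icc_self hs.1) hs.2
        rw [hd.deriv]; exact hd) hint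
    change ENNReal.ofReal |g b - g a| ≤ _
    rw [← hftc, intervalIntegral.integral_of_le hab, ← Real.norm_eq_abs, ofReal_norm]
    refine (enorm_integral_le_lintegral_enorm _).trans ?_
    rw [← lintegral_const_mul' _ _ ENNReal.ofReal_ne_top]
    refine le_trans ?_ (lintegral_mono_set Set.Ioc_subset_Icc_self)
    refine lintegral_mono_ae ?_
    filter_upwards [hae] with s hs
    rw [← ENNReal.ofReal_mul (norm_nonneg _), ← ofReal_norm, Real.norm_eq_abs]
    exact ENNReal.ofReal_le_ofReal (hbound s hs.1 hs.2)

/-! ### The discrete Sobolev inequality in the maximum norm -/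

theorem integrableOn_cell {g : Plane → ℝ} (hg : Continuous g) (t : Fin T.n) :
    IntegrableOn g (T.cell t) :=
  hg.continuousOn.integrableOn_compact (T.isCompact_cell t)

/-- The squared modulus of the discrete Hessian on the triangle `t`. -/
noncomputable def hessSq (w : T.Deformation) (t : Fin T.n) (x : Plane) : ℝ :=
  ∑ a, ∑ j, ∑ k, Poly.val (T.discreteHess w t a j k) x ^ 2

theorem continuous_hessSq (w : T.Deformation) (t : Fin T.n) : Continuous (T.hessSq w t) := by
  unfold hessSq
  have h := fun a j k => Poly.continuous_val (T.discreteHess w t a j k)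
  fun_prop

theorem hessSq_nonneg (w : T.Deformation) (t : Fin T.n) (x : Plane) : 0 ≤ T.hessSq w t x :=
  Finset.sum_nonneg fun _ _ => Finset.sum_nonneg fun _ _ => Finset.sum_nonneg fun _ _ => sq_nonneg _

theorem star_self (w : T.Deformation) : T.star w w = ∑ t, ∫ x in T.cell t, T.hessSq w t x := by
  simp only [star, integral, Poly.val_sum, Poly.val_mul, hessSq, sq]

theorem star_self_nonneg (w : T.Deformation) : 0 ≤ T.star w w := by
  rw [star_self]
  exact Finset.sum_nonneg fun t _ => integral_nonneg (T.hessSq_nonneg w t)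

theorem integral_hessSq_le_star (w : T.Deformation) (t : Fin T.n) :
    ∫ x in T.cell t, T.hessSq w t x ≤ T.star w w := by
  rw [star_self]
  exact Finset.single_le_sum (f := fun t => ∫ x in T.cell t, T.hessSq w t x)
    (fun t _ => integral_nonneg (T.hessSq_nonneg w t)) (Finset.mem_univ t)

theorem norm_sq_grad (P : Poly) (x : Plane) :
    ‖Poly.grad P x‖ ^ 2 = ∑ k, Poly.val (MvPolynomial.pderiv k P) x ^ 2 := by
  rw [EuclideanSpace.norm_sq_eq]
  simp [Poly.grad]

/-- The component `j` of the discrete gradient of the component `a` of a deformation. -/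
noncomputable def gradPiece (w : T.Deformation) (a : Fin 3) (j : Fin 2) (t : Fin T.n) : Poly :=
  T.discreteGrad t ((w a).1 t) j

theorem isConforming_gradPiece (w : T.Deformation) (a : Fin 3) (j : Fin 2) :
    T.IsConforming (T.gradPiece w a j) :=
  fun _ _ _ hx hx' => T.discreteGrad_conforming (w a) j hx hx'

theorem gradPiece_vert (w : T.Deformation) (a : Fin 3) (j : Fin 2) (t : Fin T.n) (i : Fin 3) :
    Poly.val (T.gradPiece w a j t) (T.vert t i) = T.nodalGrad w t i a j := by
  rw [gradPiece, discreteGrad_vert]; rfl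

theorem norm_sq_grad_gradPiece_le (w : T.Deformation) (a : Fin 3) (j : Fin 2) (t : Fin T.n)
    (x : Plane) : ‖Poly.grad (T.gradPiece w a j t) x‖ ^ 2 ≤ T.hessSq w t x := by
  rw [norm_sq_grad]
  refine le_trans ?_ (Finset.single_le_sum (f := fun a => ∑ j, ∑ k,
    Poly.val (T.discreteHess w t a j k) x ^ 2) (fun _ _ => Finset.sum_nonneg fun _ _ =>
      Finset.sum_nonneg fun _ _ => sq_nonneg _) (Finset.mem_univ a))
  exact Finset.single_le_sum (f := fun j => ∑ k, Poly.val (T.discreteHess w t a j k) x ^ 2)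
    (fun _ _ => Finset.sum_nonneg fun _ _ => sq_nonneg _) (Finset.mem_univ j)

theorem sum_integral_grad_le_star (w : T.Deformation) (a : Fin 3) (j : Fin 2) :
    ∑ t, ∫ x in T.cell t, ‖Poly.grad (T.gradPiece w a j t) x‖ ^ 2 ≤ T.star w w := by
  rw [star_self]
  refine Finset.sum_le_sum fun t _ => ?_
  exact integral_mono (T.integrableOn_cell ((Poly.continuous_grad _).norm.pow 2) t)
    (T.integrableOn_cell (T.continuous_hessSq w t) t) (T.norm_sq_grad_gradPiece_le w a j t)

theorem sq_discreteHess_le (w : T.Deformation) (t : Fin T.n) (a : Fin 3) (j k : Fin 2) {x : Plane}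
    (hx : x ∈ T.cell t) : volume.real (T.cell t) * Poly.val (T.discreteHess w t a j k) x ^ 2 ≤
      64 * ∫ x in T.cell t, T.hessSq w t x := by
  refine ((T.isAffine_pderiv_discreteGrad t ((w a).1 t) j k).sq_le T hx).trans ?_
  refine mul_le_mul_of_nonneg_left ?_ (by norm_num)
  refine integral_mono (T.integrableOn_cell ((Poly.continuous_val _).pow 2) t)
    (T.integrableOn_cell (T.continuous_hessSq w t) t) fun x => ?_
  refine le_trans ?_ (T.norm_sq_grad_gradPiece_le w a j t x)
  rw [norm_sq_grad]
  exact Finset.single_le_sum (f := fun k => Poly.val (MvPolynomial.pderiv k (T.gradPiece w a j t)) x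
    ^ 2) (fun _ _ => sq_nonneg _) (Finset.mem_univ k)

/-- Inverse estimate for the oscillation of the discrete gradient on a triangle. -/
theorem sq_gradPiece_sub_le (w : T.Deformation) (a : Fin 3) (j : Fin 2) (t : Fin T.n) {p q : Plane}
    (hp : p ∈ T.cell t) (hq : q ∈ T.cell t) :
    volume.real (T.cell t) *
        (Poly.val (T.gradPiece w a j t) p - Poly.val (T.gradPiece w a j t) q) ^ 2 ≤
      T.diam t ^ 2 * (128 * ∫ x in T.cell t, T.hessSq w t x) := by
  set f := T.gradPiece w a j t with hf
  have hd := fun s => Poly.hasDerivAt_line f q (p - q) s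
  -- The mean value theorem on the segment from `q` to `p`. At the intermediate point each of the
  -- two partial derivatives obeys the inverse estimate with 64, together 128.
  obtain ⟨s, hs, hs'⟩ := exists_hasDerivAt_eq_slope (fun s : ℝ => Poly.val f (q + s • (p - q))) _
    one_pos (fun s _ => (hd s).continuousAt.continuousWithinAt) fun s _ => hd s
  simp only [one_smul, zero_smul, add_zero, add_sub_cancel, sub_zero, div_one] at hs'
  rw [← hs']
  have hx : q + s • (p - q) ∈ T.cell t :=
    (T.convex_cell t).add_smul_sub_mem hq hp ⟨hs.1.le, hs.2.le⟩
  have h1 : inner ℝ (Poly.grad f (q + s • (p - q))) (p - q) ^ 2 ≤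
      ‖Poly.grad f (q + s • (p - q))‖ ^ 2 * T.diam t ^ 2 := by
    rw [← sq_abs, ← mul_pow]
    refine pow_le_pow_left₀ (abs_nonneg _) ((abs_real_inner_le_norm _ _).trans ?_) 2
    refine mul_le_mul_of_nonneg_left ?_ (norm_nonneg _)
    rw [← dist_eq_norm]
    exact Metric.dist_le_diam_of_mem (T.isCompact_cell t).isBounded hp hq
  have h2 : volume.real (T.cell t) * ‖Poly.grad f (q + s • (p - q))‖ ^ 2 ≤
      128 * ∫ x in T.cell t, T.hessSq w t x := by
    rw [norm_sq_grad, Fin.sum_univ_two, mul_add]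
    have e0 := T.sq_discreteHess_le w t a j 0 hx
    have e1 := T.sq_discreteHess_le w t a j 1 hx
    have : ∀ k, T.discreteHess w t a j k = MvPolynomial.pderiv k f := fun k => rfl
    rw [this] at e0 e1
    linarith
  calc _ ≤ volume.real (T.cell t) * (‖Poly.grad f (q + s • (p - q))‖ ^ 2 * T.diam t ^ 2) :=
        mul_le_mul_of_nonneg_left h1 measureReal_nonneg
    _ = T.diam t ^ 2 * (volume.real (T.cell t) * ‖Poly.grad f (q + s • (p - q))‖ ^ 2) := by ring
    _ ≤ _ := mul_le_mul_of_nonneg_left h2 (sq_nonneg _)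

/-- The homogeneous boundary conditions of the discrete tangent spaces. -/
def VanishesOn (Γ : Set Plane) (w : T.Deformation) : Prop :=
  ∀ t i, T.vert t i ∈ Γ → (∀ a, Poly.val ((w a).1 t) (T.vert t i) = 0) ∧ T.nodalGrad w t i = 0

variable {T} in
theorem VanishesOn.grad_eq_zero {Γ : Set Plane} {w : T.Deformation} (hw : T.VanishesOn Γ w)
    {t : Fin T.n} {i : Fin 3} (h : T.vert t i ∈ Γ) (a : Fin 3) :
    Poly.grad ((w a).1 t) (T.vert t i) = 0 := by
  ext j
  have := congrFun (congrFun (hw t i h).2 a) j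
  simpa [nodalGrad] using this

variable {T} in
theorem VanishesOn.glue_eq_zero {Γ : Set Plane} (hΓ : T.Matches Γ) {w : T.Deformation}
    (hw : T.VanishesOn Γ w) (a : Fin 3) (j : Fin 2) {x : Plane} (hx : x ∈ Γ) :
    T.glue (T.gradPiece w a j) x = 0 := by
  obtain ⟨S, hS⟩ := hΓ
  have hx' := hx
  rw [hS, Set.mem_iUnion₂] at hx'
  obtain ⟨⟨t, i⟩, he, hxe⟩ := hx'
  have hsub : T.edge t i ⊆ Γ := by
    rw [hS]; exact Set.subset_biUnion_of_mem (u := fun e : Fin T.n × Fin 3 => T.edge e.1 e.2) he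
  have h1 : T.vert t (i + 1) ∈ Γ := hsub (left_mem_segment ℝ _ _)
  have h2 : T.vert t (i + 2) ∈ Γ := hsub (right_mem_segment ℝ _ _)
  have hxc : x ∈ T.cell t :=
    (T.convex_cell t).segment_subset (T.vert_mem_cell t _) (T.vert_mem_cell t _) hxe
  rw [(T.isConforming_gradPiece w a j).glue_eq hxc]
  exact T.discreteGrad_edge_eq_zero t _ (((w a).2.1 t).1) j i ((hw _ _ h1).1 a) ((hw _ _ h2).1 a)
    (hw.grad_eq_zero h1 a) (hw.grad_eq_zero h2 a) hxe

/-- The discrete Sobolev inequality in the maximum norm, with a logarithmic factor. -/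
theorem exists_discrete_sobolev {Γ : Set Plane} (hω : IsOpen ω) (hωc : IsConnected ω)
    (hΓ : Γ.Nonempty) (σ δ : ℝ) (hδ : 0 < δ) :
    ∃ C : ℝ, 0 < C ∧ ∀ T : Triangulation ω, T.ShapeRegular σ → T.Matches Γ →
      δ ≤ |Real.log T.hmin| → ∀ w : T.Deformation, T.VanishesOn Γ w → ∀ t i a j,
      T.nodalGrad w t i a j ^ 2 ≤ C * |Real.log T.hmin| * T.star w w := by
  -- All geometric constants come from one triangulation `T₀` matching `Γ`, chosen before `T`. If
  -- there is none, nothing is claimed.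
  by_cases hT : ∃ T₀ : Triangulation ω, T₀.Matches Γ
  swap
  · push Not at hT
    exact ⟨1, one_pos, fun T _ h => absurd h (hT T)⟩
  obtain ⟨T₀, S₀, hS₀⟩ := hT
  obtain ⟨x₀, hx₀⟩ := hΓ
  have hx₀' := hx₀
  rw [hS₀, Set.mem_iUnion₂] at hx₀'
  obtain ⟨⟨t₁, i₁⟩, he₁, -⟩ := hx₀'
  have hedge : T₀.edge t₁ i₁ ⊆ Γ := by
    rw [hS₀]; exact Set.subset_biUnion_of_mem (u := fun e : Fin T₀.n × Fin 3 => T₀.edge e.1 e.2) he₁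
  obtain ⟨C₀, R, hC₀, hR0, hR, hsob⟩ := T₀.exists_log_sobolev hω hωc t₁ i₁
  set K := 1 + |Real.log R| + |Real.log σ| with hK
  have hK0 : 0 < K := by positivity
  refine ⟨C₀ * (128 * σ ^ 2 / δ + K / δ + 1), by positivity, ?_⟩
  intro T hreg hmatch hlogδ w hw t i a j
  set l := |Real.log T.hmin| with hl
  set I := T.star w w with hI
  have hI0 : 0 ≤ I := T.star_self_nonneg w
  obtain ⟨x, r, hr, hball, hdiam⟩ := hreg t
  have hdp := T.diam_pos t
  have hσ : 0 < σ := pos_of_mul_pos_left (hdp.trans_le hdiam) hr.le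
  have hvol := T.volume_cell_ge hr hball
  have hxt : x ∈ T.cell t := hball (Metric.mem_closedBall_self hr.le)
  -- The cut-off is chosen so that the points of the domain within `ε * R` of the disc centre `x`
  -- lie in the single triangle `t`, where the oscillation is controlled by `hosc`.
  set ε := min 1 (r / R) with hε
  have hε0 : 0 < ε := lt_min one_pos (div_pos hr hR0)
  have hconf := T.isConforming_gradPiece w a j
  have hosc : ∀ p ∈ T.cell t, ∀ q ∈ T.cell t,
      (Poly.val (T.gradPiece w a j t) p - Poly.val (T.gradPiece w a j t) q) ^ 2 ≤
        128 * σ ^ 2 * I := by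
    intro p hp q hq
    have h1 := T.sq_gradPiece_sub_le w a j t hp hq
    have h2 := T.integral_hessSq_le_star w t
    have h3 : T.diam t ^ 2 ≤ σ ^ 2 * volume.real (T.cell t) := by
      have : T.diam t ^ 2 ≤ (σ * r) ^ 2 := pow_le_pow_left₀ hdp.le hdiam 2
      rw [mul_pow] at this
      exact this.trans (mul_le_mul_of_nonneg_left hvol (sq_nonneg _))
    have h4 : T.diam t ^ 2 * (128 * ∫ x in T.cell t, T.hessSq w t x) ≤
        (σ ^ 2 * volume.real (T.cell t)) * (128 * I) :=
      mul_le_mul h3 (by linarith) (mul_nonneg (by norm_num)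
        (integral_nonneg (T.hessSq_nonneg w t))) (by positivity)
    have h5 := h1.trans h4
    refine le_of_mul_le_mul_left ?_ (T.volume_cell_pos t)
    linarith
  have key := hsob (T.glue (T.gradPiece w a j)) _ I hconf.isUpperGradient hI0
    (by
      rw [lintegral_gradSq]
      exact ENNReal.ofReal_le_ofReal (T.sum_integral_grad_le_star w a j))
    (fun y hy => hw.glue_eq_zero hmatch a j (hedge hy)) x (T.cell_subset t hxt) ε
    (T.nodalGrad w t i a j) (128 * σ ^ 2 * I) hε0 (min_le_left _ _) (by positivity) (by
      intro y hy hyx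
      have hyt : y ∈ T.cell t := by
        refine hball (mem_closedBall_iff_norm.2 (hyx.trans ?_))
        calc ε * R ≤ r / R * R := mul_le_mul_of_nonneg_right (min_le_right _ _) hR0.le
          _ = r := div_mul_cancel₀ _ hR0.ne'
      rw [hconf.glue_eq hyt, ← gradPiece_vert]
      exact hosc _ (T.vert_mem_cell t i) _ hyt)
  have hne : ω.Nonempty := hωc.nonempty
  have hhm := T.hmin_pos hne
  have hlogε : 1 + Real.log (1 / ε) ≤ K + l := by
    have hK1 : 1 ≤ K := by
      have := abs_nonneg (Real.log R); have := abs_nonneg (Real.log σ); linarith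
    have hl0 : 0 ≤ l := abs_nonneg _
    rcases le_total 1 (r / R) with h | h
    · rw [hε, min_eq_left h]; simp; linarith
    · rw [hε, min_eq_right h, one_div_div]
      -- Shape regularity bounds the radius of the disc from below by `T.hmin / σ`, which turns the
      -- cut-off scale into the minimal mesh size.
      have h1 : R / r ≤ R * σ / T.hmin := by
        rw [div_le_div_iff₀ hr hhm]
        have := (T.hmin_le t).trans hdiam
        nlinarith
      have h2 := Real.log_le_log (div_pos hR0 hr) h1
      rw [Real.log_div (by positivity) hhm.ne', Real.log_mul hR0.ne' hσ.ne'] at h2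
      have h3 := le_abs_self (Real.log R)
      have h4 := le_abs_self (Real.log σ)
      have h5 := neg_abs_le (Real.log T.hmin)
      linarith
  refine key.trans ?_
  rw [mul_assoc (C₀ * _), mul_assoc C₀]
  refine mul_le_mul_of_nonneg_left ?_ hC₀.le
  -- The lower bound `δ` for the logarithm absorbs the terms without a logarithm.
  have h6 : 1 ≤ l / δ := (one_le_div hδ).2 hlogδ
  have e1 : (128 * σ ^ 2 / δ + K / δ + 1) * (l * I) =
      128 * σ ^ 2 * I * (l / δ) + (K * (l / δ) + l) * I := by field_simp; ring
  rw [e1]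
  refine add_le_add (le_mul_of_one_le_right (by positivity) h6) ?_
  refine mul_le_mul_of_nonneg_right (hlogε.trans ?_) hI0
  linarith [le_mul_of_one_le_right hK0.le h6]

/-! ### Unisolvence and definiteness of the scalar product -/

/-- A cubic with double zeros at two points vanishes on the line through them. -/
theorem _root_.BilayerPlate.Poly.val_line_eq_zero_of_double {P : Poly} (hP : P.totalDegree ≤ 3)
    {a b : Plane} (ha : Poly.val P a = 0) (hb : Poly.val P b = 0) (ha' : Poly.grad P a = 0)
    (hb' : Poly.grad P b = 0) (s : ℝ) : Poly.val P (a + s • (b - a)) = 0 := by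
  obtain ⟨c₀, c₁, c₂, c₃, h, h'⟩ := Poly.exists_cubic_line P hP a (b - a)
  have e0 := h 0; have e0' := h' 0; have e1 := h 1; have e1' := h' 1
  simp only [zero_smul, add_zero, one_smul, add_sub_cancel, ha, hb, ha', hb',
    inner_zero_left] at e0 e0' e1 e1'
  have c0 : c₀ = 0 := by linarith
  have c1 : c₁ = 0 := by linarith
  have c3 : c₃ = 0 := by linarith
  have c2 : c₂ = 0 := by linarith
  rw [h, c0, c1, c2, c3]; ring

theorem bary_center (t : Fin T.n) (i : Fin 3) :
    Poly.val (T.bary t i) (T.center t) = 1 / 3 := by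
  have e : T.center t = ∑ j, (1 / 3 : ℝ) • T.vert t j := by rw [center, Finset.smul_sum]
  rw [e, T.bary_combo t i (fun _ => 1 / 3) (by simp)]

/-- Unisolvence: a cubic is determined by its values and gradients at the vertices of a triangle
and its value at the centre of gravity. -/
theorem poly_eq_zero {t : Fin T.n} {P : Poly} (hP : P.totalDegree ≤ 3)
    (hv : ∀ i, Poly.val P (T.vert t i) = 0) (hg : ∀ i, Poly.grad P (T.vert t i) = 0)
    (hc : Poly.val P (T.center t) = 0) : P = 0 := by
  have hedge : ∀ i j s, Poly.val P (T.vert t i + s • (T.vert t j - T.vert t i)) = 0 :=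
    fun i j s => Poly.val_line_eq_zero_of_double hP (hv i) (hv j) (hg i) (hg j) s
  -- On the median from vertex 1 there is a double zero at the vertex, a zero at the centre of
  -- gravity (parameter 1) and one at the midpoint of the opposite edge (parameter 3/2).
  have hmedian : ∀ s : ℝ, Poly.val P (T.vert t 1 + s • (T.center t - T.vert t 1)) = 0 := by
    refine Poly.val_line_eq_zero P hP _ _ (hv 1) (hg 1) (s := 1) (r := 3 / 2) (by norm_num)
      (by norm_num) (by norm_num) (by simpa using hc) ?_
    have e : T.vert t 1 + (3 / 2 : ℝ) • (T.center t - T.vert t 1) =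
        T.vert t 0 + (1 / 2 : ℝ) • (T.vert t 2 - T.vert t 0) := by
      rw [center, Fin.sum_univ_three]; module
    rw [e]; exact hedge 0 2 _
  -- The line from vertex 0 through `x` has a double zero at this vertex and meets the opposite edge
  -- line and the median from vertex 1. The two points differ since the coordinate `l2` is positive.
  have hgood : ∀ x, Poly.val (T.bary t 0) x < 1 → 0 < Poly.val (T.bary t 2) x →
      Poly.val P x = 0 := by
    intro x h0 h2
    have hs := T.sum_bary t x
    have hx := T.sum_bary_smul t x
    rw [Fin.sum_univ_three] at hs hx
    set l0 := Poly.val (T.bary t 0) x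
    set l1 := Poly.val (T.bary t 1) x
    set l2 := Poly.val (T.bary t 2) x
    have hd1 : 1 - l0 ≠ 0 := by linarith
    have hd2 : 1 - l0 + l2 ≠ 0 := by linarith
    have hl1 : l1 = 1 - l0 - l2 := by linarith
    have hxe : x - T.vert t 0 = (1 - l0 - l2) • (T.vert t 1 - T.vert t 0) +
        l2 • (T.vert t 2 - T.vert t 0) := by
      conv_lhs => rw [← hx, hl1]
      module
    have := Poly.val_line_eq_zero P hP (T.vert t 0) (x - T.vert t 0) (hv 0) (hg 0)
      (s := (1 - l0)⁻¹) (r := (1 - l0 + l2)⁻¹) (inv_ne_zero hd1) (inv_ne_zero hd2)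
      (fun h => by rw [inv_inj] at h; linarith) ?_ ?_ 1
    · simpa using this
    · have e : T.vert t 0 + (1 - l0)⁻¹ • (x - T.vert t 0) =
          T.vert t 1 + ((1 - l0)⁻¹ * l2) • (T.vert t 2 - T.vert t 1) := by
        rw [hxe]
        match_scalars <;> field_simp <;> ring
      rw [e]; exact hedge 1 2 _
    · have e : T.vert t 0 + (1 - l0 + l2)⁻¹ • (x - T.vert t 0) =
          T.vert t 1 + ((1 - l0 + l2)⁻¹ * (3 * l2)) • (T.center t - T.vert t 1) := by
        rw [hxe, center, Fin.sum_univ_three]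
        match_scalars <;> field_simp <;> ring
      rw [e]; exact hmedian _
  -- The polynomial vanishes on an open set around the centre of gravity, hence on a product of two
  -- intervals, hence identically.
  set U : Set (Fin 2 → ℝ) := {z | Poly.val (T.bary t 0) (WithLp.toLp 2 z) < 1 ∧
    0 < Poly.val (T.bary t 2) (WithLp.toLp 2 z)} with hU
  have hUo : IsOpen U := by
    have h := fun i => (Poly.continuous_val (T.bary t i)).comp (PiLp.continuous_toLp 2 fun _ => ℝ)
    exact (isOpen_lt (h 0) continuous_const).inter (isOpen_lt continuous_const (h 2))
  have hcU : (fun i => T.center t i) ∈ U := by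
    have e : WithLp.toLp 2 (fun i => T.center t i) = T.center t := rfl
    refine ⟨?_, ?_⟩ <;> rw [e, bary_center] <;> norm_num
  obtain ⟨r, hr, hball⟩ := Metric.isOpen_iff.1 hUo _ hcU
  rw [ball_pi _ hr] at hball
  refine MvPolynomial.funext_set (fun i => Metric.ball (T.center t i) r) (fun i => ?_)
    fun z hz => ?_
  · rw [Real.ball_eq_Ioo]; exact Set.Ioo_infinite (by linarith)
  · have h := hball hz
    have := hgood (WithLp.toLp 2 z) h.1 h.2
    simpa [Poly.val] using this

variable {T} in
/-- A reduced cubic with vanishing vertex gradients and constant vertex values is constant. -/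
theorem IsReducedCubic.eq_C {t : Fin T.n} {P : Poly} (hP : T.IsReducedCubic t P) {c : ℝ}
    (hv : ∀ i, Poly.val P (T.vert t i) = c) (hg : ∀ i, Poly.grad P (T.vert t i) = 0) :
    P = MvPolynomial.C c := by
  rw [← sub_eq_zero]
  refine T.poly_eq_zero (t := t) ?_ (fun i => by simp [hv i]) (fun i => by simp [hg i]) ?_
  · refine (MvPolynomial.totalDegree_sub _ _).trans (max_le hP.1 ?_)
    simp
  · rw [Poly.val_sub, hP.2]
    simp [hv, hg]; ring

theorem dkt_eq_zero {p : T.dkt} (hv : ∀ t i, Poly.val (p.1 t) (T.vert t i) = 0)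
    (hg : ∀ t i, Poly.grad (p.1 t) (T.vert t i) = 0) : p = 0 := by
  ext1
  ext1 t
  rw [(p.2.1 t).eq_C (hv t) (hg t)]
  simp

/-- The nodal values and gradients as a linear map. -/
noncomputable def nodalMap : T.dkt →ₗ[ℝ] (Fin T.n → Fin 3 → ℝ × Plane) where
  toFun p t i := (Poly.val (p.1 t) (T.vert t i), Poly.grad (p.1 t) (T.vert t i))
  map_add' p q := by ext <;> simp
  map_smul' c p := by ext <;> simp

/-- By unisolvence the nodal values and gradients determine the function. -/
instance finiteDimensional_dkt : FiniteDimensional ℝ T.dkt := by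
  refine FiniteDimensional.of_injective T.nodalMap ?_
  rw [← LinearMap.ker_eq_bot, LinearMap.ker_eq_bot']
  intro p hp
  refine T.dkt_eq_zero (fun t i => ?_) fun t i => ?_
  · exact congrArg Prod.fst (congrFun (congrFun hp t) i)
  · exact congrArg Prod.snd (congrFun (congrFun hp t) i)

/-- A deformation whose nodal gradients vanish and whose discrete Hessian vanishes is constant on
each triangle. -/
theorem val_vert_eq {w : T.Deformation} (hs : T.star w w = 0)
    (hg : ∀ t i, T.nodalGrad w t i = 0) (a : Fin 3) (t : Fin T.n) (i : Fin 3) :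
    Poly.val ((w a).1 t) (T.vert t (i + 1)) = Poly.val ((w a).1 t) (T.vert t (i + 2)) := by
  have hgr : ∀ i, Poly.grad ((w a).1 t) (T.vert t i) = 0 := by
    intro i
    ext j
    have := congrFun (congrFun (hg t i) a) j
    simpa [nodalGrad] using this
  have hzero : ∀ j, ∀ p ∈ T.cell t, Poly.val (T.gradPiece w a j t) p = 0 := by
    intro j p hp
    have h1 := T.sq_gradPiece_sub_le w a j t hp (T.vert_mem_cell t 0)
    have h2 := T.integral_hessSq_le_star w t
    rw [hs] at h2
    have h3 : ∫ x in T.cell t, T.hessSq w t x = 0 :=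
      le_antisymm h2 (integral_nonneg (T.hessSq_nonneg w t))
    rw [h3, gradPiece_vert, hg] at h1
    simp only [mul_zero, Matrix.zero_apply, sub_zero] at h1
    have h4 : volume.real (T.cell t) * Poly.val (T.gradPiece w a j t) p ^ 2 = 0 :=
      le_antisymm h1 (mul_nonneg measureReal_nonneg (sq_nonneg _))
    simpa [(T.volume_cell_pos t).ne'] using h4
  have hmem : (1 / 2 : ℝ) • T.vert t (i + 1) + (1 / 2 : ℝ) • T.vert t (i + 2) ∈ T.cell t :=
    T.convex_cell t (T.vert_mem_cell t _) (T.vert_mem_cell t _) (by norm_num) (by norm_num)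
      (by norm_num)
  -- With vanishing nodal gradients the midpoint value is $\frac32|b-a|^{-2}(p(b)-p(a))(b-a)$. It is
  -- zero because the discrete gradient is constant on the triangle and zero at a vertex.
  have hmid : ∀ j, edgeMid (T.vert t (i + 1)) (T.vert t (i + 2))
      (Poly.val ((w a).1 t) (T.vert t (i + 1))) (Poly.val ((w a).1 t) (T.vert t (i + 2)))
      (Poly.grad ((w a).1 t) (T.vert t (i + 1))) (Poly.grad ((w a).1 t) (T.vert t (i + 2))) j
        = 0 := by
    intro j
    have h1 := hzero j _ hmem
    rw [gradPiece, discreteGrad_edge T t _ ((w a).2.1 t).1 j i _ _ (by norm_num), hgr, hgr] at h1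
    rw [hgr, hgr]
    norm_num at h1
    exact h1
  simp only [hgr, edgeMid] at hmid
  have hne : T.vert t (i + 1) ≠ T.vert t (i + 2) := by
    intro h
    have := T.vert_injective t h
    revert this; clear * -; revert i; decide
  have hn : ‖T.vert t (i + 2) - T.vert t (i + 1)‖ ≠ 0 := by
    rw [norm_ne_zero_iff, sub_ne_zero]; exact hne.symm
  by_contra hv
  apply hne
  ext j
  have h := hmid j
  simp only [add_zero, inner_zero_left, PiLp.zero_apply, mul_zero, zero_smul, zero_add,
    PiLp.smul_apply, smul_eq_mul, mul_eq_zero, sub_zero, inv_eq_zero, hn, or_self, false_or] at h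
  have h2 : Poly.val ((w a).1 t) (T.vert t (i + 2)) -
      Poly.val ((w a).1 t) (T.vert t (i + 1)) ≠ 0 := sub_ne_zero.2 (Ne.symm hv)
  norm_num [h2] at h
  linarith

/-- The scalar product is definite. -/
theorem eq_zero_of_star_eq_zero (hωc : IsConnected ω) {Γ : Set Plane} (hΓ : T.Matches Γ)
    (hΓ0 : Γ.Nonempty) {w : T.Deformation} (hw : T.VanishesOn Γ w) (hs : T.star w w = 0)
    (hg : ∀ t i, T.nodalGrad w t i = 0) : w = 0 := by
  funext a
  have hgr : ∀ t i, Poly.grad ((w a).1 t) (T.vert t i) = 0 := by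
    intro t i
    ext j
    have := congrFun (congrFun (hg t i) a) j
    simpa [nodalGrad] using this
  have hv : ∀ t i, Poly.val ((w a).1 t) (T.vert t i) = Poly.val ((w a).1 t) (T.vert t 0) := by
    intro t i
    have h0 := T.val_vert_eq hs hg a t 0
    have h1 := T.val_vert_eq hs hg a t 1
    fin_cases i
    · rfl
    · exact h0.trans h1
    · exact h1
  have hC := fun t => ((w a).2.1 t).eq_C (hv t) (hgr t)
  have hconf : T.IsConforming fun t => (w a).1 t := fun t t' x hx hx' => (w a).2.2.1 t t' x ⟨hx, hx'⟩
  have hpre : IsPreconnected (closure ω) := hωc.isPreconnected.closure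
  -- A continuous function with finitely many values on a connected set is constant.
  have hfin : (T.glue (fun t => (w a).1 t) '' closure ω).Finite := by
    refine (Set.finite_range fun t => Poly.val ((w a).1 t) (T.vert t 0)).subset ?_
    rintro _ ⟨x, hx, rfl⟩
    obtain ⟨t, ht⟩ := T.exists_mem_cell hx
    refine ⟨t, ?_⟩
    rw [hconf.glue_eq ht]
    simp only
    rw [hC t]; simp
  have hsub : (T.glue (fun t => (w a).1 t) '' closure ω).Subsingleton := by
    by_contra h
    exact (hpre.image _ hconf.continuousOn_glue).infinite_of_nontrivial
      (Set.not_subsingleton_iff.1 h) hfin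
  have hall : ∀ t, Poly.val ((w a).1 t) (T.vert t 0) = 0 := by
    intro t
    obtain ⟨S, hS⟩ := hΓ
    obtain ⟨x, hx⟩ := hΓ0
    have hx' := hx
    rw [hS, Set.mem_iUnion₂] at hx'
    obtain ⟨⟨t', i'⟩, he, -⟩ := hx'
    have h1 : T.vert t' (i' + 1) ∈ Γ := by
      rw [hS]; exact Set.mem_biUnion he (left_mem_segment ℝ _ _)
    have h2 := (hw _ _ h1).1 a
    rw [← h2]
    have := hsub ⟨_, T.cell_subset t (T.vert_mem_cell t 0), rfl⟩
      ⟨_, T.cell_subset t' (T.vert_mem_cell t' (i' + 1)), rfl⟩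
    rwa [hconf.glue_eq (T.vert_mem_cell t 0), hconf.glue_eq (T.vert_mem_cell t' _)] at this
  exact T.dkt_eq_zero (fun t i => by rw [hv, hall]) hgr

/-! ### Multilinearity of the forms -/

section Linearity

theorem midGrad_add (t : Fin T.n) (p q : Poly) (i : Fin 3) :
    T.midGrad t (p + q) i = T.midGrad t p i + T.midGrad t q i := by
  simp only [midGrad, Poly.grad_add, inner_add_left]
  module

theorem midGrad_smul (t : Fin T.n) (c : ℝ) (p : Poly) (i : Fin 3) :
    T.midGrad t (c • p) i = c • T.midGrad t p i := by
  simp only [midGrad, Poly.grad_smul, inner_add_left, real_inner_smul_left]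
  module

theorem discreteGrad_add (t : Fin T.n) (p q : Poly) (j : Fin 2) :
    T.discreteGrad t (p + q) j = T.discreteGrad t p j + T.discreteGrad t q j := by
  simp only [discreteGrad, ← Finset.sum_add_distrib]
  refine Finset.sum_congr rfl fun i _ => ?_
  rw [midGrad_add, Poly.grad_add, PiLp.add_apply, PiLp.add_apply, map_add, map_add]
  ring

theorem discreteGrad_smul (t : Fin T.n) (c : ℝ) (p : Poly) (j : Fin 2) :
    T.discreteGrad t (c • p) j = c • T.discreteGrad t p j := by
  simp only [discreteGrad, Finset.smul_sum]
  refine Finset.sum_congr rfl fun i _ => ?_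
  rw [midGrad_smul, Poly.grad_smul, PiLp.smul_apply, PiLp.smul_apply, smul_eq_mul, smul_eq_mul,
    map_mul, map_mul, MvPolynomial.smul_eq_C_mul]
  ring

theorem discreteHess_add (v w : T.Deformation) (t : Fin T.n) (a : Fin 3) (j k : Fin 2) :
    T.discreteHess (v + w) t a j k = T.discreteHess v t a j k + T.discreteHess w t a j k := by
  change MvPolynomial.pderiv k (T.discreteGrad t ((v a).1 t + (w a).1 t) j) = _
  rw [discreteGrad_add, map_add]; rfl

theorem discreteHess_smul (c : ℝ) (w : T.Deformation) (t : Fin T.n) (a : Fin 3) (j k : Fin 2) :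
    T.discreteHess (c • w) t a j k = c • T.discreteHess w t a j k := by
  change MvPolynomial.pderiv k (T.discreteGrad t (c • (w a).1 t) j) = _
  rw [discreteGrad_smul, Derivation.map_smul]; rfl

theorem discreteLaplacian_add (v w : T.Deformation) (t : Fin T.n) (i : Fin 3) :
    T.discreteLaplacian (v + w) t i = T.discreteLaplacian v t i + T.discreteLaplacian w t i := by
  ext a
  simp [discreteLaplacian, discreteHess_add, Finset.sum_add_distrib]

theorem discreteLaplacian_smul (c : ℝ) (w : T.Deformation) (t : Fin T.n) (i : Fin 3) :
    T.discreteLaplacian (c • w) t i = c • T.discreteLaplacian w t i := by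
  ext a
  simp [discreteLaplacian, discreteHess_smul, mul_add]

theorem nodalGrad_add (v w : T.Deformation) (t : Fin T.n) (i : Fin 3) :
    T.nodalGrad (v + w) t i = T.nodalGrad v t i + T.nodalGrad w t i := by
  ext a j
  change (Poly.grad ((v a).1 t + (w a).1 t) (T.vert t i)) j = _
  rw [Poly.grad_add]; rfl

theorem nodalGrad_smul (c : ℝ) (w : T.Deformation) (t : Fin T.n) (i : Fin 3) :
    T.nodalGrad (c • w) t i = c • T.nodalGrad w t i := by
  ext a j
  change (Poly.grad (c • (w a).1 t) (T.vert t i)) j = _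
  rw [Poly.grad_smul]; rfl

theorem nodalPartial_add (j : Fin 2) (v w : T.Deformation) (t : Fin T.n) (i : Fin 3) :
    T.nodalPartial j (v + w) t i = T.nodalPartial j v t i + T.nodalPartial j w t i := by
  ext a; simp [nodalPartial, nodalGrad_add]

theorem nodalPartial_smul (j : Fin 2) (c : ℝ) (w : T.Deformation) (t : Fin T.n) (i : Fin 3) :
    T.nodalPartial j (c • w) t i = c • T.nodalPartial j w t i := by
  ext a; simp [nodalPartial, nodalGrad_smul]

theorem integral_add (p q : Fin T.n → Poly) :
    T.integral (fun t => p t + q t) = T.integral p + T.integral q := by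
  simp only [integral, Poly.val_add, ← Finset.sum_add_distrib]
  exact Finset.sum_congr rfl fun t _ => MeasureTheory.integral_add
    (T.integrableOn_cell (Poly.continuous_val _) t) (T.integrableOn_cell (Poly.continuous_val _) t)

theorem integral_smul (c : ℝ) (p : Fin T.n → Poly) :
    T.integral (fun t => c • p t) = c * T.integral p := by
  simp only [integral, Poly.val_smul, MeasureTheory.integral_const_mul, Finset.mul_sum]

theorem star_comm (v w : T.Deformation) : T.star v w = T.star w v := by
  simp only [star, mul_comm]

theorem star_add_left (u v w : T.Deformation) : T.star (u + v) w = T.star u w + T.star v w := by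
  simp only [star, discreteHess_add, add_mul, Finset.sum_add_distrib]
  exact T.integral_add _ _

theorem star_smul_left (c : ℝ) (v w : T.Deformation) : T.star (c • v) w = c * T.star v w := by
  simp only [star, discreteHess_smul, smul_mul_assoc, ← Finset.smul_sum]
  exact T.integral_smul c _

theorem star_add_right (u v w : T.Deformation) : T.star u (v + w) = T.star u v + T.star u w := by
  rw [star_comm, star_add_left, T.star_comm v u, T.star_comm w u]

theorem star_smul_right (c : ℝ) (v w : T.Deformation) : T.star v (c • w) = c * T.star v w := by
  rw [star_comm, star_smul_left, star_comm]

theorem interp_add (g h : Fin T.n → Fin 3 → ℝ) :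
    T.interp (fun t i => g t i + h t i) = fun t => T.interp g t + T.interp h t := by
  ext1 t; simp only [interp, map_add, add_mul, Finset.sum_add_distrib]

theorem interp_smul (c : ℝ) (g : Fin T.n → Fin 3 → ℝ) :
    T.interp (fun t i => c * g t i) = fun t => c • T.interp g t := by
  ext1 t
  simp only [interp, map_mul, mul_assoc, MvPolynomial.smul_eq_C_mul, Finset.mul_sum]

theorem cubicForm_add_left (u u' v w : T.Deformation) :
    T.cubicForm (u + u') v w = T.cubicForm u v w + T.cubicForm u' v w := by
  simp only [cubicForm, discreteLaplacian_add, add_dotProduct]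
  rw [interp_add, integral_add]

theorem cubicForm_smul_left (c : ℝ) (u v w : T.Deformation) :
    T.cubicForm (c • u) v w = c * T.cubicForm u v w := by
  simp only [cubicForm, discreteLaplacian_smul, smul_dotProduct, smul_eq_mul]
  rw [interp_smul, integral_smul]

theorem cubicForm_add_mid (u v v' w : T.Deformation) :
    T.cubicForm u (v + v') w = T.cubicForm u v w + T.cubicForm u v' w := by
  simp only [cubicForm, nodalPartial_add, map_add, LinearMap.add_apply, dotProduct_add]
  rw [interp_add, integral_add]

theorem cubicForm_smul_mid (c : ℝ) (u v w : T.Deformation) :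
    T.cubicForm u (c • v) w = c * T.cubicForm u v w := by
  simp only [cubicForm, nodalPartial_smul, map_smul, LinearMap.smul_apply, dotProduct_smul,
    smul_eq_mul]
  rw [interp_smul, integral_smul]

theorem cubicForm_add_right (u v w w' : T.Deformation) :
    T.cubicForm u v (w + w') = T.cubicForm u v w + T.cubicForm u v w' := by
  simp only [cubicForm, nodalPartial_add, map_add, dotProduct_add]
  rw [interp_add, integral_add]

theorem cubicForm_smul_right (c : ℝ) (u v w : T.Deformation) :
    T.cubicForm u v (c • w) = c * T.cubicForm u v w := by
  simp only [cubicForm, nodalPartial_smul, map_smul, dotProduct_smul, smul_eq_mul]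
  rw [interp_smul, integral_smul]

end Linearity

/-! ### Boundedness of the cubic form and of the scalar product -/

/-- Componentwise bounds of the nodal gradients. -/
def NodalBound (w : T.Deformation) (β : ℝ) : Prop := ∀ t i a j, |T.nodalGrad w t i a j| ≤ β

theorem abs_dot_cross_le {x y z : Fin 3 → ℝ} {A β γ : ℝ} (hx : ∀ a, |x a| ≤ A)
    (hy : ∀ a, |y a| ≤ β) (hz : ∀ a, |z a| ≤ γ) :
    |dotProduct x (crossProduct y z)| ≤ 6 * (A * β * γ) := by
  have h : ∀ a b c, |x a * (y b * z c)| ≤ A * β * γ := by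
    intro a b c
    have hA := (abs_nonneg _).trans (hx a)
    have hβ := (abs_nonneg _).trans (hy b)
    rw [abs_mul, abs_mul, mul_assoc]
    exact mul_le_mul (hx a) (mul_le_mul (hy b) (hz c) (abs_nonneg _) hβ)
      (by positivity) hA
  have h2 := fun a b c => abs_le.1 (h a b c)
  rw [cross_apply, abs_le]
  simp only [dotProduct, Fin.sum_univ_three, Matrix.cons_val, mul_sub]
  constructor <;> linarith [(h2 0 1 2).1, (h2 0 2 1).2, (h2 1 2 0).1, (h2 1 0 2).2, (h2 2 0 1).1,
    (h2 2 1 0).2, (h2 0 1 2).2, (h2 0 2 1).1, (h2 1 2 0).2, (h2 1 0 2).1, (h2 2 0 1).2,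
    (h2 2 1 0).1]

theorem abs_discreteLaplacian_le (u : T.Deformation) (t : Fin T.n) (i a : Fin 3) :
    |T.discreteLaplacian u t i a| ≤
      16 * Real.sqrt ((∫ x in T.cell t, T.hessSq u t x) / volume.real (T.cell t)) := by
  have hv := T.volume_cell_pos t
  have h1 : ∀ j, |Poly.val (T.discreteHess u t a j j) (T.vert t i)| ≤
      8 * Real.sqrt ((∫ x in T.cell t, T.hessSq u t x) / volume.real (T.cell t)) := by
    intro j
    refine Real.abs_le_sqrt (y := 64 * ((∫ x in T.cell t, T.hessSq u t x) /
      volume.real (T.cell t))) ?_ |>.trans (le_of_eq ?_)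
    · rw [← mul_div_assoc, le_div_iff₀ hv, mul_comm]
      exact T.sq_discreteHess_le u t a j j (T.vert_mem_cell t i)
    · rw [Real.sqrt_mul (by norm_num), show (64 : ℝ) = 8 ^ 2 by norm_num,
        Real.sqrt_sq (by norm_num)]
  rw [discreteLaplacian, Fin.sum_univ_two]
  refine (abs_add_le _ _).trans ?_
  linarith [h1 0, h1 1]

/-- The boundedness of the cubic form. -/
theorem abs_cubicForm_le (u v w : T.Deformation) {β γ : ℝ} (hβ0 : 0 ≤ β) (hγ0 : 0 ≤ γ)
    (hv : T.NodalBound v β) (hw : T.NodalBound w γ) :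
    |T.cubicForm u v w| ≤
      288 * Real.sqrt (volume.real (closure ω)) * Real.sqrt (T.star u u) * β * γ := by
  set X : Fin T.n → ℝ :=
    fun t => Real.sqrt ((∫ x in T.cell t, T.hessSq u t x) / volume.real (T.cell t)) with hX
  -- 288 = 3 * 6 * 16: three vertices, six terms of the triple product, and 16 from the inverse
  -- estimate for the Laplacian.
  have hcell : ∀ t, |∫ x in T.cell t, Poly.val (T.interp (fun t i =>
      dotProduct (T.discreteLaplacian u t i)
        (crossProduct (T.nodalPartial 0 v t i) (T.nodalPartial 1 w t i))) t) x| ≤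
      288 * β * γ * (volume.real (T.cell t) * X t) := by
    intro t
    have h := norm_setIntegral_le_of_norm_le_const (μ := volume) (s := T.cell t)
      (f := Poly.val (T.interp (fun t i => dotProduct (T.discreteLaplacian u t i)
        (crossProduct (T.nodalPartial 0 v t i) (T.nodalPartial 1 w t i))) t))
      (C := 288 * β * γ * X t) (T.isCompact_cell t).measure_lt_top ?_
    · rw [Real.norm_eq_abs] at h
      refine h.trans (le_of_eq ?_); ring
    · intro x hx
      have hb : ∀ i, |dotProduct (T.discreteLaplacian u t i)
        (crossProduct (T.nodalPartial 0 v t i) (T.nodalPartial 1 w t i))| ≤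
          6 * (16 * X t * β * γ) := fun i =>
        abs_dot_cross_le (fun a => T.abs_discreteLaplacian_le u t i a) (fun a => hv t i a 0)
          (fun a => hw t i a 1)
      rw [Real.norm_eq_abs, interp]
      simp only [Poly.val_sum, Poly.val_mul, Poly.val_C]
      have hX0 : 0 ≤ X t := Real.sqrt_nonneg _
      refine (Finset.abs_sum_le_sum_abs _ _).trans ((Finset.sum_le_sum fun i _ =>
        (show _ ≤ 6 * (16 * X t * β * γ) from ?_)).trans (le_of_eq ?_))
      · rw [abs_mul, abs_of_nonneg ((T.mem_cell_iff t x).1 hx i)]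
        exact (mul_le_mul (hb i) (T.bary_le_one hx i) ((T.mem_cell_iff t x).1 hx i)
          (by positivity)).trans (le_of_eq (mul_one _))
      · simp; ring
  -- Cauchy–Schwarz over the triangles: the areas add up to at most that of the closure of `ω`, the
  -- local norms to the global one.
  have hsum : ∑ t, volume.real (T.cell t) * X t ≤
      Real.sqrt (volume.real (closure ω)) * Real.sqrt (T.star u u) := by
    have h1 : ∀ t, volume.real (T.cell t) * X t = Real.sqrt (volume.real (T.cell t)) *
        Real.sqrt (∫ x in T.cell t, T.hessSq u t x) := by
      intro t
      have hv := T.volume_cell_pos t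
      rw [hX]
      simp only
      rw [Real.sqrt_div' _ hv.le]
      have : 0 < Real.sqrt (volume.real (T.cell t)) := Real.sqrt_pos.2 hv
      have h2 := Real.mul_self_sqrt hv.le
      rw [mul_div_assoc', div_eq_iff this.ne']
      linear_combination (-Real.sqrt (∫ x in T.cell t, T.hessSq u t x)) * h2
    simp_rw [h1]
    refine (Real.sum_sqrt_mul_sqrt_le _ (fun t => measureReal_nonneg)
      (fun t => integral_nonneg (T.hessSq_nonneg u t))).trans ?_
    rw [← star_self]
    exact mul_le_mul_of_nonneg_right (Real.sqrt_le_sqrt T.area_le) (Real.sqrt_nonneg _)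
  rw [cubicForm, integral]
  refine (Finset.abs_sum_le_sum_abs _ _).trans ((Finset.sum_le_sum fun t _ => hcell t).trans ?_)
  rw [← Finset.mul_sum]
  calc _ ≤ 288 * β * γ * (Real.sqrt (volume.real (closure ω)) * Real.sqrt (T.star u u)) :=
        mul_le_mul_of_nonneg_left hsum (by positivity)
    _ = _ := by ring

theorem abs_star_le (v w : T.Deformation) :
    |T.star v w| ≤ Real.sqrt (T.star v v) * Real.sqrt (T.star w w) := by
  rw [← Real.sqrt_mul (T.star_self_nonneg v)]
  refine Real.abs_le_sqrt ?_
  have h : ∀ s : ℝ, 0 ≤ T.star w w * (s * s) + 2 * T.star v w * s + T.star v v := by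
    intro s
    have := T.star_self_nonneg (v + s • w)
    rw [star_add_left, star_add_right, star_add_right, star_smul_left, star_smul_left,
      star_smul_right, star_smul_right, T.star_comm w v] at this
    linarith
  have := discrim_le_zero h
  rw [discrim] at this
  linarith

/-! ### Solvability of a single step -/

section Existence

/-- The discrete tangent space as a subspace. -/
def tangentSubmodule (Γ : Set Plane) (y : T.Deformation) : Submodule ℝ T.Deformation where
  carrier := T.TangentSpace Γ y
  zero_mem' := by
    have h : ∀ t i, T.nodalGrad (0 : T.Deformation) t i = 0 := fun t i => by
      have := T.nodalGrad_smul 0 0 t i; simpa using this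
    exact ⟨fun t i _ => ⟨fun a => by simp, h t i⟩, fun t i => by simp [h]⟩
  add_mem' := by
    rintro v w ⟨hv, hv'⟩ ⟨hw, hw'⟩
    refine ⟨fun t i hz => ⟨fun a => ?_, ?_⟩, fun t i => ?_⟩
    · change Poly.val ((v a).1 t + (w a).1 t) _ = 0
      rw [Poly.val_add, (hv t i hz).1 a, (hw t i hz).1 a, add_zero]
    · rw [nodalGrad_add, (hv t i hz).2, (hw t i hz).2, add_zero]
    · rw [nodalGrad_add, Matrix.transpose_add, Matrix.add_mul, Matrix.mul_add, add_add_add_comm, hv', hw',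
        add_zero]
  smul_mem' := by
    rintro c w ⟨hw, hw'⟩
    refine ⟨fun t i hz => ⟨fun a => ?_, ?_⟩, fun t i => ?_⟩
    · change Poly.val (c • (w a).1 t) _ = 0
      rw [Poly.val_smul, (hw t i hz).1 a, mul_zero]
    · rw [nodalGrad_smul, (hw t i hz).2, smul_zero]
    · rw [nodalGrad_smul, Matrix.transpose_smul, Matrix.smul_mul, Matrix.mul_smul, ← smul_add, hw',
        smul_zero]

/-- Definiteness makes the induced map into the dual space injective, and equality of dimensions
makes it surjective. -/
theorem existsUnique_of_definite {V : Type*} [AddCommGroup V] [Module ℝ V] [FiniteDimensional ℝ V]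
    (b : V →ₗ[ℝ] V →ₗ[ℝ] ℝ) (hb : ∀ v, b v v = 0 → v = 0) (l : V →ₗ[ℝ] ℝ) :
    ∃! d, ∀ w, b d w = l w := by
  have hinj : Function.Injective b := by
    refine (injective_iff_map_eq_zero b).2 fun v hv => hb v ?_
    rw [hv]; rfl
  have hsurj : Function.Surjective b :=
    (LinearMap.injective_iff_surjective_of_finrank_eq_finrank (f := b)
      Subspace.dual_finrank_eq.symm).1 hinj
  obtain ⟨d, hd⟩ := hsurj l
  exact ⟨d, fun w => by rw [hd], fun e he => hinj (by rw [hd]; ext w; exact he w)⟩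

/-- The update is well defined if the scalar product is definite on the tangent space. -/
theorem existsUnique_isUpdate {Γ : Set Plane} (α : ℝ) {τ : ℝ} (hτ : 0 < τ) (y : T.Deformation)
    (hdef : ∀ w ∈ T.TangentSpace Γ y, T.star w w = 0 → w = 0) :
    ∃! d, T.IsUpdate Γ α τ y d := by
  set V := T.tangentSubmodule Γ y with hV
  have hfin : FiniteDimensional ℝ T.Deformation := inferInstance
  -- With the term containing `τ` moved to the left, the problem has the form (1 + τ)(d, w)_* =
  -- l(w). No smallness of `τ` is needed.
  obtain ⟨d, hd, huniq⟩ := existsUnique_of_definite (V := V)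
    (LinearMap.mk₂ ℝ (fun v w => (1 + τ) * T.star v.1 w.1)
      (fun u v w => by
        change (1 + τ) * T.star (u.1 + v.1) w.1 = _
        rw [star_add_left, mul_add])
      (fun c v w => by
        change (1 + τ) * T.star (c • v.1) w.1 = c * _
        rw [star_smul_left]; ring)
      (fun u v w => by
        change (1 + τ) * T.star u.1 (v.1 + w.1) = _
        rw [star_add_right, mul_add])
      (fun c v w => by
        change (1 + τ) * T.star v.1 (c • w.1) = c * _
        rw [star_smul_right]; ring))
    (fun v hv => Subtype.ext (hdef v.1 v.2 ((mul_eq_zero.1 hv).resolve_left (by linarith))))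
    { toFun := fun w => -T.star y w.1 + α * T.cubicForm w.1 y y + α * T.cubicForm y w.1 y +
        α * T.cubicForm y y w.1
      map_add' := fun v w => by
        change -T.star y (v.1 + w.1) + α * T.cubicForm (v.1 + w.1) y y +
          α * T.cubicForm y (v.1 + w.1) y + α * T.cubicForm y y (v.1 + w.1) = _
        rw [star_add_right, cubicForm_add_left, cubicForm_add_mid, cubicForm_add_right]; ring
      map_smul' := fun c w => by
        change -T.star y (c • w.1) + α * T.cubicForm (c • w.1) y y +
          α * T.cubicForm y (c • w.1) y + α * T.cubicForm y y (c • w.1) = c * _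
        rw [star_smul_right, cubicForm_smul_left, cubicForm_smul_mid, cubicForm_smul_right]; ring }
  refine ⟨d.1, ⟨d.2, fun w hw => ?_⟩, fun e he => ?_⟩
  · have h : (1 + τ) * T.star d.1 w = -T.star y w + α * T.cubicForm w y y +
      α * T.cubicForm y w y + α * T.cubicForm y y w := hd ⟨w, hw⟩
    linarith
  · refine congrArg Subtype.val (huniq ⟨e, he.mem⟩ fun w => ?_)
    change (1 + τ) * T.star e w.1 = -T.star y w.1 + α * T.cubicForm w.1 y y +
      α * T.cubicForm y w.1 y + α * T.cubicForm y y w.1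
    linarith [he.eq w.1 w.2]

end Existence

/-! ### Energy estimates for a single step -/

/-- The cubic form is bounded with constant `A`. -/
def CubicBound (A : ℝ) : Prop := ∀ (u v w : T.Deformation) (β γ : ℝ), 0 ≤ β → 0 ≤ γ →
  T.NodalBound v β → T.NodalBound w γ →
  |T.cubicForm u v w| ≤ A * Real.sqrt (T.star u u) * β * γ

/-- The Taylor expansion of a polynomial of degree three, hence without remainder. Its first-order
part is what the update equation tests. -/
theorem energy_add_smul (α τ : ℝ) (y d : T.Deformation) :
    T.energy α (y + τ • d) = T.energy α y + τ * T.star y d + τ ^ 2 / 2 * T.star d d -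
      α * (τ * (T.cubicForm d y y + T.cubicForm y d y + T.cubicForm y y d) +
        τ ^ 2 * (T.cubicForm d d y + T.cubicForm d y d + T.cubicForm y d d +
          τ * T.cubicForm d d d)) := by
  simp only [energy, star_add_left, star_add_right, star_smul_left, star_smul_right,
    cubicForm_add_left, cubicForm_add_mid, cubicForm_add_right, cubicForm_smul_left,
    cubicForm_smul_mid, cubicForm_smul_right, T.star_comm d y]
  ring

theorem area_nonneg : 0 ≤ T.area := Finset.sum_nonneg fun _ _ => measureReal_nonneg

variable {T}

/-- With nodal gradients bounded by 2 the cubic term is only linear in the norm, so completing a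
square gives both coercivity and a lower bound. -/
theorem CubicBound.energy_ge {A : ℝ} (hA : T.CubicBound A) (α : ℝ) {y : T.Deformation}
    (hy : T.NodalBound y 2) : 1 / 4 * T.star y y - 16 * α ^ 2 * A ^ 2 ≤ T.energy α y ∧
      -(8 * α ^ 2 * A ^ 2) ≤ T.energy α y := by
  have h1 := hA y y y 2 2 (by norm_num) (by norm_num) hy hy
  have h2 := T.star_self_nonneg y
  set x := Real.sqrt (T.star y y) with hx
  have hxx : x ^ 2 = T.star y y := Real.sq_sqrt h2
  have h3 : α * T.cubicForm y y y ≤ |α| * (A * x * 2 * 2) := by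
    refine (le_abs_self _).trans ?_
    rw [abs_mul]; exact mul_le_mul_of_nonneg_left h1 (abs_nonneg _)
  have h4 : 0 ≤ α ^ 2 * T.area := mul_nonneg (sq_nonneg _) T.area_nonneg
  have h5 : α ^ 2 * A ^ 2 = (|α| * A) ^ 2 := by rw [mul_pow, sq_abs]
  unfold energy
  rw [mul_assoc 16, mul_assoc 8, h5, ← hxx]
  constructor
  · nlinarith [sq_nonneg (x / 2 - 4 * (|α| * A))]
  · nlinarith [sq_nonneg (x - 4 * (|α| * A))]

/-- A bound for the update in one step of the flow. -/
theorem CubicBound.sqrt_star_le {A κ δ l Y α τ : ℝ} {Γ : Set Plane} {y d : T.Deformation}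
    (hA : T.CubicBound A) (hA0 : 0 ≤ A) (hκ : 0 ≤ κ) (hδ : 0 < δ) (hl : δ ≤ l) (hτ : 0 < τ)
    (hY : Real.sqrt (T.star y y) ≤ Y) (hy : T.NodalBound y 2)
    (hd : T.NodalBound d (κ * Real.sqrt l * Real.sqrt (T.star d d)))
    (hupd : T.IsUpdate Γ α τ y d) :
    Real.sqrt (T.star d d) ≤
      ((Y + 4 * |α| * A) / Real.sqrt δ + 4 * |α| * A * Y * κ) * Real.sqrt l := by
  have hN2 := Real.sq_sqrt (T.star_self_nonneg d)
  set N := Real.sqrt (T.star d d) with hN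
  have hN0 : 0 ≤ N := Real.sqrt_nonneg _
  have hY0 : 0 ≤ Y := (Real.sqrt_nonneg _).trans hY
  set L := Real.sqrt l with hL
  have hsδ : 0 < Real.sqrt δ := Real.sqrt_pos.2 hδ
  have hL1 : Real.sqrt δ ≤ L := Real.sqrt_le_sqrt hl
  have hL0 : 0 < L := hsδ.trans_le hL1
  have heq := hupd.eq d hupd.mem
  have b0 : -T.star y d ≤ Y * N := by
    have := (abs_le.1 (T.abs_star_le y d)).1
    have := mul_le_mul_of_nonneg_right hY hN0
    linarith
  have b1 := hA d y y 2 2 (by norm_num) (by norm_num) hy hy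
  have b2 := hA y d y _ 2 (by positivity) (by norm_num) hd hy
  have b3 := hA y y d 2 _ (by norm_num) (by positivity) hy hd
  have hYs : ∀ c, 0 ≤ c → A * Real.sqrt (T.star y y) * c ≤ A * Y * c := fun c hc =>
    mul_le_mul_of_nonneg_right (mul_le_mul_of_nonneg_left hY hA0) hc
  have c2 := hYs (κ * L * N * 2) (by positivity)
  have b4 : α * (T.cubicForm d y y + T.cubicForm y d y + T.cubicForm y y d) ≤
      |α| * (4 * A * N + 4 * (A * Y * (κ * L * N))) := by
    refine (le_abs_self _).trans ?_
    rw [abs_mul]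
    refine mul_le_mul_of_nonneg_left ((abs_add_three _ _ _).trans ?_) (abs_nonneg _)
    linarith
  -- The equation is tested with `d`. The term with `τ` has a favourable sign, so the bound does not
  -- degenerate for small `τ`.
  have h1 : N * N ≤ (Y + |α| * (4 * A + 4 * (A * Y * (κ * L)))) * N := by
    have : 0 ≤ τ * T.star d d := mul_nonneg hτ.le (T.star_self_nonneg d)
    nlinarith
  have h2 : N ≤ Y + |α| * (4 * A + 4 * (A * Y * (κ * L))) := by
    rcases hN0.eq_or_lt with h | h
    · rw [← h]; positivity
    · exact le_of_mul_le_mul_right h1 h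
  refine h2.trans ?_
  have h3 : Y + 4 * |α| * A ≤ (Y + 4 * |α| * A) / Real.sqrt δ * L := by
    rw [div_mul_eq_mul_div, le_div_iff₀ hsδ]
    exact mul_le_mul_of_nonneg_left hL1 (by positivity)
  linarith

/-- The decay of the energy in one step of the flow. -/
theorem CubicBound.energy_step {A κ δ l Y K α τ : ℝ} {Γ : Set Plane} {y d : T.Deformation}
    (hA : T.CubicBound A) (hA0 : 0 ≤ A) (hκ : 0 ≤ κ) (hδ : 0 < δ) (hl : δ ≤ l) (hτ : 0 < τ)
    (hτl : τ * l ≤ 1) (hY : Real.sqrt (T.star y y) ≤ Y) (hy : T.NodalBound y 2)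
    (hd : T.NodalBound d (κ * Real.sqrt l * Real.sqrt (T.star d d)))
    (hK0 : 0 ≤ K) (hK : Real.sqrt (T.star d d) ≤ K * Real.sqrt l)
    (hupd : T.IsUpdate Γ α τ y d) :
    T.energy α (y + τ • d) + (1 - |α| * (4 * A * κ / Real.sqrt δ + A * Y * κ ^ 2 +
      A * K * κ ^ 2 / Real.sqrt δ) * τ * l) * (τ * T.star d d) ≤ T.energy α y := by
  have hN2 := Real.sq_sqrt (T.star_self_nonneg d)
  set N := Real.sqrt (T.star d d) with hN
  have hN0 : 0 ≤ N := Real.sqrt_nonneg _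
  have hY0 : 0 ≤ Y := (Real.sqrt_nonneg _).trans hY
  have hl0 : 0 < l := hδ.trans_le hl
  have hL2 := Real.sq_sqrt hl0.le
  set L := Real.sqrt l with hL
  have hsδ : 0 < Real.sqrt δ := Real.sqrt_pos.2 hδ
  have hL1 : Real.sqrt δ ≤ L := Real.sqrt_le_sqrt hl
  have hL0 : 0 < L := hsδ.trans_le hL1
  -- The terms with one factor $\sqrt l$ are brought to the common power `l` at the price of
  -- $\delta^{-1/2}$.
  have hLl : L ≤ l / Real.sqrt δ := by
    rw [le_div_iff₀ hsδ, ← hL2, sq]; exact mul_le_mul_of_nonneg_left hL1 hL0.le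
  have hβ : 0 ≤ κ * L * N := by positivity
  have b1 := hA d d y _ 2 hβ (by norm_num) hd hy
  have b2 := hA d y d 2 _ (by norm_num) hβ hy hd
  have b3 := hA y d d _ _ hβ hβ hd hd
  have b4 := hA d d d _ _ hβ hβ hd hd
  have c1 : A * N * (κ * L * N) * 2 ≤ 2 * (A * κ * N ^ 2) * (l / Real.sqrt δ) := by
    have := mul_le_mul_of_nonneg_left hLl (show 0 ≤ 2 * (A * κ * N ^ 2) by positivity)
    linarith
  have c3 : A * Real.sqrt (T.star y y) * (κ * L * N) * (κ * L * N) ≤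
      A * Y * κ ^ 2 * l * N ^ 2 := by
    have := mul_le_mul_of_nonneg_right (mul_le_mul_of_nonneg_left hY hA0)
      (mul_nonneg hβ hβ)
    rw [← hL2]; linarith
  have hτL : τ * L ≤ 1 / Real.sqrt δ := by
    calc τ * L ≤ τ * (l / Real.sqrt δ) := mul_le_mul_of_nonneg_left hLl hτ.le
      _ = (τ * l) / Real.sqrt δ := by ring
      _ ≤ _ := div_le_div_of_nonneg_right hτl hsδ.le
  -- The term cubic in `d` has one norm too many. The crude bound `hK` and `τ * l ≤ 1` absorb it.
  have c4 : τ * (A * N * (κ * L * N) * (κ * L * N)) ≤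
      A * K * κ ^ 2 * l * N ^ 2 * (1 / Real.sqrt δ) := by
    calc τ * (A * N * (κ * L * N) * (κ * L * N)) = (τ * A * κ ^ 2 * L ^ 2 * N ^ 2) * N := by ring
      _ ≤ (τ * A * κ ^ 2 * L ^ 2 * N ^ 2) * (K * L) :=
        mul_le_mul_of_nonneg_left hK (by positivity)
      _ = (A * K * κ ^ 2 * l * N ^ 2) * (τ * L) := by rw [hL2]; ring
      _ ≤ _ := mul_le_mul_of_nonneg_left hτL (by positivity)
  have hrem : -(α * (T.cubicForm d d y + T.cubicForm d y d + T.cubicForm y d d +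
      τ * T.cubicForm d d d)) ≤ |α| * ((4 * A * κ / Real.sqrt δ + A * Y * κ ^ 2 +
      A * K * κ ^ 2 / Real.sqrt δ) * l * N ^ 2) := by
    refine (neg_le_abs _).trans ?_
    rw [abs_mul]
    refine mul_le_mul_of_nonneg_left ?_ (abs_nonneg _)
    refine (abs_add_le _ _).trans ((add_le_add_left (abs_add_three _ _ _) _).trans ?_)
    have b4' : |τ * T.cubicForm d d d| ≤ τ * (A * N * (κ * L * N) * (κ * L * N)) := by
      rw [abs_mul, abs_of_pos hτ]; exact mul_le_mul_of_nonneg_left b4 hτ.le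
    have e : (4 * A * κ / Real.sqrt δ + A * Y * κ ^ 2 + A * K * κ ^ 2 / Real.sqrt δ) * l * N ^ 2 =
        4 * (A * κ * N ^ 2) * (l / Real.sqrt δ) + A * Y * κ ^ 2 * l * N ^ 2 +
          A * K * κ ^ 2 * l * N ^ 2 * (1 / Real.sqrt δ) := by ring
    rw [e]
    linarith
  -- This equation turns the first-order part of the expansion into $-\tau(1+\tau)\|d\|_*^2$, and
  -- half of $\tau^2\|d\|_*^2$ compensates the quadratic term.
  have heq := hupd.eq d hupd.mem
  rw [energy_add_smul]
  have h5 := mul_le_mul_of_nonneg_left hrem (sq_nonneg τ)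
  rw [hN2] at h5
  have h6 : 0 ≤ τ ^ 2 * T.star d d := mul_nonneg (sq_nonneg _) (T.star_self_nonneg d)
  nlinarith

/-! ### The iterates: isometry violation and energy decay -/

variable (T)

/-- The mixed terms are the linearized isometry constraint and cancel. The violation is thus of
second order and can be summed against the dissipation. -/
theorem gram_step {Γ : Set Plane} {y d : T.Deformation} (hd : d ∈ T.TangentSpace Γ y) (τ : ℝ)
    (t : Fin T.n) (i : Fin 3) :
    (T.nodalGrad (y + τ • d) t i).transpose * T.nodalGrad (y + τ • d) t i =
      (T.nodalGrad y t i).transpose * T.nodalGrad y t i +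
        τ ^ 2 • ((T.nodalGrad d t i).transpose * T.nodalGrad d t i) := by
  have h := hd.2 t i
  rw [nodalGrad_add, nodalGrad_smul, Matrix.transpose_add, Matrix.transpose_smul, Matrix.add_mul,
    Matrix.mul_add, Matrix.mul_add, Matrix.smul_mul, Matrix.mul_smul, Matrix.smul_mul,
    Matrix.mul_smul, smul_smul, ← sq]
  have h2 : τ • ((T.nodalGrad y t i).transpose * T.nodalGrad d t i) +
      τ • ((T.nodalGrad d t i).transpose * T.nodalGrad y t i) = 0 := by
    rw [← smul_add, add_comm, h, smul_zero]
  rw [add_assoc, ← add_assoc (τ • _), h2, zero_add]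

theorem succ_eq {τ : ℝ} (hτ : 0 < τ) (y : ℕ → T.Deformation) (k : ℕ) :
    y (k + 1) = y k + τ • T.dt τ y k := by
  rw [dt, smul_smul, mul_inv_cancel₀ hτ.ne', one_smul, add_sub_cancel]

/-- The isometry violation of the iterates. -/
theorem abs_gram_sub_one_le {Γ : Set Plane} {α τ B : ℝ} (hτ : 0 < τ) {y₀ : T.Deformation}
    {y : ℕ → T.Deformation} (hy : T.IsIsoFlow Γ α τ y₀ y)
    (h0 : ∀ t i, (T.nodalGrad y₀ t i).transpose * T.nodalGrad y₀ t i = 1)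
    (hB : ∀ k t i a j, T.nodalGrad (T.dt τ y k) t i a j ^ 2 ≤
      B * T.star (T.dt τ y k) (T.dt τ y k))
    (L : ℕ) (t : Fin T.n) (i : Fin 3) (j k : Fin 2) :
    |((T.nodalGrad (y L) t i).transpose * T.nodalGrad (y L) t i - 1 :
      Matrix (Fin 2) (Fin 2) ℝ) j k| ≤
      3 * B * τ * (τ * ∑ k ∈ Finset.range L, T.star (T.dt τ y k) (T.dt τ y k)) := by
  induction L with
  | zero => rw [hy.init, h0]; simp
  | succ L ih =>
    rw [T.succ_eq hτ y L, T.gram_step (hy.step L).mem, add_sub_right_comm, Matrix.add_apply,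
      Finset.sum_range_succ]
    refine (abs_add_le _ _).trans ?_
    have h1 : |(τ ^ 2 • ((T.nodalGrad (T.dt τ y L) t i).transpose *
        T.nodalGrad (T.dt τ y L) t i)) j k| ≤
        τ ^ 2 * (3 * (B * T.star (T.dt τ y L) (T.dt τ y L))) := by
      rw [Matrix.smul_apply, smul_eq_mul, abs_mul, abs_of_nonneg (sq_nonneg τ)]
      refine mul_le_mul_of_nonneg_left ?_ (sq_nonneg _)
      rw [Matrix.mul_apply, Fin.sum_univ_three]
      simp only [Matrix.transpose_apply]
      have h2 : ∀ a, |T.nodalGrad (T.dt τ y L) t i a j * T.nodalGrad (T.dt τ y L) t i a k| ≤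
          B * T.star (T.dt τ y L) (T.dt τ y L) := by
        intro a
        have e1 := hB L t i a j
        have e2 := hB L t i a k
        rw [abs_mul]
        nlinarith [sq_abs (T.nodalGrad (T.dt τ y L) t i a j),
          sq_abs (T.nodalGrad (T.dt τ y L) t i a k),
          sq_nonneg (|T.nodalGrad (T.dt τ y L) t i a j| - |T.nodalGrad (T.dt τ y L) t i a k|)]
      refine (abs_add_three _ _ _).trans ?_
      linarith [h2 0, h2 1, h2 2]
    linarith

/-- The columns of the nodal gradient have squared length at most 1 + 3. This is the origin of the
bound 2 for all iterates. -/
theorem nodalBound_of_gram {y : T.Deformation}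
    (h : ∀ t i j, |((T.nodalGrad y t i).transpose * T.nodalGrad y t i - 1 :
      Matrix (Fin 2) (Fin 2) ℝ) j j| ≤ 3) : T.NodalBound y 2 := by
  intro t i a j
  have h1 := (abs_le.1 (h t i j)).2
  rw [Matrix.sub_apply, Matrix.one_apply_eq, Matrix.mul_apply] at h1
  simp only [Matrix.transpose_apply] at h1
  have h2 : T.nodalGrad y t i a j * T.nodalGrad y t i a j ≤
      ∑ a, T.nodalGrad y t i a j * T.nodalGrad y t i a j :=
    Finset.single_le_sum (f := fun a => T.nodalGrad y t i a j * T.nodalGrad y t i a j)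
      (fun a _ => mul_self_nonneg _) (Finset.mem_univ a)
  refine abs_le_of_sq_le_sq ?_ (by norm_num)
  nlinarith

/-- The iterates of the flow exist and are unique. -/
theorem existsUnique_isIsoFlow {Γ : Set Plane} {α τ : ℝ} (hτ : 0 < τ)
    (hupd : ∀ y, ∃! d, T.IsUpdate Γ α τ y d) (y₀ : T.Deformation) :
    ∃! y : ℕ → T.Deformation, T.IsIsoFlow Γ α τ y₀ y := by
  choose D hD hDu using hupd
  set y : ℕ → T.Deformation := fun k => Nat.rec y₀ (fun _ z => z + τ • D z) k with hy
  have hdt : ∀ k, T.dt τ y k = D (y k) := fun k => by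
    have : y (k + 1) = y k + τ • D (y k) := rfl
    rw [dt, this, add_sub_cancel_left, smul_smul, inv_mul_cancel₀ hτ.ne', one_smul]
  refine ⟨y, ⟨rfl, fun k => by rw [hdt]; exact hD _⟩, fun z hz => ?_⟩
  funext k
  induction k with
  | zero => exact hz.init
  | succ k ih =>
    rw [T.succ_eq hτ z k, T.succ_eq hτ y k, hdt, hDu _ _ (hz.step k), ih]

/-- The energy decay and the bounds of the iterates of the flow. -/
theorem flow_decay {A κ δ l M α τ : ℝ} {Γ : Set Plane} (hA : T.CubicBound A) (hA0 : 0 ≤ A)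
    (hκ : 0 ≤ κ) (hδ : 0 < δ) (hl : δ ≤ l) (hM : 0 ≤ M) (hτ : 0 < τ)
    {Y K C₀ : ℝ} (hY : Y = Real.sqrt (4 * M + 64 * α ^ 2 * A ^ 2))
    (hK : K = (Y + 4 * |α| * A) / Real.sqrt δ + 4 * |α| * A * Y * κ)
    (hC₀ : C₀ = |α| * (4 * A * κ / Real.sqrt δ + A * Y * κ ^ 2 + A * K * κ ^ 2 / Real.sqrt δ))
    (hτl : (1 + 2 * C₀ + 3 * κ ^ 2 * (2 * (M + 8 * α ^ 2 * A ^ 2) + K ^ 2)) * τ * l ≤ 1)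
    (hsob : ∀ w, T.VanishesOn Γ w → ∀ t i a j, T.nodalGrad w t i a j ^ 2 ≤ κ ^ 2 * l * T.star w w)
    {y₀ : T.Deformation} (hE : T.energy α y₀ ≤ M)
    (h0 : ∀ t i, (T.nodalGrad y₀ t i).transpose * T.nodalGrad y₀ t i = 1)
    {y : ℕ → T.Deformation} (hy : T.IsIsoFlow Γ α τ y₀ y) (L : ℕ) :
    T.NodalBound (y L) 2 ∧ T.energy α (y L) + (1 - C₀ * τ * l) *
      (τ * ∑ k ∈ Finset.range L, T.star (T.dt τ y k) (T.dt τ y k)) ≤ T.energy α y₀ := by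
  have hl0 : 0 < l := hδ.trans_le hl
  have hsδ : 0 < Real.sqrt δ := Real.sqrt_pos.2 hδ
  have hY0 : 0 ≤ Y := hY ▸ Real.sqrt_nonneg _
  have hK0 : 0 ≤ K := by rw [hK]; positivity
  have hC₀0 : 0 ≤ C₀ := by rw [hC₀]; positivity
  set P := 3 * κ ^ 2 * (2 * (M + 8 * α ^ 2 * A ^ 2) + K ^ 2) with hP
  have hP0 : 0 ≤ P := by positivity
  have hτl0 : 0 < τ * l := mul_pos hτ hl0
  have hτl1 : τ * l ≤ 1 := by nlinarith
  have hτlC : C₀ * τ * l ≤ 1 / 2 := by nlinarith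
  have hτlP : P * (τ * l) ≤ 1 := by nlinarith
  set S : ℕ → ℝ := fun L => τ * ∑ k ∈ Finset.range L, T.star (T.dt τ y k) (T.dt τ y k) with hS
  have hB : ∀ k t i a j, T.nodalGrad (T.dt τ y k) t i a j ^ 2 ≤
      κ ^ 2 * l * T.star (T.dt τ y k) (T.dt τ y k) :=
    fun k t i a j => hsob _ (hy.step k).mem.1 t i a j
  have hgram := T.abs_gram_sub_one_le hτ hy h0 hB
  -- The energy step needs the nodal bound of the current iterate, and the next nodal bound needs
  -- the dissipation controlled so far.
  induction L with
  | zero =>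
    refine ⟨T.nodalBound_of_gram fun t i j => (hgram 0 t i j j).trans (by simp), ?_⟩
    rw [hy.init]; simp
  | succ L ih =>
    obtain ⟨ihB, ihE⟩ := ih
    set d := T.dt τ y L with hd
    have hS0 : 0 ≤ S L := mul_nonneg hτ.le (Finset.sum_nonneg fun _ _ => T.star_self_nonneg _)
    have hEL : T.energy α (y L) ≤ M := by
      have : 0 ≤ (1 - C₀ * τ * l) * S L := mul_nonneg (by linarith) hS0
      linarith
    obtain ⟨hlow1, hlow2⟩ := hA.energy_ge α ihB
    have hYL : Real.sqrt (T.star (y L) (y L)) ≤ Y := by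
      rw [hY]; exact Real.sqrt_le_sqrt (by linarith)
    have hdB : T.NodalBound d (κ * Real.sqrt l * Real.sqrt (T.star d d)) := by
      intro t i a j
      refine abs_le_of_sq_le_sq ?_ (by positivity)
      rw [mul_pow, mul_pow, Real.sq_sqrt hl0.le, Real.sq_sqrt (T.star_self_nonneg d)]
      exact hB L t i a j
    have hdK : Real.sqrt (T.star d d) ≤ K * Real.sqrt l := by
      rw [hK]
      exact hA.sqrt_star_le hA0 hκ hδ hl hτ hYL ihB hdB (hy.step L)
    have hstep := hA.energy_step hA0 hκ hδ hl hτ hτl1 hYL ihB hdB hK0 hdK (hy.step L)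
    rw [← hC₀, ← T.succ_eq hτ y L] at hstep
    have hSsucc : S (L + 1) = S L + τ * T.star d d := by
      simp only [hS, Finset.sum_range_succ, mul_add, hd]
    -- The lower energy bound is not yet available at the new iterate. The earlier dissipation is
    -- therefore bounded through the energy at `y L`, and the last summand by the crude bound `K ^
    -- 2`.
    refine ⟨T.nodalBound_of_gram fun t i j => (hgram (L + 1) t i j j).trans ?_, ?_⟩
    · change 3 * (κ ^ 2 * l) * τ * S (L + 1) ≤ 3
      have h1 : S L ≤ 2 * (M + 8 * α ^ 2 * A ^ 2) := by nlinarith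
      have h2 : T.star d d ≤ K ^ 2 * l := by
        have := pow_le_pow_left₀ (Real.sqrt_nonneg _) hdK 2
        rwa [mul_pow, Real.sq_sqrt (T.star_self_nonneg d), Real.sq_sqrt hl0.le] at this
      have h3 : τ * T.star d d ≤ K ^ 2 := by
        calc τ * T.star d d ≤ τ * (K ^ 2 * l) := mul_le_mul_of_nonneg_left h2 hτ.le
          _ = K ^ 2 * (τ * l) := by ring
          _ ≤ K ^ 2 * 1 := mul_le_mul_of_nonneg_left hτl1 (sq_nonneg _)
          _ = K ^ 2 := mul_one _
      have h4 : S (L + 1) ≤ 2 * (M + 8 * α ^ 2 * A ^ 2) + K ^ 2 := by rw [hSsucc]; linarith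
      have h5 : 3 * (κ ^ 2 * l) * τ * S (L + 1) ≤ P * (τ * l) := by
        have := mul_le_mul_of_nonneg_left h4 (show 0 ≤ 3 * (κ ^ 2 * l) * τ by positivity)
        refine this.trans (le_of_eq ?_); rw [hP]; ring
      linarith
    · change _ + _ * S (L + 1) ≤ _
      change _ + _ * S L ≤ _ at ihE
      rw [hSsucc]
      linarith

theorem energy_le_of_decay {c α τ : ℝ} (hτ : 0 < τ) {y₀ : T.Deformation}
    {y : ℕ → T.Deformation} {L : ℕ} (hc : c ≤ 1 / 2)
    (h : T.energy α (y L) + (1 - c) *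
      (τ * ∑ k ∈ Finset.range L, T.star (T.dt τ y k) (T.dt τ y k)) ≤ T.energy α y₀) :
    0 ≤ T.energy α y₀ - T.energy α (y L) := by
  have : 0 ≤ (1 - c) * (τ * ∑ k ∈ Finset.range L, T.star (T.dt τ y k) (T.dt τ y k)) :=
    mul_nonneg (by linarith)
      (mul_nonneg hτ.le (Finset.sum_nonneg fun _ _ => T.star_self_nonneg _))
  linarith

/-- `c ≤ 1 / 2` gives a factor 2 between dissipation and energy drop, so each entry of the Gram
defect is bounded with 6. The Frobenius norm of four such entries doubles this to 12. -/
theorem isometryViolation_le {κ l c α τ : ℝ} {Γ : Set Plane} (hτ : 0 < τ) (hl : 0 ≤ l)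
    {y₀ : T.Deformation} {y : ℕ → T.Deformation} (hy : T.IsIsoFlow Γ α τ y₀ y)
    (h0 : ∀ t i, (T.nodalGrad y₀ t i).transpose * T.nodalGrad y₀ t i = 1)
    (hsob : ∀ w, T.VanishesOn Γ w → ∀ t i a j, T.nodalGrad w t i a j ^ 2 ≤ κ ^ 2 * l * T.star w w)
    (L : ℕ) (hc : c ≤ 1 / 2)
    (h : T.energy α (y L) + (1 - c) *
      (τ * ∑ k ∈ Finset.range L, T.star (T.dt τ y k) (T.dt τ y k)) ≤ T.energy α y₀) :
    T.isometryViolation (y L) ≤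
      12 * κ ^ 2 * τ * l * (T.energy α y₀ - T.energy α (y L)) := by
  have hgram := T.abs_gram_sub_one_le hτ hy h0
    (fun k t i a j => hsob _ (hy.step k).mem.1 t i a j) L
  have hdiff := T.energy_le_of_decay hτ hc h
  have hS0 : 0 ≤ τ * ∑ k ∈ Finset.range L, T.star (T.dt τ y k) (T.dt τ y k) :=
    mul_nonneg hτ.le (Finset.sum_nonneg fun _ _ => T.star_self_nonneg _)
  have hSE : τ * ∑ k ∈ Finset.range L, T.star (T.dt τ y k) (T.dt τ y k) ≤
      2 * (T.energy α y₀ - T.energy α (y L)) := by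
    have := mul_nonneg (show 0 ≤ 1 / 2 - c by linarith) hS0
    linarith
  have h1 := mul_le_mul_of_nonneg_left hSE (show 0 ≤ 3 * (κ ^ 2 * l) * τ by positivity)
  have hb0 : 0 ≤ 12 * κ ^ 2 * τ * l * (T.energy α y₀ - T.energy α (y L)) :=
    mul_nonneg (by positivity) hdiff
  refine Real.iSup_le (fun z => Real.sqrt_le_iff.2 ⟨hb0, ?_⟩) hb0
  have h2 := fun j k => pow_le_pow_left₀ (abs_nonneg _) ((hgram z.1 z.2 j k).trans h1) 2
  simp only [sq_abs] at h2
  simp only [Fin.sum_univ_two]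
  linarith [h2 0 0, h2 0 1, h2 1 0, h2 1 1]

end Triangulation

end BilayerPlate

/-! ### Choice of the constants and proof of the theorem -/

theorem mainTheorem2 (ω Γ : Set BilayerPlate.Plane) (hω : IsOpen ω) (hωc : IsConnected ω)
    (hΓ : Γ ⊆ frontier ω) (hΓ0 : 0 < Measure.hausdorffMeasure 1 Γ)
    (α σ δ M : ℝ) (hδ : 0 < δ) (hM : 0 < M) :
    ∃ C C' : ℝ, 0 < C ∧ 0 < C' ∧
      ∀ T : BilayerPlate.Triangulation ω, T.ShapeRegular σ → T.Matches Γ →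
      δ ≤ |Real.log T.hmin| →
      ∀ (yD : BilayerPlate.Plane → Fin 3 → ℝ)
        (φD : BilayerPlate.Plane → Matrix (Fin 3) (Fin 2) ℝ),
      ∀ y₀ ∈ T.Admissible Γ yD φD, T.energy α y₀ ≤ M →
      ∀ τ : ℝ, 0 < τ →
        (∃! y : ℕ → T.Deformation, T.IsIsoFlow Γ α τ y₀ y) ∧
        ∀ y : ℕ → T.Deformation, T.IsIsoFlow Γ α τ y₀ y →
          (∀ k, ∃! d : T.Deformation, T.IsUpdate Γ α τ (y k) d) ∧
          (C * τ * |Real.log T.hmin| ≤ 1 → ∀ L : ℕ,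
            T.energy α (y L) + (1 - C * τ * |Real.log T.hmin|) *
              (τ * ∑ k ∈ Finset.range L, T.star (T.dt τ y k) (T.dt τ y k)) ≤ T.energy α y₀) ∧
          (τ ≤ (2 * C * |Real.log T.hmin|)⁻¹ → ∀ L : ℕ,
            T.isometryViolation (y L) ≤
              C' * τ * |Real.log T.hmin| * (T.energy α y₀ - T.energy α (y L)) ∧
            (M⁻¹ ≤ T.energy α y₀ →
              T.isometryViolation (y L) ≤ C' * τ * |Real.log T.hmin| * T.energy α y₀)) := by
  have hne : Γ.Nonempty := by
    rw [Set.nonempty_iff_ne_empty]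
    rintro rfl
    simp at hΓ0
  obtain ⟨Cs, hCs, hsob⟩ := BilayerPlate.Triangulation.exists_discrete_sobolev hω hωc hne σ δ hδ
  obtain ⟨κ, hκ⟩ : ∃ κ, κ = Real.sqrt Cs := ⟨_, rfl⟩
  have hκ2 : κ ^ 2 = Cs := by rw [hκ, Real.sq_sqrt hCs.le]
  have hκ0 : 0 < κ := by rw [hκ]; exact Real.sqrt_pos.2 hCs
  obtain ⟨A, hA⟩ : ∃ A, A = 288 * Real.sqrt (volume.real (closure ω)) := ⟨_, rfl⟩
  have hA0 : 0 ≤ A := by rw [hA]; positivity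
  obtain ⟨Y, hY⟩ : ∃ Y, Y = Real.sqrt (4 * M + 64 * α ^ 2 * A ^ 2) := ⟨_, rfl⟩
  obtain ⟨K, hK⟩ : ∃ K, K = (Y + 4 * |α| * A) / Real.sqrt δ + 4 * |α| * A * Y * κ := ⟨_, rfl⟩
  have hY0 : 0 ≤ Y := by rw [hY]; exact Real.sqrt_nonneg _
  have hK0 : 0 ≤ K := by rw [hK]; positivity
  obtain ⟨C₀, hC₀⟩ : ∃ C₀, C₀ = |α| * (4 * A * κ / Real.sqrt δ + A * Y * κ ^ 2 +
    A * K * κ ^ 2 / Real.sqrt δ) := ⟨_, rfl⟩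
  have hC₀0 : 0 ≤ C₀ := by rw [hC₀]; positivity
  obtain ⟨C₁, hC₁⟩ : ∃ C₁, C₁ = 8 * α ^ 2 * A ^ 2 := ⟨_, rfl⟩
  have hC₁0 : 0 ≤ C₁ := by rw [hC₁]; positivity
  obtain ⟨P, hP⟩ : ∃ P, P = 3 * κ ^ 2 * (2 * (M + C₁) + K ^ 2) := ⟨_, rfl⟩
  have hP0 : 0 ≤ P := by rw [hP]; positivity
  -- The three summands ensure `τ * l ≤ 1`, the bound 1/2 for `C₀ * τ * l`, and the closing of the
  -- induction for the nodal bound. The factor `1 + C₁ * M` serves the last claim.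
  refine ⟨1 + 2 * C₀ + P, 12 * κ ^ 2 * (1 + C₁ * M), by positivity, by positivity, ?_⟩
  intro T hreg hmatch hl yD φD y₀ hy₀ hE τ hτ
  have hsobT := hsob T hreg hmatch hl
  generalize |Real.log T.hmin| = l at hl hsobT ⊢
  have hl0 : 0 < l := hδ.trans_le hl
  have hsobT' : ∀ w, T.VanishesOn Γ w → ∀ t i a j,
      T.nodalGrad w t i a j ^ 2 ≤ κ ^ 2 * l * T.star w w := by
    intro w hw t i a j
    rw [hκ2]; exact hsobT w hw t i a j
  -- The Sobolev inequality turns a vanishing norm into vanishing nodal gradients, as the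
  -- definiteness lemma requires.
  have hupd : ∀ y : T.Deformation, ∃! d, T.IsUpdate Γ α τ y d := by
    refine fun y => T.existsUnique_isUpdate α hτ y fun w hw hw0 => ?_
    refine T.eq_zero_of_star_eq_zero hωc hmatch hne hw.1 hw0 fun t i => ?_
    ext a j
    have := hsobT' w hw.1 t i a j
    rw [hw0, mul_zero] at this
    exact pow_eq_zero_iff two_ne_zero |>.1 (le_antisymm this (sq_nonneg _))
  have hcub : T.CubicBound A := fun u v w β γ hβ hγ hv hw => by
    rw [hA]; exact T.abs_cubicForm_le u v w hβ hγ hv hw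
  have hdecay : (1 + 2 * C₀ + P) * τ * l ≤ 1 → ∀ y : ℕ → T.Deformation,
      T.IsIsoFlow Γ α τ y₀ y → ∀ L, _ := fun h y hy L =>
    T.flow_decay hcub hA0 hκ0.le hδ hl hM.le hτ hY hK hC₀ (by rw [← hC₁, ← hP]; exact h) hsobT' hE hy₀.2 hy L
  refine ⟨T.existsUnique_isIsoFlow hτ hupd y₀, fun y hy => ⟨fun k => hupd (y k), ?_, ?_⟩⟩
  · intro hC L
    refine le_trans ?_ (hdecay hC y hy L).2
    have hS0 : 0 ≤ τ * ∑ k ∈ Finset.range L, T.star (T.dt τ y k) (T.dt τ y k) :=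
      mul_nonneg hτ.le (Finset.sum_nonneg fun _ _ => T.star_self_nonneg _)
    have h1 : C₀ * τ * l ≤ (1 + 2 * C₀ + P) * τ * l := by
      have : C₀ ≤ 1 + 2 * C₀ + P := by linarith
      gcongr
    have := mul_le_mul_of_nonneg_right h1 hS0
    linarith
  · intro hτC L
    have hC : 2 * ((1 + 2 * C₀ + P) * τ * l) ≤ 1 := by
      have h0 : 0 < 2 * (1 + 2 * C₀ + P) * l := by positivity
      have := mul_le_mul_of_nonneg_left hτC h0.le
      rw [mul_inv_cancel₀ h0.ne'] at this
      linarith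
    obtain ⟨hB, hdec⟩ := hdecay (by linarith [show 0 ≤ (1 + 2 * C₀ + P) * τ * l by positivity])
      y hy L
    have hhalf : C₀ * τ * l ≤ 1 / 2 := by
      have : 0 ≤ (1 + C₀ + P) * τ * l := by positivity
      linarith
    have hviol := T.isometryViolation_le hτ hl0.le hy hy₀.2 hsobT' L hhalf hdec
    have hdiff := T.energy_le_of_decay hτ hhalf hdec
    have hE0 := (hcub.energy_ge α hB).2
    rw [← hC₁] at hE0
    generalize T.energy α (y L) = E at *
    generalize T.energy α y₀ = E₀ at *
    constructor
    · refine hviol.trans ?_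
      have : 0 ≤ 12 * κ ^ 2 * (C₁ * M) * τ * l * (E₀ - E) := by
        positivity
      linarith
    · intro hM1
      refine hviol.trans ?_
      have h1 : 1 ≤ E₀ * M := by
        have := mul_le_mul_of_nonneg_right hM1 hM.le
        rwa [inv_mul_cancel₀ hM.ne'] at this
      -- The final energy may be negative, but not below `-C₁`, and `C₁ ≤ C₁ * M * E₀` by the lower
      -- bound of the initial energy.
      have h2 : E₀ - E ≤ (1 + C₁ * M) * E₀ := by
        have := mul_le_mul_of_nonneg_left h1 hC₁0
        linarith
      have h3 := mul_le_mul_of_nonneg_left h2 (show 0 ≤ 12 * κ ^ 2 * τ * l by positivity)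
      linarith
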